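/- **Setting.** Let $\gamma\ge 1$, $b_0\in\mathbb R$. For $\gamma>1$ put $\rho(s)=\bigl(1+(\gamma-1)(b_0-\tfrac s2)\bigr)^{1/(\gamma-1)}$ (where the base is positive), and for $\gamma=1$ put $\rho(s)=e^{b_0-s/2}$; this is the density given by Bernoulli's law at squared speed $s$. Let $c(\rho)=\rho^{(\gamma-1)/2}$ be the sound speed and $c_*=\sqrt{\tfrac{2}{\gamma+1}(1+(\gamma-1)b_0)}$ the critical speed. Let $u^->c_*$, and $u^-<\sqrt{2(b_0+\frac1{\gamma-1})}$ if $\gamma>1$. Let $\Omega\subset\mathbb R^2$ be a bounded domain with $C^3$ boundary, $D=(-1,1)\times\Omega$, $\Sigma_i=\{i\}\times\Omega$ ($i=\pm1$), $\Gamma=[-1,1]\times\partial\Omega$ with outward unit normal $n$, and let $c_1\in(0,c_*)$. For $f\in C^1(\overline\Omega)$ let $S$, $D^-$, $D^+$ be the sets of $x\in D$ with $x_1=f(x_2,x_3)$, $x_1<f(x_2,x_3)$, $x_1>f(x_2,x_3)$ respectively. A *transonic shock solution* with exit speed $c_1$ and front $x_1=f(x_2,x_3)$ is a function $\varphi\in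 C^{0,1}(D)\cap C^2(D^-\cup D^+)$ with $D^2\varphi$ bounded on $D^-\cup D^+$ such that * on $D^-\cup D^+$ the base $1+(\gamma-1)(b_0-\frac12|\nabla\varphi|^2)$ is positive and $\nabla\cdot(\rho(|\nabla\varphi|^2)\nabla\varphi)=0$; * $|\nabla\varphi|>c(\rho(|\nabla\varphi|^2))$ in $D^-$ and $|\nabla\varphi|<c(\rho(|\nabla\varphi|^2))$ in $D^+$; * $\varphi=-u^-$ and $\partial_{x_1}\varphi=u^-$ on $\Sigma_{-1}$, $|\nabla\varphi|=c_1$ on $\Sigma_1$, and $\nabla\varphi\cdot n=0$ on $\Gamma$ (boundary values being limits from $D^-\cup D^+$); * on $S$ the limits $\nabla\varphi^\pm$ of $\nabla\varphi$ from $D^\pm$ exist and satisfy $\rho(|\nabla\varphi^+|^2)\nabla\varphi^+\cdot\nu=\rho(|\nabla\varphi^-|^2)\nabla\varphi^-\cdot\nu$, where $\nu=(1,-\partial_{x_2}f,-\partial_{x_3}f)$, and $\rho(|\nabla\varphi^+|^2)>\rho(|\nabla\varphi^-|^2)$, $|\nabla\varphi^+|<|\nabla\varphi^-|$. Assumption $(H_1)$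 is: $\partial_{x_1}\varphi\ge 0$ on $\Sigma_{-1}\cup\Sigma_1$. **Theorem 1.1.** There is exactly one $u^+\in(0,c_*)$ with $\rho((u^+)^2)\,u^+=\rho((u^-)^2)\,u^-$; it depends only on $u^-,b_0,\gamma$. A transonic shock solution with exit speed $c_1$ satisfying $(H_1)$ exists if and only if $c_1=u^+$. In that case the solutions are exactly, for $t\in(-1,1)$, the functions $$\varphi_t(x)=\begin{cases}u^-x_1,& x_1<t,\\ u^+(x_1-t)+u^-t,& x_1\ge t,\end{cases}$$ with flat front $f\equiv t$; thus the solution is unique modulo translation of the flow in the $x_1$-direction. -/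

import Mathlib

open Set Filter Topology

noncomputable section

namespace TransonicDuct

/-- The cross-sectional plane. -/
abbrev Plane : Type := EuclideanSpace ℝ (Fin 2)

/-- Physical space, with coordinates `(x₁, x₂, x₃) = (x 0, x 1, x 2)`. -/
abbrev Space : Type := EuclideanSpace ℝ (Fin 3)

/-- The cross-sectional coordinates `(x₂, x₃)` of a point. -/
def cross (x : Space) : Plane := !₂[x 1, x 2]

/-! ### The gas -/

/-- By Bernoulli's law `|∇φ|² / 2 + i(ρ) = b₀`, a flow of squared speed `s` has
`ρ ^ (γ - 1) = 1 + (γ - 1) (b₀ - s / 2)`; it is a genuine state (`ρ > 0`) iff this is positive.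
For `γ = 1` the quantity is the constant `1`. -/
def bernoulliBase (γ b₀ s : ℝ) : ℝ := 1 + (γ - 1) * (b₀ - s / 2)

/-- The density as a function of the squared speed, for `γ > 1` and for `γ = 1`. -/
def density (γ b₀ s : ℝ) : ℝ :=
  if γ = 1 then Real.exp (b₀ - s / 2) else bernoulliBase γ b₀ s ^ (1 / (γ - 1))

/-- The sound speed `c(ρ)`, where `c(ρ)² = p'(ρ) = ρ ^ (γ - 1)`. -/
def soundSpeed (γ ρ : ℝ) : ℝ := Real.sqrt (ρ ^ (γ - 1))

/-- The critical speed `c_*` (which is `1` for `γ = 1`). -/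
def criticalSpeed (γ b₀ : ℝ) : ℝ := Real.sqrt (2 / (γ + 1) * (1 + (γ - 1) * b₀))

/-- `v` is a subsonic speed with the same mass flux as the speed `u` (the Rankine-Hugoniot
condition at a normal shock), the densities being given by Bernoulli's law with the same `b₀`. -/
def IsDownstreamSpeed (γ b₀ u v : ℝ) : Prop :=
  0 < v ∧ v < criticalSpeed γ b₀ ∧
    density γ b₀ (v ^ 2) * v = density γ b₀ (u ^ 2) * u

/-- The mass flux `ρ(|w|²) w` of a flow of velocity `w`. -/
def massFlux (γ b₀ : ℝ) (w : Space) : Space := density γ b₀ (‖w‖ ^ 2) • w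

/-! ### The duct -/

/-- `g` is a local `C³` defining function of `Ω` at `p`: near `p`, `Ω = {g < 0}`, `∇g p ≠ 0`. -/
def IsDefiningFunctionAt (Ω : Set Plane) (p : Plane) (g : Plane → ℝ) : Prop :=
  gradient g p ≠ 0 ∧ ∃ U ∈ 𝓝 p, ContDiffOn ℝ 3 g U ∧ ∀ y ∈ U, y ∈ Ω ↔ g y < 0

/-- A bounded domain (nonempty, open, connected) of the plane with `C³` boundary. -/
structure IsCrossSection (Ω : Set Plane) : Prop where
  isOpen : IsOpen Ω
  isConnected : IsConnected Ω
  isBounded : Bornology.IsBounded Ω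
  boundary : ∀ p ∈ frontier Ω, ∃ g, IsDefiningFunctionAt Ω p g

/-- `n` is the outward unit normal of `Ω` at the boundary point `p`. -/
def IsOutwardUnitNormal (Ω : Set Plane) (p n : Plane) : Prop :=
  ∃ g, IsDefiningFunctionAt Ω p g ∧ n = ‖gradient g p‖⁻¹ • gradient g p

/-- The duct `D = (-1,1) × Ω`. -/
def duct (Ω : Set Plane) : Set Space := {x | x 0 ∈ Ioo (-1) 1 ∧ cross x ∈ Ω}

/-- The section `Σ_i = {i} × Ω`; the entry is `i = -1`, the exit is `i = 1`. -/
def endSection (Ω : Set Plane) (i : ℝ) : Set Space := {x | x 0 = i ∧ cross x ∈ Ω}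

/-- The lateral wall `Γ = [-1,1] × ∂Ω`. -/
def wall (Ω : Set Plane) : Set Space := {x | x 0 ∈ Icc (-1) 1 ∧ cross x ∈ frontier Ω}

/-- The shock-front `S` with equation `x₁ = f (x₂, x₃)`. -/
def front (Ω : Set Plane) (f : Plane → ℝ) : Set Space := {x ∈ duct Ω | x 0 = f (cross x)}

/-- The part `D⁻` of the duct ahead of the front. -/
def upstream (Ω : Set Plane) (f : Plane → ℝ) : Set Space := {x ∈ duct Ω | x 0 < f (cross x)}

/-- The part `D⁺` of the duct behind the front. -/
def downstream (Ω : Set Plane) (f : Plane → ℝ) : Set Space := {x ∈ duct Ω | f (cross x) < x 0}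

/-- `D⁻ ∪ D⁺`, where the flow is smooth. -/
def smoothRegion (Ω : Set Plane) (f : Plane → ℝ) : Set Space := upstream Ω f ∪ downstream Ω f

/-- A normal vector `(1, -∂₂f, -∂₃f)` of the front above `y`. -/
def frontNormal (f : Plane → ℝ) (y : Plane) : Space := !₂[1, -gradient f y 0, -gradient f y 1]

/-- The divergence of a vector field. -/
def divergence (F : Space → Space) (x : Space) : ℝ :=
  ∑ i : Fin 3, fderiv ℝ F x (EuclideanSpace.single i 1) i

/-! ### The problem -/

/-- `φ` is a transonic shock solution with front `x₁ = f (x₂, x₃)`, for the entry speed `u` and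
the exit speed `c₁`. Only the values of `φ` in `D` matter: `φ` and `∇φ` on the boundary of the
duct, and `∇φ` on the two sides of the front, are limits from `D⁻ ∪ D⁺`, `D⁻` and `D⁺`.
As usual for classical solutions, `C²` includes that the second derivatives are bounded. -/
structure IsTransonicShockSolution (γ b₀ u c₁ : ℝ) (Ω : Set Plane) (f : Plane → ℝ)
    (φ : Space → ℝ) : Prop where
  front_contDiff : ContDiffOn ℝ 1 f (closure Ω)
  lipschitz : ∃ K, LipschitzOnWith K φ (duct Ω)
  contDiff : ContDiffOn ℝ 2 φ (smoothRegion Ω f)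
  bounded_hessian : ∃ M, ∀ x ∈ smoothRegion Ω f, ‖fderiv ℝ (gradient φ) x‖ ≤ M
  density_pos : ∀ x ∈ smoothRegion Ω f, 0 < bernoulliBase γ b₀ (‖gradient φ x‖ ^ 2)
  supersonic : ∀ x ∈ upstream Ω f,
    soundSpeed γ (density γ b₀ (‖gradient φ x‖ ^ 2)) < ‖gradient φ x‖
  subsonic : ∀ x ∈ downstream Ω f,
    ‖gradient φ x‖ < soundSpeed γ (density γ b₀ (‖gradient φ x‖ ^ 2))
  equation : ∀ x ∈ smoothRegion Ω f, divergence (fun z => massFlux γ b₀ (gradient φ z)) x = 0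
  entry_potential : ∀ x ∈ endSection Ω (-1), Tendsto φ (𝓝[smoothRegion Ω f] x) (𝓝 (-u))
  entry_velocity : ∀ x ∈ endSection Ω (-1),
    Tendsto (fun z => gradient φ z 0) (𝓝[smoothRegion Ω f] x) (𝓝 u)
  exit_speed : ∀ x ∈ endSection Ω 1,
    Tendsto (fun z => ‖gradient φ z‖) (𝓝[smoothRegion Ω f] x) (𝓝 c₁)
  slip : ∀ x ∈ wall Ω, ∀ n, IsOutwardUnitNormal Ω (cross x) n →
    Tendsto (fun z => inner ℝ (gradient φ z) (!₂[0, n 0, n 1] : Space))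
      (𝓝[smoothRegion Ω f] x) (𝓝 0)
  /-- The one-sided limits `wm` and `wp` of the velocity exist on the front, and satisfy the
  Rankine-Hugoniot condition and the entropy condition. -/
  jump : ∀ x ∈ front Ω f, ∃ wm wp : Space,
    Tendsto (gradient φ) (𝓝[upstream Ω f] x) (𝓝 wm) ∧
    Tendsto (gradient φ) (𝓝[downstream Ω f] x) (𝓝 wp) ∧
    inner ℝ (massFlux γ b₀ wp) (frontNormal f (cross x)) =
      inner ℝ (massFlux γ b₀ wm) (frontNormal f (cross x)) ∧
    density γ b₀ (‖wm‖ ^ 2) < density γ b₀ (‖wp‖ ^ 2) ∧ ‖wp‖ < ‖wm‖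

/-- Assumption (H₁): `∂₁φ ≥ 0` on the entry and on the exit. -/
def NoBackflow (Ω : Set Plane) (f : Plane → ℝ) (φ : Space → ℝ) : Prop :=
  ∀ x ∈ endSection Ω (-1) ∪ endSection Ω 1, ∃ a : ℝ, 0 ≤ a ∧
    Tendsto (fun z => gradient φ z 0) (𝓝[smoothRegion Ω f] x) (𝓝 a)

/-- The potential `φ_t` with a flat front `x₁ = t` between the speeds `um` and `up`. -/
def flatShock (um up t : ℝ) (x : Space) : ℝ :=
  if x 0 < t then um * x 0 else up * (x 0 - t) + um * t

end TransonicDuct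

end

open Set Filter Topology

noncomputable section

namespace TransonicDuct

/-! ### The gas -/

/-! Write e₁ for `axis`, q = u e₁ for the incoming velocity, F(p) = ρ(|p|²) p for the mass flux and
Π for `fluxPotential`, so that ∇Π = F. The scalar flux s ↦ ρ(s²) s increases up to the critical
speed and decreases beyond it, which gives the unique downstream speed v. Every rigidity statement
comes from one principle, `IsDuctField.divergence_eq_zero`: a field between two graphs with
nonnegative divergence, no flux through the wall and nonpositive net flux out through the graphs is
divergence free.

Ahead of the front the equation is hyperbolic with x₁ as time. The current J(p) = (p₁ - u)(F(p) -
F(q)) - (Π(p) - Π(q) - F(q)·(p - q)) e₁ (`relCurrent`) is divergence free along irrotational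
solutions and, to leading order, quadratic in p - q. Its component along any direction in the cone
of the hyperbolic operator is negative definite near q. The normal of a shock with at most critical
speed behind it lies in that cone (`shock_normal_supersonic`), so the front may serve as the far
boundary in an energy estimate. With the weight ((s + d - x₁)₊)² this gives ∇φ = q on a slab of
fixed thickness (`upstream_step`); iteration covers D⁻.

Behind the front put W = φ - v x₁. Since ∇φ = q ahead, the Rankine-Hugoniot condition says that
F(∇φ) - F(v e₁) has no flux through the front, whatever its shape. For nondecreasing θ the
divergence of θ(W)(F(∇φ) - F(v e₁)) is θ'(W)(F(∇φ) - F(v e₁))·(∇φ - v e₁) ≥ 0, by strict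
monotonicity of F on subsonic states (`massFlux_strictMono`). Taking θ(s) = -((k - s)₊)², with k the
minimum of W on the closed exit, shows that W ≥ k. At a minimum point on the exit, the first order
condition and the slip condition make the velocity axial with component at most v. By (H₁) this
component is nonnegative, so c₁ ≤ v (`exit_speed_le`). Then θ(s) = s + A forces ∇φ = v e₁ behind the
front, hence c₁ = v. Continuity of φ across the front gives W = (u - v) f, and W is locally constant
behind the front, so f is constant. -/

lemma bernoulliBase_sub {γ b : ℝ} (hγ : 1 ≤ γ) (hc : 0 < criticalSpeed γ b) (s : ℝ) :
    bernoulliBase γ b s - s = (γ + 1) / 2 * (criticalSpeed γ b ^ 2 - s) := by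
  have h : 0 ≤ 2 / (γ + 1) * (1 + (γ - 1) * b) := (Real.sqrt_pos.1 hc).le
  have hg : γ + 1 ≠ 0 := by linarith
  rw [criticalSpeed, Real.sq_sqrt h, bernoulliBase]
  field_simp
  ring

lemma bernoulliBase_anti {γ : ℝ} (b : ℝ) (hγ : 1 ≤ γ) {s t : ℝ} (h : s ≤ t) :
    bernoulliBase γ b t ≤ bernoulliBase γ b s := by
  unfold bernoulliBase; nlinarith

lemma sq_lt_bernoulliBase {γ b s : ℝ} (hγ : 1 ≤ γ) (hc : 0 < criticalSpeed γ b) (hs : 0 ≤ s)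
    (h : s < criticalSpeed γ b) : s ^ 2 < bernoulliBase γ b (s ^ 2) := by
  have := bernoulliBase_sub hγ hc (s ^ 2)
  have h2 : 0 < (γ + 1) / 2 * (criticalSpeed γ b ^ 2 - s ^ 2) :=
    mul_pos (by linarith) (by nlinarith)
  linarith

lemma bernoulliBase_pos_of_le {γ b s : ℝ} (hγ : 1 ≤ γ) (hc : 0 < criticalSpeed γ b) (hs : 0 ≤ s)
    (h : s ≤ criticalSpeed γ b) : 0 < bernoulliBase γ b (s ^ 2) := by
  have h1 := bernoulliBase_sub hγ hc (criticalSpeed γ b ^ 2)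
  have h2 := bernoulliBase_anti b hγ (pow_le_pow_left₀ hs h 2)
  have := pow_pos hc 2
  linarith

lemma bernoulliBase_lt_sq {γ b s : ℝ} (hγ : 1 ≤ γ) (hc : 0 < criticalSpeed γ b)
    (h : criticalSpeed γ b < s) : bernoulliBase γ b (s ^ 2) < s ^ 2 := by
  have := bernoulliBase_sub hγ hc (s ^ 2)
  have h2 : 0 < (γ + 1) / 2 * (s ^ 2 - criticalSpeed γ b ^ 2) :=
    mul_pos (by linarith) (by nlinarith)
  linarith

lemma density_pos_of_base {γ b s : ℝ} (h : 0 < bernoulliBase γ b s) : 0 < density γ b s := by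
  unfold density; split_ifs
  · positivity
  · exact Real.rpow_pos_of_pos h _

lemma contDiffAt_density {γ b s : ℝ} {n : WithTop ℕ∞} (h : 0 < bernoulliBase γ b s) :
    ContDiffAt ℝ n (density γ b) s := by
  by_cases hg : γ = 1
  · have : density γ b = fun s => Real.exp (b - s / 2) := by
      ext s; simp [density, hg]
    rw [this]; fun_prop
  · have : density γ b = fun s => bernoulliBase γ b s ^ (1 / (γ - 1)) := by
      ext s; simp [density, hg]
    rw [this]
    refine ContDiffAt.rpow_const_of_ne ?_ h.ne'
    unfold bernoulliBase; fun_prop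

lemma hasDerivAt_bernoulliBase (γ b s : ℝ) :
    HasDerivAt (bernoulliBase γ b) (-((γ - 1) / 2)) s := by
  unfold bernoulliBase
  have := ((((hasDerivAt_id s).div_const 2).const_sub b).const_mul (γ - 1)).const_add 1
  convert! this using 1
  ring

lemma hasDerivAt_density {γ b s : ℝ} (h : 0 < bernoulliBase γ b s) :
    HasDerivAt (density γ b) (-(density γ b s / (2 * bernoulliBase γ b s))) s := by
  by_cases hg : γ = 1
  · have : density γ b = fun s => Real.exp (b - s / 2) := by
      ext s; simp [density, hg]
    rw [this]
    have := (((hasDerivAt_id s).div_const 2).const_sub b).exp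
    convert! this using 1
    simp [bernoulliBase, hg]; ring
  · have he : density γ b = fun s => bernoulliBase γ b s ^ (1 / (γ - 1)) := by
      ext s; simp [density, hg]
    have hg' : γ - 1 ≠ 0 := sub_ne_zero.2 hg
    have := (hasDerivAt_bernoulliBase γ b s).rpow_const (p := 1 / (γ - 1)) (Or.inl h.ne')
    rw [he]
    convert! this using 1
    rw [Real.rpow_sub_one h.ne']
    field_simp

/-- The base is the square of the sound speed. Through `bernoulliBase_sub`, the subsonic and
supersonic conditions thus become comparisons with `criticalSpeed`. -/
lemma soundSpeed_density {γ b s : ℝ} (h : 0 < bernoulliBase γ b s) :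
    soundSpeed γ (density γ b s) = Real.sqrt (bernoulliBase γ b s) := by
  unfold soundSpeed density
  split_ifs with hg
  · subst hg; simp [bernoulliBase]
  · have hg' : γ - 1 ≠ 0 := sub_ne_zero.2 hg
    rw [← Real.rpow_mul h.le, one_div_mul_cancel hg', Real.rpow_one]

lemma criticalSpeed_lt_of_supersonic {γ b s : ℝ} (hγ : 1 ≤ γ) (hc : 0 < criticalSpeed γ b)
    (hs : 0 ≤ s) (hb : 0 < bernoulliBase γ b (s ^ 2))
    (h : soundSpeed γ (density γ b (s ^ 2)) < s) : criticalSpeed γ b < s := by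
  rw [soundSpeed_density hb] at h
  rw [Real.sqrt_lt' ((Real.sqrt_nonneg _).trans_lt h)] at h
  by_contra! h'
  have := bernoulliBase_sub hγ hc (s ^ 2)
  have h2 : 0 ≤ (γ + 1) / 2 * (criticalSpeed γ b ^ 2 - s ^ 2) :=
    mul_nonneg (by linarith) (by nlinarith)
  linarith

lemma lt_criticalSpeed_of_subsonic {γ b s : ℝ} (hγ : 1 ≤ γ) (hc : 0 < criticalSpeed γ b)
    (hs : 0 ≤ s) (hb : 0 < bernoulliBase γ b (s ^ 2))
    (h : s < soundSpeed γ (density γ b (s ^ 2))) : s < criticalSpeed γ b := by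
  rw [soundSpeed_density hb, Real.lt_sqrt hs] at h
  by_contra! h'
  have := bernoulliBase_sub hγ hc (s ^ 2)
  have h2 : 0 ≤ (γ + 1) / 2 * (s ^ 2 - criticalSpeed γ b ^ 2) :=
    mul_nonneg (by linarith) (by nlinarith)
  linarith

lemma soundSpeed_lt_of_criticalSpeed_lt {γ b s : ℝ} (hγ : 1 ≤ γ) (hc : 0 < criticalSpeed γ b)
    (hb : 0 < bernoulliBase γ b (s ^ 2)) (h : criticalSpeed γ b < s) :
    soundSpeed γ (density γ b (s ^ 2)) < s := by
  rw [soundSpeed_density hb, Real.sqrt_lt' (hc.trans h)]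
  exact bernoulliBase_lt_sq hγ hc h

lemma lt_soundSpeed_of_lt_criticalSpeed {γ b s : ℝ} (hγ : 1 ≤ γ) (hc : 0 < criticalSpeed γ b)
    (hs : 0 ≤ s) (h : s < criticalSpeed γ b) : s < soundSpeed γ (density γ b (s ^ 2)) := by
  rw [soundSpeed_density (bernoulliBase_pos_of_le hγ hc hs h.le), Real.lt_sqrt hs]
  exact sq_lt_bernoulliBase hγ hc hs h

/-- The factor is one minus the squared Mach number; its change of sign at the critical speed gives
both monotonicity lemmas below. -/
lemma hasDerivAt_flux {γ b s : ℝ} (h : 0 < bernoulliBase γ b (s ^ 2)) :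
    HasDerivAt (fun s => density γ b (s ^ 2) * s)
      (density γ b (s ^ 2) * (1 - s ^ 2 / bernoulliBase γ b (s ^ 2))) s := by
  have h1 : HasDerivAt (fun s : ℝ => s ^ 2) (2 * s) s := by simpa using hasDerivAt_pow 2 s
  have := (HasDerivAt.comp (h₂ := density γ b) (h := fun s : ℝ => s ^ 2) s
    (hasDerivAt_density h) h1).mul (hasDerivAt_id s)
  convert! this using 1
  simp only [id, Function.comp]
  field_simp
  ring

lemma strictMonoOn_flux {γ b : ℝ} (hγ : 1 ≤ γ) (hc : 0 < criticalSpeed γ b) :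
    StrictMonoOn (fun s => density γ b (s ^ 2) * s) (Icc 0 (criticalSpeed γ b)) := by
  apply strictMonoOn_of_deriv_pos (convex_Icc _ _)
  · intro s hs
    exact (hasDerivAt_flux (bernoulliBase_pos_of_le hγ hc hs.1 hs.2)).continuousAt.continuousWithinAt
  · intro s hs
    rw [interior_Icc] at hs
    have hb := bernoulliBase_pos_of_le hγ hc hs.1.le hs.2.le
    rw [(hasDerivAt_flux hb).deriv]
    refine mul_pos (density_pos_of_base hb) ?_
    rw [sub_pos, div_lt_one hb]
    exact sq_lt_bernoulliBase hγ hc hs.1.le hs.2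

lemma strictAntiOn_flux {γ b u : ℝ} (hγ : 1 ≤ γ) (hc : 0 < criticalSpeed γ b)
    (hb : 0 < bernoulliBase γ b (u ^ 2)) :
    StrictAntiOn (fun s => density γ b (s ^ 2) * s) (Icc (criticalSpeed γ b) u) := by
  have key : ∀ s ∈ Icc (criticalSpeed γ b) u, 0 < bernoulliBase γ b (s ^ 2) := fun s hs =>
    hb.trans_le (bernoulliBase_anti b hγ (pow_le_pow_left₀ (hc.le.trans hs.1) hs.2 2))
  apply strictAntiOn_of_deriv_neg (convex_Icc _ _)
  · intro s hs
    exact (hasDerivAt_flux (key s hs)).continuousAt.continuousWithinAt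
  · intro s hs
    rw [interior_Icc] at hs
    have hb := key s ⟨hs.1.le, hs.2.le⟩
    rw [(hasDerivAt_flux hb).deriv]
    refine mul_neg_of_pos_of_neg (density_pos_of_base hb) ?_
    rw [sub_neg, one_lt_div hb]
    exact bernoulliBase_lt_sq hγ hc hs.1

/-- The flux at `u` is positive and below its maximum, attained at the critical speed, so the
increasing subsonic branch takes this value exactly once. -/
theorem existsUnique_isDownstreamSpeed {γ b u : ℝ} (hγ : 1 ≤ γ) (hc : 0 < criticalSpeed γ b)
    (hu : criticalSpeed γ b < u) (hb : 0 < bernoulliBase γ b (u ^ 2)) :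
    ∃! v, IsDownstreamSpeed γ b u v := by
  have hcont : ContinuousOn (fun s => density γ b (s ^ 2) * s) (Icc 0 (criticalSpeed γ b)) :=
    fun s hs => (hasDerivAt_flux
      (bernoulliBase_pos_of_le hγ hc hs.1 hs.2)).continuousAt.continuousWithinAt
  have h1 : density γ b (u ^ 2) * u
      < density γ b (criticalSpeed γ b ^ 2) * criticalSpeed γ b :=
    strictAntiOn_flux hγ hc hb (left_mem_Icc.2 hu.le) (right_mem_Icc.2 hu.le) hu
  have h0 : 0 < density γ b (u ^ 2) * u := mul_pos (density_pos_of_base hb) (hc.trans hu)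
  obtain ⟨v, hv, hv'⟩ := intermediate_value_Ioo hc.le hcont
    (show density γ b (u ^ 2) * u ∈ Ioo _ _ from ⟨by simpa using h0, h1⟩)
  refine ⟨v, ⟨hv.1, hv.2, hv'⟩, ?_⟩
  rintro w ⟨hw0, hw1, hw⟩
  exact (strictMonoOn_flux hγ hc).injOn ⟨hw0.le, hw1.le⟩ ⟨hv.1.le, hv.2.le⟩
    (show density γ b (w ^ 2) * w = density γ b (v ^ 2) * v from hw.trans hv'.symm)

lemma density_lt_density {γ b s t : ℝ} (hγ : 1 ≤ γ) (hst : s < t)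
    (hb : 0 < bernoulliBase γ b t) : density γ b t < density γ b s := by
  unfold density
  split_ifs with hg
  · exact Real.exp_lt_exp.2 (by linarith)
  · have hg' : 0 < γ - 1 := by
      rcases hγ.lt_or_eq with h | h
      · linarith
      · exact absurd h.symm hg
    refine Real.rpow_lt_rpow hb.le ?_ (by positivity)
    unfold bernoulliBase; nlinarith

/-- For `γ > 1` the upper bound on `u` is the vacuum speed. Staying below it means a positive base
at `u`, which in turn forces `1 + (γ - 1) b > 0`. -/
lemma criticalSpeed_pos_and_base_pos {γ b u : ℝ} (hγ : 1 ≤ γ) (hu : criticalSpeed γ b < u)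
    (hu' : 1 < γ → u < Real.sqrt (2 * (b + 1 / (γ - 1)))) :
    0 < criticalSpeed γ b ∧ 0 < bernoulliBase γ b (u ^ 2) := by
  have hu0 : 0 < u := (Real.sqrt_nonneg _).trans_lt hu
  rcases hγ.lt_or_eq with h | h
  · have h1 := hu' h
    have h2 : u ^ 2 < 2 * (b + 1 / (γ - 1)) := (Real.lt_sqrt hu0.le).1 h1
    have hg : 0 < γ - 1 := by linarith
    have h3 : (γ - 1) * u ^ 2 < 2 * ((γ - 1) * b + 1) := by
      have := mul_lt_mul_of_pos_left h2 hg
      have e : (γ - 1) * (2 * (b + 1 / (γ - 1))) = 2 * ((γ - 1) * b + 1) := by field_simp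
      linarith
    have h4 : 0 < (γ - 1) * u ^ 2 := by positivity
    refine ⟨Real.sqrt_pos.2 (mul_pos (by positivity) (by linarith)), ?_⟩
    unfold bernoulliBase; nlinarith
  · subst h
    refine ⟨Real.sqrt_pos.2 (by norm_num), by simp [bernoulliBase]⟩

/-! ### The mass flux -/

lemma hasStrictFDerivAt_norm_sq' (p : Space) :
    HasFDerivAt (fun p : Space => ‖p‖ ^ 2) (2 • innerSL ℝ p) p :=
  (hasStrictFDerivAt_norm_sq p).hasFDerivAt

/-- The derivative of the mass flux with respect to the velocity. -/
def fluxDeriv (γ b : ℝ) (p : Space) : Space →L[ℝ] Space :=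
  density γ b (‖p‖ ^ 2) • (ContinuousLinearMap.id ℝ Space -
    (bernoulliBase γ b (‖p‖ ^ 2))⁻¹ • (innerSL ℝ p).smulRight p)

lemma fluxDeriv_apply (γ b : ℝ) (p h : Space) : fluxDeriv γ b p h =
    density γ b (‖p‖ ^ 2) • (h - ((bernoulliBase γ b (‖p‖ ^ 2))⁻¹ * inner ℝ p h) • p) := by
  simp [fluxDeriv, smul_smul]

lemma hasFDerivAt_massFlux {γ b : ℝ} {p : Space} (h : 0 < bernoulliBase γ b (‖p‖ ^ 2)) :
    HasFDerivAt (massFlux γ b) (fluxDeriv γ b p) p := by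
  have h1 := (hasDerivAt_density h).comp_hasFDerivAt p (hasStrictFDerivAt_norm_sq' p)
  have h2 := h1.smul (hasFDerivAt_id p)
  unfold massFlux
  convert! h2 using 1
  ext1 k
  simp [fluxDeriv_apply, smul_smul, sub_eq_add_neg]
  congr 1
  field_simp

lemma contDiffAt_massFlux {γ b : ℝ} {p : Space} {n : WithTop ℕ∞}
    (h : 0 < bernoulliBase γ b (‖p‖ ^ 2)) : ContDiffAt ℝ n (massFlux γ b) p := by
  unfold massFlux
  exact ((contDiffAt_density h).comp p (contDiff_norm_sq ℝ).contDiffAt).smul contDiffAt_id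

/-- The potential of the mass flux; it is minus the pressure. -/
def fluxPotential (γ b : ℝ) (p : Space) : ℝ :=
  -(γ⁻¹ * (density γ b (‖p‖ ^ 2) * bernoulliBase γ b (‖p‖ ^ 2)))

/-- As a function of the squared speed, density times base has derivative -(1 + (γ - 1)) ρ / 2 = -γ
ρ / 2, whence the factor `γ⁻¹` in the potential. -/
lemma hasFDerivAt_fluxPotential {γ b : ℝ} {p : Space} (hγ : 1 ≤ γ)
    (h : 0 < bernoulliBase γ b (‖p‖ ^ 2)) :
    HasFDerivAt (fluxPotential γ b) (innerSL ℝ (massFlux γ b p)) p := by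
  have h1 := (((hasDerivAt_density h).mul (hasDerivAt_bernoulliBase γ b _)).const_mul
    γ⁻¹).neg.comp_hasFDerivAt p (hasStrictFDerivAt_norm_sq' p)
  unfold fluxPotential
  convert! h1 using 1
  ext1 k
  have : γ ≠ 0 := by linarith
  simp [massFlux]
  field_simp
  ring

lemma contDiffAt_fluxPotential {γ b : ℝ} {p : Space} {n : WithTop ℕ∞}
    (h : 0 < bernoulliBase γ b (‖p‖ ^ 2)) : ContDiffAt ℝ n (fluxPotential γ b) p := by
  unfold fluxPotential
  refine (contDiffAt_const.mul (((contDiffAt_density h).comp p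
    (contDiff_norm_sq ℝ).contDiffAt).mul ?_)).neg
  unfold bernoulliBase
  exact contDiffAt_const.add (contDiffAt_const.mul (contDiffAt_const.sub
    ((contDiff_norm_sq ℝ).contDiffAt.div_const 2)))

/-- The derivative of `massFlux` paired with the direction, along a segment. -/
lemma hasDerivAt_inner_massFlux {γ b : ℝ} {r d : Space} {s : ℝ}
    (h : 0 < bernoulliBase γ b (‖r + s • d‖ ^ 2)) :
    HasDerivAt (fun s : ℝ => inner ℝ (massFlux γ b (r + s • d)) d)
      (density γ b (‖r + s • d‖ ^ 2) * (‖d‖ ^ 2 -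
        (bernoulliBase γ b (‖r + s • d‖ ^ 2))⁻¹ * inner ℝ (r + s • d) d ^ 2)) s := by
  have h0 : HasDerivAt (fun s : ℝ => r + s • d) d s := by
    simpa using ((hasDerivAt_id s).smul_const d).const_add r
  have h1 := (hasFDerivAt_massFlux h).comp_hasDerivAt s h0
  have h2 := h1.inner ℝ (hasDerivAt_const s d)
  convert! h2 using 1
  simp only [Function.comp, fluxDeriv_apply, inner_zero_right, zero_add, inner_smul_left,
    inner_sub_left, real_inner_self_eq_norm_sq]
  simp
  left; ring

/-- This is ellipticity. The segment from `r` to `p` stays in the subsonic ball, and there the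
derivative ρ (|d|² - (x·d)²/c²) of the flux in direction `d` is positive by Cauchy-Schwarz and |x| <
c. -/
lemma massFlux_strictMono {γ b : ℝ} (hγ : 1 ≤ γ) (hc : 0 < criticalSpeed γ b) {p r : Space}
    (hp : ‖p‖ < criticalSpeed γ b) (hr : ‖r‖ < criticalSpeed γ b) (hne : p ≠ r) :
    0 < inner ℝ (massFlux γ b p - massFlux γ b r) (p - r) := by
  set d := p - r with hd
  have hd0 : 0 < ‖d‖ := norm_pos_iff.2 (sub_ne_zero.2 hne)
  have hx : ∀ s ∈ Icc (0 : ℝ) 1, ‖r + s • d‖ < criticalSpeed γ b := by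
    intro s hs
    have := (convex_ball (0 : Space) (criticalSpeed γ b)).add_smul_sub_mem
      (x := r) (y := p) (by simpa using hr) (by simpa using hp) hs
    simpa using this
  have hm : StrictMonoOn (fun s : ℝ => inner ℝ (massFlux γ b (r + s • d)) d) (Icc 0 1) := by
    apply strictMonoOn_of_deriv_pos (convex_Icc _ _)
    · intro s hs
      exact (hasDerivAt_inner_massFlux (bernoulliBase_pos_of_le hγ hc (norm_nonneg _)
        (hx s hs).le)).continuousAt.continuousWithinAt
    · intro s hs
      rw [interior_Icc] at hs
      have hx' := hx s ⟨hs.1.le, hs.2.le⟩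
      have hb := bernoulliBase_pos_of_le hγ hc (norm_nonneg _) hx'.le
      rw [(hasDerivAt_inner_massFlux hb).deriv]
      refine mul_pos (density_pos_of_base hb) ?_
      rw [sub_pos, inv_mul_lt_iff₀ hb]
      have h1 : inner ℝ (r + s • d) d ^ 2 ≤ ‖r + s • d‖ ^ 2 * ‖d‖ ^ 2 := by
        rw [← mul_pow, ← sq_abs]
        exact pow_le_pow_left₀ (abs_nonneg _) (abs_real_inner_le_norm _ _) 2
      have h2 := sq_lt_bernoulliBase hγ hc (norm_nonneg _) hx'
      have : 0 < ‖d‖ ^ 2 := by positivity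
      nlinarith
  have := hm (left_mem_Icc.2 zero_le_one) (right_mem_Icc.2 zero_le_one) zero_lt_one
  simp only [zero_smul, add_zero, one_smul] at this
  rw [show r + d = p by simp [hd]] at this
  rw [inner_sub_left]; linarith

/-- An oblique shock from a supersonic state `q` to a state `r` of at most critical speed is
supersonic in the normal direction `q - r` ahead of the front. -/
lemma shock_normal_supersonic {γ b : ℝ} (hγ : 1 ≤ γ) (hc : 0 < criticalSpeed γ b) {q r : Space}
    (hq : criticalSpeed γ b < ‖q‖) (hbq : 0 < bernoulliBase γ b (‖q‖ ^ 2))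
    (hr : ‖r‖ ≤ criticalSpeed γ b) (hpos : 0 < inner ℝ q (q - r))
    (hE : inner ℝ (massFlux γ b q - massFlux γ b r) (q - r) = 0) :
    bernoulliBase γ b (‖q‖ ^ 2) * ‖q - r‖ ^ 2 < inner ℝ q (q - r) ^ 2 := by
  set d := q - r with hd
  have hd0 : 0 < ‖d‖ := by
    refine norm_pos_iff.2 (sub_ne_zero.2 ?_)
    rintro rfl; linarith
  have hq' : r + (1 : ℝ) • d = q := by simp [hd]
  have hx : ∀ s ∈ Icc (0 : ℝ) 1, 0 < bernoulliBase γ b (‖r + s • d‖ ^ 2) := by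
    intro s hs
    have := (convex_closedBall (0 : Space) ‖q‖).add_smul_sub_mem
      (x := r) (y := q) (by simpa using hr.trans hq.le) (by simp) hs
    have h' : ‖r + s • d‖ ≤ ‖q‖ := by simpa using this
    exact hbq.trans_le (bernoulliBase_anti b hγ (pow_le_pow_left₀ (norm_nonneg _) h' 2))
  -- Rolle's theorem: the flux in direction `d` agrees at `r` and `q`, so at some intermediate state
  -- the velocity component along `d` is exactly sonic.
  obtain ⟨s, hs, hs0⟩ := exists_hasDerivAt_eq_zero
    (f := fun s : ℝ => inner ℝ (massFlux γ b (r + s • d)) d) zero_lt_one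
    (fun s hs => (hasDerivAt_inner_massFlux (hx s hs)).continuousAt.continuousWithinAt)
    (by simp only [hq']; simp [inner_sub_left] at hE ⊢; linarith)
    (fun s hs => hasDerivAt_inner_massFlux (hx s ⟨hs.1.le, hs.2.le⟩))
  have hbs := hx s ⟨hs.1.le, hs.2.le⟩
  have hs1 : bernoulliBase γ b (‖r + s • d‖ ^ 2) * ‖d‖ ^ 2 = inner ℝ (r + s • d) d ^ 2 := by
    have h1 := (mul_eq_zero.1 hs0).resolve_left (density_pos_of_base hbs).ne'
    field_simp at h1
    linarith
  -- This sign makes both the component along `d` squared and the total speed increase along the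
  -- segment.
  have hr0 : 0 < inner ℝ r d := by
    have hbr := bernoulliBase_pos_of_le hγ hc (norm_nonneg _) hr
    have h1 : density γ b (‖r‖ ^ 2) * inner ℝ r d = density γ b (‖q‖ ^ 2) * inner ℝ q d := by
      simp only [massFlux, inner_sub_left, inner_smul_left] at hE
      simp at hE; linarith
    have h2 := mul_pos (density_pos_of_base hbq) hpos
    rw [← h1] at h2
    exact (mul_pos_iff_of_pos_left (density_pos_of_base hbr)).1 h2
  have e1 : inner ℝ (r + s • d) d = inner ℝ r d + s * ‖d‖ ^ 2 := by
    rw [inner_add_left, inner_smul_left, real_inner_self_eq_norm_sq]; simp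
  have e2 : ‖r + s • d‖ ^ 2 = ‖r‖ ^ 2 + 2 * s * inner ℝ r d + s ^ 2 * ‖d‖ ^ 2 := by
    rw [norm_add_sq_real, inner_smul_right, norm_smul, mul_pow]; simp; ring
  have e3 : inner ℝ q d = inner ℝ r d + ‖d‖ ^ 2 := by
    conv_lhs => rw [← hq']
    rw [inner_add_left, inner_smul_left, real_inner_self_eq_norm_sq]; simp
  have e4 : ‖q‖ ^ 2 = ‖r‖ ^ 2 + 2 * inner ℝ r d + ‖d‖ ^ 2 := by
    conv_lhs => rw [← hq']
    rw [norm_add_sq_real, inner_smul_right, norm_smul, mul_pow]; simp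
  rw [e1, e2] at hs1
  rw [e3, e4]
  unfold bernoulliBase at hs1 ⊢
  have hA : 0 < ‖d‖ ^ 2 := by positivity
  set A := ‖d‖ ^ 2
  set m := inner ℝ r d
  have h5 : 0 < (1 - s) * A := mul_pos (by linarith [hs.2]) hA
  -- From the sonic state to `q` this is the gain in (x·d)²; multiplied by (γ - 1)/2 it is the loss
  -- in base times `A`. The two effects add up.
  have h6 : 0 < (1 - s) * A * (2 * m + (1 + s) * A) :=
    mul_pos h5 (by have := hs.1; positivity)
  nlinarith [mul_nonneg (sub_nonneg.2 hγ) h6.le]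

/-! ### Coordinates -/

/-- The unit vector along the axis of the duct. -/
def axis : Space := EuclideanSpace.single 0 1

/-- The point with axial coordinate `t` and cross-sectional coordinates `y`. -/
def lift (t : ℝ) (y : Plane) : Space := !₂[t, y 0, y 1]

lemma cross_add (x y : Space) : cross (x + y) = cross x + cross y := by
  ext i; fin_cases i <;> simp [cross]

lemma cross_smul (c : ℝ) (x : Space) : cross (c • x) = c • cross x := by
  ext i; fin_cases i <;> simp [cross]

lemma cross_sub (x y : Space) : cross (x - y) = cross x - cross y := by
  ext i; fin_cases i <;> simp [cross]

lemma cross_neg (x : Space) : cross (-x) = -cross x := by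
  ext i; fin_cases i <;> simp [cross]

/-- `cross` as a continuous linear map. -/
def crossL : Space →L[ℝ] Plane :=
  LinearMap.toContinuousLinearMap
    { toFun := cross, map_add' := cross_add, map_smul' := cross_smul }

@[simp] lemma crossL_apply (x : Space) : crossL x = cross x := rfl

/-- The inclusion of the cross-sectional plane as a continuous linear map. -/
def embed : Plane →L[ℝ] Space :=
  LinearMap.toContinuousLinearMap
    { toFun := fun y => lift 0 y
      map_add' := fun y z => by ext i; fin_cases i <;> simp [lift]
      map_smul' := fun c z => by ext i; fin_cases i <;> simp [lift] }

lemma embed_apply (y : Plane) : embed y = lift 0 y := rfl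

@[simp] lemma lift_zero (t : ℝ) (y : Plane) : lift t y 0 = t := rfl

@[simp] lemma cross_lift (t : ℝ) (y : Plane) : cross (lift t y) = y := by
  ext i; fin_cases i <;> rfl

@[simp] lemma lift_cross (x : Space) : lift (x 0) (cross x) = x := by
  ext i; fin_cases i <;> rfl

@[simp] lemma axis_zero : axis 0 = 1 := by simp [axis]

@[simp] lemma cross_axis : cross axis = 0 := by
  ext i; fin_cases i <;> simp [cross, axis]

@[simp] lemma embed_zero_coord (y : Plane) : embed y 0 = 0 := rfl

@[simp] lemma cross_embed (y : Plane) : cross (embed y) = y := cross_lift 0 y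

lemma space_ext {x y : Space} (h0 : x 0 = y 0) (h : cross x = cross y) : x = y := by
  rw [← lift_cross x, ← lift_cross y, h0, h]

lemma lift_eq (t : ℝ) (y : Plane) : lift t y = t • axis + embed y :=
  space_ext (by simp) (by simp [cross_add, cross_smul])

lemma continuous_cross : Continuous cross := crossL.continuous

lemma continuous_lift : Continuous fun z : ℝ × Plane => lift z.1 z.2 := by
  simp only [lift_eq]
  exact (continuous_fst.smul continuous_const).add (embed.continuous.comp continuous_snd)

lemma continuous_coord (i : Fin 3) : Continuous fun x : Space => x i :=
  (EuclideanSpace.proj i : Space →L[ℝ] ℝ).continuous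

lemma inner_eq_coord (x y : Space) :
    inner ℝ x y = x 0 * y 0 + inner ℝ (cross x) (cross y) := by
  simp [PiLp.inner_apply, Fin.sum_univ_succ, cross, mul_comm]

lemma norm_sq_eq_coord (x : Space) : ‖x‖ ^ 2 = x 0 ^ 2 + ‖cross x‖ ^ 2 := by
  rw [← real_inner_self_eq_norm_sq, inner_eq_coord, real_inner_self_eq_norm_sq]; ring

@[simp] lemma inner_axis (x : Space) : inner ℝ x axis = x 0 := by
  rw [inner_eq_coord]; simp

@[simp] lemma axis_inner (x : Space) : inner ℝ axis x = x 0 := by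
  rw [real_inner_comm, inner_axis]

@[simp] lemma norm_axis : ‖axis‖ = 1 := by simp [axis]

lemma inner_embed (x : Space) (y : Plane) : inner ℝ x (embed y) = inner ℝ (cross x) y := by
  rw [inner_eq_coord]; simp

lemma norm_embed (y : Plane) : ‖embed y‖ = ‖y‖ := by
  have := norm_sq_eq_coord (embed y)
  simp at this
  exact this

lemma abs_zero_le_norm (x : Space) : |x 0| ≤ ‖x‖ := by
  rw [← Real.norm_eq_abs]; exact PiLp.norm_apply_le x 0

lemma norm_cross_le (x : Space) : ‖cross x‖ ≤ ‖x‖ := by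
  refine le_of_sq_le_sq ?_ (norm_nonneg _)
  rw [norm_sq_eq_coord x]; nlinarith [sq_nonneg (x 0)]

lemma lift_sub_lift (s t : ℝ) (y : Plane) : lift s y - lift t y = (s - t) • axis := by
  rw [lift_eq, lift_eq, sub_smul]; abel

lemma norm_lift_sub_lift (s t : ℝ) (y : Plane) : ‖lift s y - lift t y‖ = |s - t| := by
  rw [lift_sub_lift, norm_smul]; simp

lemma frontNormal_zero (f : Plane → ℝ) (y : Plane) : frontNormal f y 0 = 1 := rfl

lemma cross_frontNormal (f : Plane → ℝ) (y : Plane) :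
    cross (frontNormal f y) = -gradient f y := by
  ext i; fin_cases i <;> rfl

lemma inner_frontNormal (f : Plane → ℝ) (y : Plane) (x : Space) :
    inner ℝ x (frontNormal f y) = x 0 - fderiv ℝ f y (cross x) := by
  rw [inner_eq_coord, cross_frontNormal, frontNormal_zero, inner_neg_right, mul_one,
    real_inner_comm, inner_gradient_left]
  ring

/-! ### Regions between graphs -/

/-- The region between the graphs of `a` and `b` over `Ω`. -/
def graphRegion (Ω : Set Plane) (a b : Plane → ℝ) : Set Space :=
  {x | cross x ∈ Ω ∧ a (cross x) < x 0 ∧ x 0 < b (cross x)}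

lemma lift_mem_graphRegion {Ω : Set Plane} {a b : Plane → ℝ} {t : ℝ} {y : Plane} :
    lift t y ∈ graphRegion Ω a b ↔ y ∈ Ω ∧ a y < t ∧ t < b y := by
  simp [graphRegion]

lemma isOpen_graphRegion {Ω : Set Plane} (hΩ : IsOpen Ω) {a b : Plane → ℝ}
    (ha : ContinuousOn a Ω) (hb : ContinuousOn b Ω) : IsOpen (graphRegion Ω a b) := by
  rw [isOpen_iff_mem_nhds]
  rintro x ⟨hx, h1, h2⟩
  have hc : ContinuousAt cross x := continuous_cross.continuousAt
  have ha' : ContinuousAt (fun x => a (cross x)) x :=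
    ContinuousAt.comp (g := a) (ha.continuousAt (hΩ.mem_nhds hx)) hc
  have hb' : ContinuousAt (fun x => b (cross x)) x :=
    ContinuousAt.comp (g := b) (hb.continuousAt (hΩ.mem_nhds hx)) hc
  have h0 : ContinuousAt (fun x : Space => x 0) x := (continuous_coord 0).continuousAt
  filter_upwards [hc.eventually (hΩ.mem_nhds hx), ha'.eventually_lt h0 h1,
    h0.eventually_lt hb' h2] with z hz h3 h4 using ⟨hz, h3, h4⟩

/-! ### The divergence -/

lemma divergence_smul {s : Space → ℝ} {V : Space → Space} {s' : Space →L[ℝ] ℝ} {x : Space}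
    (hs : HasFDerivAt s s' x) (hV : DifferentiableAt ℝ V x) :
    divergence (fun z => s z • V z) x = s x * divergence V x + s' (V x) := by
  have h := (hs.smul hV.hasFDerivAt).fderiv
  have e : V x = ∑ i : Fin 3, V x i • EuclideanSpace.single i (1 : ℝ) := by
    ext j; fin_cases j <;> simp [Fin.sum_univ_succ]
  unfold divergence
  rw [show (fun z => s z • V z) = s • V from rfl, h]
  conv_rhs => rw [e, map_sum]
  simp only [map_smul, smul_eq_mul, add_apply,
    ContinuousLinearMap.smulRight_apply, smul_apply, PiLp.add_apply,
    PiLp.smul_apply, Finset.sum_add_distrib, Finset.mul_sum]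
  congr 1
  exact Finset.sum_congr rfl fun i _ => mul_comm _ _

lemma divergence_eq_coord (V : Space → Space) (x : Space) :
    divergence V x = fderiv ℝ V x axis 0 +
      ∑ j : Fin 2, cross (fderiv ℝ V x (embed (EuclideanSpace.single j 1))) j := by
  have h0 : embed (EuclideanSpace.single 0 1) = EuclideanSpace.single 1 1 := by
    ext i; fin_cases i <;> simp [embed_apply, lift]
  have h1 : embed (EuclideanSpace.single 1 1) = EuclideanSpace.single 2 1 := by
    ext i; fin_cases i <;> simp [embed_apply, lift]
  simp [divergence, Fin.sum_univ_succ, axis, h0, h1, cross]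

section Flux

open MeasureTheory

/-! ### A planar divergence theorem -/

/-- The divergence of a planar vector field. -/
def planarDiv (H : Plane → Plane) (y : Plane) : ℝ :=
  ∑ j : Fin 2, fderiv ℝ H y (EuclideanSpace.single j 1) j

lemma measurable_planarDiv (H : Plane → Plane) : Measurable (planarDiv H) := by
  unfold planarDiv
  refine Finset.measurable_sum _ fun j _ => ?_
  exact (EuclideanSpace.proj j : Plane →L[ℝ] ℝ).continuous.measurable.comp
    (measurable_fderiv_apply_const ℝ H _)

/-- The derivative of a column flux will only be shown to be locally bounded; a finite subcover
makes the bound uniform on supports of test functions. -/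
lemma exists_bound_fderiv_of_isCompact {H : Plane → Plane} {K : Set Plane} (hK : IsCompact K)
    (hloc : ∀ y ∈ K, ∃ C, ∀ᶠ z in 𝓝 y, ‖fderiv ℝ H z‖ ≤ C) :
    ∃ C, ∀ z ∈ K, ‖fderiv ℝ H z‖ ≤ C := by
  refine hK.induction_on (p := fun s => ∃ C, ∀ z ∈ s, ‖fderiv ℝ H z‖ ≤ C) ⟨0, by simp⟩ ?_ ?_ ?_
  · rintro s t hst ⟨C, hC⟩
    exact ⟨C, fun z hz => hC z (hst hz)⟩
  · rintro s t ⟨C, hC⟩ ⟨C', hC'⟩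
    refine ⟨max C C', ?_⟩
    rintro z (hz | hz)
    · exact (hC z hz).trans (le_max_left _ _)
    · exact (hC' z hz).trans (le_max_right _ _)
  · intro y hy
    obtain ⟨C, hC⟩ := hloc y hy
    exact ⟨_, mem_nhdsWithin_of_mem_nhds hC, C, fun z hz => hz⟩

lemma integrable_mul_fderiv_coord {H : Plane → Plane} {Ω : Set Plane}
    (hloc : ∀ y ∈ Ω, ∃ C, ∀ᶠ z in 𝓝 y, ‖fderiv ℝ H z‖ ≤ C) {ψ : Plane → ℝ}
    (hψ : Continuous ψ) (hcs : HasCompactSupport ψ) (hsub : tsupport ψ ⊆ Ω) (v : Plane)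
    (j : Fin 2) (hv : ‖v‖ ≤ 1) : Integrable fun y => ψ y * fderiv ℝ H y v j := by
  obtain ⟨C, hC⟩ := exists_bound_fderiv_of_isCompact hcs fun y hy => hloc y (hsub hy)
  obtain ⟨B, hB⟩ := hψ.bounded_above_of_compact_support hcs
  have hm : Measurable fun y => ψ y * fderiv ℝ H y v j :=
    hψ.measurable.mul ((EuclideanSpace.proj j : Plane →L[ℝ] ℝ).continuous.measurable.comp
      (measurable_fderiv_apply_const ℝ H _))
  rw [← integrableOn_iff_integrable_of_support_subset (s := tsupport ψ)]
  · refine Measure.integrableOn_of_bounded (M := B * C) hcs.measure_lt_top.ne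
      hm.aestronglyMeasurable ?_
    refine (ae_restrict_iff' (isClosed_tsupport ψ).measurableSet).2 (ae_of_all _ fun y hy => ?_)
    rw [norm_mul]
    have h1 : ‖fderiv ℝ H y v j‖ ≤ C := by
      refine (PiLp.norm_apply_le _ j).trans (((fderiv ℝ H y).le_opNorm v).trans ?_)
      have := hC y hy
      nlinarith [norm_nonneg (fderiv ℝ H y), norm_nonneg v]
    exact mul_le_mul (hB y) h1 (norm_nonneg _) ((norm_nonneg _).trans (hB y))
  · intro y hy
    exact subset_tsupport ψ (left_ne_zero_of_mul hy)

lemma integrable_mul_planarDiv {H : Plane → Plane} {Ω : Set Plane}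
    (hloc : ∀ y ∈ Ω, ∃ C, ∀ᶠ z in 𝓝 y, ‖fderiv ℝ H z‖ ≤ C) {ψ : Plane → ℝ}
    (hψ : Continuous ψ) (hcs : HasCompactSupport ψ) (hsub : tsupport ψ ⊆ Ω) :
    Integrable fun y => ψ y * planarDiv H y := by
  simp only [planarDiv, Finset.mul_sum]
  exact integrable_finsetSum _ fun j _ =>
    integrable_mul_fderiv_coord hloc hψ hcs hsub _ j (by simp)

lemma continuous_mul_of_tsupport {Ω : Set Plane} (hΩ : IsOpen Ω) {ψ k : Plane → ℝ}
    (hψ : Continuous ψ) (hsub : tsupport ψ ⊆ Ω) (hk : ContinuousOn k Ω) :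
    Continuous fun y => ψ y * k y :=
  (hψ.continuousOn.mul hk).continuous_of_tsupport_subset hΩ
    ((tsupport_mul_subset_left (f := ψ) (g := k)).trans hsub)

lemma clm_apply_eq_sum (l : Plane →L[ℝ] ℝ) (w : Plane) :
    l w = ∑ j : Fin 2, l (EuclideanSpace.single j 1) * w j := by
  have e : w = ∑ i : Fin 2, w i • EuclideanSpace.single i (1 : ℝ) := by
    ext j; fin_cases j <;> simp [Fin.sum_univ_succ]
  conv_lhs => rw [e, map_sum]
  exact Finset.sum_congr rfl fun i _ => by rw [map_smul, smul_eq_mul, mul_comm]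

lemma integral_mul_planarDiv {H : Plane → Plane} {Ω : Set Plane} (hΩ : IsOpen Ω)
    (hd : ∀ y ∈ Ω, DifferentiableAt ℝ H y)
    (hloc : ∀ y ∈ Ω, ∃ C, ∀ᶠ z in 𝓝 y, ‖fderiv ℝ H z‖ ≤ C) {ψ : Plane → ℝ}
    (hψ : ContDiff ℝ 1 ψ) (hcs : HasCompactSupport ψ) (hsub : tsupport ψ ⊆ Ω) :
    ∫ y, ψ y * planarDiv H y = -∫ y, fderiv ℝ ψ y (H y) := by
  have hHc : ∀ j : Fin 2, ContinuousOn (fun y => H y j) Ω := fun j y hy =>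
    ((EuclideanSpace.proj j : Plane →L[ℝ] ℝ).continuous.continuousAt.comp
      (hd y hy).continuousAt).continuousWithinAt
  have hψ' : ∀ j : Fin 2, Continuous fun y => fderiv ℝ ψ y (EuclideanSpace.single j 1) :=
    fun j => (hψ.continuous_fderiv one_ne_zero).clm_apply continuous_const
  have hts : ∀ j : Fin 2,
      tsupport (fun y => fderiv ℝ ψ y (EuclideanSpace.single j 1)) ⊆ tsupport ψ := fun j =>
    tsupport_fderiv_apply_subset ℝ _
  have hI1 : ∀ j : Fin 2, Integrable fun y => fderiv ℝ ψ y (EuclideanSpace.single j 1) * H y j :=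
    fun j => (continuous_mul_of_tsupport hΩ (hψ' j) ((hts j).trans hsub)
      (hHc j)).integrable_of_hasCompactSupport ((hcs.fderiv_apply ℝ _).mul_right)
  have hI2 : ∀ j : Fin 2, Integrable fun y => ψ y * fderiv ℝ H y (EuclideanSpace.single j 1) j :=
    fun j => integrable_mul_fderiv_coord hloc hψ.continuous hcs hsub _ j (by simp)
  have hI3 : ∀ j : Fin 2, Integrable fun y => ψ y * H y j := fun j =>
    (continuous_mul_of_tsupport hΩ hψ.continuous hsub
      (hHc j)).integrable_of_hasCompactSupport hcs.mul_right
  simp only [planarDiv, Finset.mul_sum, clm_apply_eq_sum (fderiv ℝ ψ _) (H _)]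
  rw [integral_finsetSum _ fun j _ => hI2 j, integral_finsetSum _ fun j _ => hI1 j,
    ← Finset.sum_neg_distrib]
  refine Finset.sum_congr rfl fun j _ => ?_
  -- Integration by parts on the whole plane: `H` has to be differentiable only on the support of
  -- `ψ`, so its values outside `Ω` play no role.
  refine integral_bilinear_hasFDerivAt_right_eq_neg_left_of_integrable
    (B := ContinuousLinearMap.mul ℝ ℝ) (f := ψ) (f' := fderiv ℝ ψ) (g := fun y => H y j)
    (g' := fun y => (EuclideanSpace.proj j : Plane →L[ℝ] ℝ).comp (fderiv ℝ H y))
    (v := EuclideanSpace.single j 1) (hI1 j) (hI2 j) (hI3 j) ?_ ?_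
  · intro x _
    exact (hψ.differentiable one_ne_zero x).hasFDerivAt
  · intro x hx
    exact (EuclideanSpace.proj j : Plane →L[ℝ] ℝ).hasFDerivAt.comp x (hd x (hsub hx)).hasFDerivAt

/-- `g` is a defining function of `Ω` on the ball of radius `r` about `p`, with derivative bounded
below in the direction of its gradient at `p`. -/
structure IsDefiningOnBall (Ω : Set Plane) (p : Plane) (r : ℝ) (g : Plane → ℝ) : Prop where
  contDiffAt : ∀ y ∈ Metric.ball p r, ContDiffAt ℝ 3 g y
  mem_iff : ∀ y ∈ Metric.ball p r, y ∈ Ω ↔ g y < 0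
  gradient_ne : ∀ y ∈ Metric.ball p r, gradient g y ≠ 0
  pos : ∃ c > 0, ∀ y ∈ Metric.ball p r, c ≤ fderiv ℝ g y (gradient g p)

lemma IsDefiningFunctionAt.exists_ball {Ω : Set Plane} {p : Plane} {g : Plane → ℝ}
    (h : IsDefiningFunctionAt Ω p g) : ∃ r > 0, IsDefiningOnBall Ω p r g := by
  obtain ⟨hne, U, hU, hg, hmem⟩ := h
  have hgU : ∀ᶠ y in 𝓝 p, ContDiffAt ℝ 3 g y := by
    filter_upwards [eventually_mem_nhds_iff.2 hU] with y hy using hg.contDiffAt hy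
  have hcont : ContinuousAt (fderiv ℝ g) p :=
    (hgU.self_of_nhds.fderiv_right (m := 2) (by norm_num)).continuousAt
  have hpos : 0 < ‖gradient g p‖ ^ 2 := by
    have := norm_pos_iff.2 hne; positivity
  -- At `p` this directional derivative equals `‖gradient g p‖ ^ 2`; half of it survives nearby and
  -- serves as the constant in `pos`.
  have h2 : ∀ᶠ y in 𝓝 p, ‖gradient g p‖ ^ 2 / 2 < fderiv ℝ g y (gradient g p) := by
    have hc : ContinuousAt (fun y => fderiv ℝ g y (gradient g p)) p :=
      hcont.clm_apply continuousAt_const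
    refine hc.eventually_const_lt ?_
    show _ < fderiv ℝ g p (gradient g p)
    rw [← inner_gradient_left, real_inner_self_eq_norm_sq]; linarith
  obtain ⟨r, hr, hball⟩ := Metric.eventually_nhds_iff_ball.1 (hgU.and (h2.and
    (eventually_mem_nhds_iff.2 hU)))
  refine ⟨r, hr, fun y hy => (hball y hy).1, fun y hy => hmem y (mem_of_mem_nhds (hball y hy).2.2),
    fun y hy h0 => ?_, ‖gradient g p‖ ^ 2 / 2, by positivity, fun y hy => (hball y hy).2.1.le⟩
  have := (hball y hy).2.1
  rw [← inner_gradient_left, h0, inner_zero_left] at this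
  linarith

lemma IsDefiningOnBall.isDefiningFunctionAt {Ω : Set Plane} {p : Plane} {r : ℝ} {g : Plane → ℝ}
    (h : IsDefiningOnBall Ω p r g) {y : Plane} (hy : y ∈ Metric.ball p r) :
    IsDefiningFunctionAt Ω y g :=
  ⟨h.gradient_ne y hy, _, Metric.isOpen_ball.mem_nhds hy,
    fun z hz => (h.contDiffAt z hz).contDiffWithinAt, h.mem_iff⟩

lemma IsDefiningOnBall.continuousOn_fderiv {Ω : Set Plane} {p : Plane} {r : ℝ} {g : Plane → ℝ}
    (h : IsDefiningOnBall Ω p r g) : ContinuousOn (fderiv ℝ g) (Metric.ball p r) := fun y hy =>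
  ((h.contDiffAt y hy).fderiv_right (m := 2) (by norm_num)).continuousAt.continuousWithinAt

lemma IsDefiningOnBall.continuousOn {Ω : Set Plane} {p : Plane} {r : ℝ} {g : Plane → ℝ}
    (h : IsDefiningOnBall Ω p r g) : ContinuousOn g (Metric.ball p r) := fun y hy =>
  (h.contDiffAt y hy).continuousAt.continuousWithinAt

/-- The vanishing of the flux through the boundary is uniform on a compact set. -/
lemma IsDefiningOnBall.exists_strip {Ω : Set Plane} {p : Plane} {r : ℝ} {g : Plane → ℝ}
    (h : IsDefiningOnBall Ω p r g) {H : Plane → Plane} {C : ℝ} (hC : ∀ y ∈ Ω, ‖H y‖ ≤ C)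
    (hwall : ∀ p ∈ frontier Ω, ∀ g, IsDefiningFunctionAt Ω p g →
      Tendsto (fun y => inner ℝ (H y) (gradient g p)) (𝓝[Ω] p) (𝓝 0))
    {K : Set Plane} (hK : IsCompact K) (hKr : K ⊆ Metric.ball p r) {δ : ℝ} (hδ : 0 < δ) :
    ∃ ε > 0, ∀ y ∈ K, g y < 0 → -ε ≤ g y → |fderiv ℝ g y (H y)| ≤ δ := by
  -- Otherwise violating points with `g` tending to zero accumulate at a point of the boundary in
  -- `K`. There the wall condition controls the pairing with the gradient at the limit point, and
  -- continuity of `fderiv ℝ g` together with boundedness of `H` absorbs the difference.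
  by_contra! hcon
  have hε : ∀ n : ℕ, (0 : ℝ) < 1 / ((n : ℝ) + 1) := fun n => by positivity
  choose y hyK hy0 hyε hyδ using fun n : ℕ => hcon _ (hε n)
  obtain ⟨z, hzK, φ, hφ, hz⟩ := hK.tendsto_subseq hyK
  have hzr := hKr hzK
  have hyΩ : ∀ n, y n ∈ Ω := fun n => (h.mem_iff _ (hKr (hyK n))).2 (hy0 n)
  have hgc : ContinuousAt g z := (h.contDiffAt z hzr).continuousAt
  have hgz : g z = 0 := by
    have h1 : Tendsto (fun n => g (y (φ n))) atTop (𝓝 (g z)) := hgc.tendsto.comp hz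
    have h2 : Tendsto (fun n => g (y (φ n))) atTop (𝓝 0) := by
      refine tendsto_of_tendsto_of_tendsto_of_le_of_le
        (g := fun n => -(1 / (((φ n : ℕ) : ℝ) + 1))) (h := fun _ => 0) ?_ tendsto_const_nhds
        (fun n => hyε _) (fun n => (hy0 _).le)
      have := (tendsto_one_div_add_atTop_nhds_zero_nat (𝕜 := ℝ)).comp hφ.tendsto_atTop
      simpa using this.neg
    exact tendsto_nhds_unique h1 h2
  have hzΩ : z ∉ Ω := by rw [h.mem_iff z hzr, hgz]; exact lt_irrefl 0
  have hzf : z ∈ frontier Ω :=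
    ⟨mem_closure_of_tendsto hz (Eventually.of_forall fun n => hyΩ _),
      fun hi => hzΩ (interior_subset hi)⟩
  have hzw : Tendsto (fun n => y (φ n)) atTop (𝓝[Ω] z) :=
    tendsto_nhdsWithin_iff.2 ⟨hz, Eventually.of_forall fun n => hyΩ _⟩
  have h1 := (hwall z hzf g (h.isDefiningFunctionAt hzr)).comp hzw
  have h2 : Tendsto (fun n => fderiv ℝ g (y (φ n)) - fderiv ℝ g z) atTop (𝓝 0) := by
    have := (h.continuousOn_fderiv.continuousAt (Metric.isOpen_ball.mem_nhds hzr)).tendsto.comp hz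
    simpa using this.sub_const (fderiv ℝ g z)
  have h3 : Tendsto (fun n => (fderiv ℝ g (y (φ n)) - fderiv ℝ g z) (H (y (φ n)))) atTop
      (𝓝 0) := by
    refine squeeze_zero_norm (a := fun n => ‖fderiv ℝ g (y (φ n)) - fderiv ℝ g z‖ * C)
      (fun n => ?_) (by simpa using h2.norm.mul_const C)
    exact (ContinuousLinearMap.le_opNorm _ _).trans
      (mul_le_mul_of_nonneg_left (hC _ (hyΩ _)) (norm_nonneg _))
  have h4 : Tendsto (fun n => fderiv ℝ g (y (φ n)) (H (y (φ n)))) atTop (𝓝 0) := by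
    have := h3.add h1
    simp only [add_zero] at this
    refine this.congr fun n => ?_
    simp
  have h5 := (h4.abs.eventually (gt_mem_nhds (by simpa using hδ))).exists
  obtain ⟨n, hn⟩ := h5
  exact absurd hn (not_lt.2 (hyδ _).le)

/-- A cutoff function vanishing near the boundary `g = 0`. -/
def boundaryCutoff (g : Plane → ℝ) (n : ℕ) (y : Plane) : ℝ :=
  Real.smoothTransition (-((n : ℝ) + 1) * g y - 1)

/-! ### Cutoffs vanishing near the boundary of the cross-section -/

section Cutoff

variable {Ω : Set Plane} {p : Plane} {r : ℝ} {g θ : Plane → ℝ}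

lemma boundaryCutoff_nonneg (g : Plane → ℝ) (n : ℕ) (y : Plane) : 0 ≤ boundaryCutoff g n y :=
  Real.smoothTransition.nonneg _

lemma boundaryCutoff_le_one (g : Plane → ℝ) (n : ℕ) (y : Plane) : boundaryCutoff g n y ≤ 1 :=
  Real.smoothTransition.le_one _

lemma lt_of_boundaryCutoff_ne_zero {n : ℕ} {y : Plane} (h : boundaryCutoff g n y ≠ 0) :
    0 < -((n : ℝ) + 1) * g y - 1 := by
  by_contra! h'
  exact h (Real.smoothTransition.zero_of_nonpos h')

lemma neg_of_cutoff {n : ℕ} {t : ℝ} (h : 0 ≤ -((n : ℝ) + 1) * t - 1) : t < 0 := by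
  by_contra! h'
  have : (0 : ℝ) ≤ (n : ℝ) + 1 := by positivity
  nlinarith [mul_nonneg this h']

lemma tendsto_boundaryCutoff (y : Plane) (h : g y < 0) :
    Tendsto (fun n => boundaryCutoff g n y) atTop (𝓝 1) := by
  refine tendsto_const_nhds.congr' ?_
  obtain ⟨N, hN⟩ := exists_nat_gt (2 / -g y)
  filter_upwards [eventually_ge_atTop N] with n hn
  refine (Real.smoothTransition.one_of_one_le ?_).symm
  have h1 : (N : ℝ) ≤ n := by exact_mod_cast hn
  have h2 := (div_lt_iff₀ (by linarith : 0 < -g y)).1 hN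
  nlinarith

/-- The cutoff lives where `(n + 1) * g ≤ -1`, which is closed relative to the support of `θ` and
misses `g = 0`. The product is therefore a legitimate test function inside `Ω`. -/
lemma tsupport_mul_cutoff (h : IsDefiningOnBall Ω p r g) (hθ : tsupport θ ⊆ Metric.ball p r)
    (n : ℕ) : tsupport (fun y => θ y * boundaryCutoff g n y) ⊆ tsupport θ ∩ Ω := by
  have hcl : IsClosed (tsupport θ ∩ {y | 0 ≤ -((n : ℝ) + 1) * g y - 1}) := by
    have : ContinuousOn (fun y => -((n : ℝ) + 1) * g y - 1) (tsupport θ) :=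
      (continuousOn_const.mul (h.continuousOn.mono hθ)).sub continuousOn_const
    exact this.preimage_isClosed_of_isClosed (isClosed_tsupport θ) isClosed_Ici
  refine (closure_minimal ?_ hcl).trans ?_
  · intro y hy
    exact ⟨subset_tsupport _ (left_ne_zero_of_mul hy),
      (lt_of_boundaryCutoff_ne_zero (right_ne_zero_of_mul hy)).le⟩
  · rintro y ⟨hy1, hy2⟩
    exact ⟨hy1, (h.mem_iff y (hθ hy1)).2 (neg_of_cutoff hy2)⟩

lemma contDiffAt_boundaryCutoff (h : IsDefiningOnBall Ω p r g) (n : ℕ) {y : Plane}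
    (hy : y ∈ Metric.ball p r) : ContDiffAt ℝ 1 (boundaryCutoff g n) y := by
  unfold boundaryCutoff
  refine (Real.smoothTransition.contDiff (n := 1)).contDiffAt.comp y ?_
  exact (contDiffAt_const.mul ((h.contDiffAt y hy).of_le (by norm_num))).sub contDiffAt_const

lemma contDiff_mul_cutoff (h : IsDefiningOnBall Ω p r g) (hθ : tsupport θ ⊆ Metric.ball p r)
    (hθd : ContDiff ℝ 1 θ) (n : ℕ) : ContDiff ℝ 1 (fun y => θ y * boundaryCutoff g n y) := by
  refine contDiff_iff_contDiffAt.2 fun y => ?_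
  by_cases hy : y ∈ tsupport θ
  · exact hθd.contDiffAt.mul (contDiffAt_boundaryCutoff h n (hθ hy))
  · have h1 : (fun y => θ y * boundaryCutoff g n y) =ᶠ[𝓝 y] fun _ => 0 := by
      filter_upwards [notMem_tsupport_iff_eventuallyEq.1 hy] with z hz; simp [hz]
    exact contDiffAt_const.congr_of_eventuallyEq h1

/-- The density `θ (n + 1) η'`, which concentrates on the boundary. -/
def boundaryDensity (g θ : Plane → ℝ) (n : ℕ) (y : Plane) : ℝ :=
  θ y * (((n : ℝ) + 1) * deriv Real.smoothTransition (-((n : ℝ) + 1) * g y - 1))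

/-- The second term is the boundary layer: paired with a field, it turns into the flux through the
boundary as `n` grows. -/
lemma fderiv_mul_cutoff (h : IsDefiningOnBall Ω p r g) (hθ : tsupport θ ⊆ Metric.ball p r)
    (hθd : ContDiff ℝ 1 θ) (n : ℕ) (y k : Plane) :
    fderiv ℝ (fun y => θ y * boundaryCutoff g n y) y k =
      boundaryCutoff g n y * fderiv ℝ θ y k - boundaryDensity g θ n y * fderiv ℝ g y k := by
  by_cases hy : y ∈ tsupport θ
  · have hyr := hθ hy
    have h1 : HasFDerivAt (boundaryCutoff g n)
        (deriv Real.smoothTransition (-((n : ℝ) + 1) * g y - 1) •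
          (-((n : ℝ) + 1)) • fderiv ℝ g y) y := by
      have hs := ((Real.smoothTransition.contDiff (n := 1)).differentiable one_ne_zero
        (-((n : ℝ) + 1) * g y - 1)).hasDerivAt
      exact hs.comp_hasFDerivAt y ((((h.contDiffAt y hyr).differentiableAt
        (by norm_num)).hasFDerivAt.const_mul _).sub_const 1)
    have h2 := ((hθd.differentiable one_ne_zero y).hasFDerivAt.mul h1).fderiv
    rw [show (fun y => θ y * boundaryCutoff g n y) = θ * boundaryCutoff g n from rfl, h2]
    simp [boundaryDensity]
    ring
  · have h0 : θ =ᶠ[𝓝 y] 0 := notMem_tsupport_iff_eventuallyEq.1 hy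
    have h1 : (fun y => θ y * boundaryCutoff g n y) =ᶠ[𝓝 y] fun _ => 0 := by
      filter_upwards [h0] with z hz; simp [hz]
    rw [h1.fderiv_eq, h0.fderiv_eq]
    simp [boundaryDensity, h0.self_of_nhds]

lemma continuous_boundaryDensity (h : IsDefiningOnBall Ω p r g)
    (hθ : tsupport θ ⊆ Metric.ball p r) (hθd : Continuous θ) (n : ℕ) :
    Continuous (boundaryDensity g θ n) := by
  refine continuous_mul_of_tsupport Metric.isOpen_ball hθd hθ ?_
  refine continuousOn_const.mul ?_
  have hs : Continuous (deriv Real.smoothTransition) :=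
    (Real.smoothTransition.contDiff (n := 1)).continuous_deriv le_rfl
  exact hs.comp_continuousOn ((continuousOn_const.mul h.continuousOn).sub continuousOn_const)

lemma deriv_smoothTransition_nonneg (t : ℝ) : 0 ≤ deriv Real.smoothTransition t :=
  Real.smoothTransition.monotone.deriv_nonneg

lemma boundaryDensity_nonneg (h0 : ∀ y, 0 ≤ θ y) (n : ℕ) (y : Plane) :
    0 ≤ boundaryDensity g θ n y :=
  mul_nonneg (h0 y) (mul_nonneg (by positivity) (deriv_smoothTransition_nonneg _))

/-- The transition function is locally constant off [0, 1], so the layer is confined to 1 ≤ -(n + 1)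
g ≤ 2. -/
lemma mem_strip_of_boundaryDensity_ne {n : ℕ} {y : Plane} (h : boundaryDensity g θ n y ≠ 0) :
    y ∈ tsupport θ ∧ g y < 0 ∧ -(2 / ((n : ℝ) + 1)) ≤ g y := by
  have h1 := right_ne_zero_of_mul (right_ne_zero_of_mul h)
  have hn : (0 : ℝ) < (n : ℝ) + 1 := by positivity
  set t := -((n : ℝ) + 1) * g y - 1
  have ht0 : 0 ≤ t := by
    by_contra! ht
    refine h1 ?_
    have : Real.smoothTransition =ᶠ[𝓝 t] fun _ => 0 := by
      filter_upwards [gt_mem_nhds ht] with s hs using Real.smoothTransition.zero_of_nonpos hs.le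
    rw [this.deriv_eq, deriv_const]
  have ht1 : t ≤ 1 := by
    by_contra! ht
    refine h1 ?_
    have : Real.smoothTransition =ᶠ[𝓝 t] fun _ => 1 := by
      filter_upwards [lt_mem_nhds ht] with s hs using Real.smoothTransition.one_of_one_le hs.le
    rw [this.deriv_eq, deriv_const]
  refine ⟨subset_tsupport _ (left_ne_zero_of_mul h), neg_of_cutoff ht0, ?_⟩
  rw [neg_le, ← sub_nonneg]
  have : 2 / ((n : ℝ) + 1) - -g y = (1 - t) / ((n : ℝ) + 1) := by
    simp only [t]; field_simp; ring
  rw [this]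
  exact div_nonneg (by linarith) hn.le

end Cutoff

/-- `H` is a bounded differentiable field on `Ω` with no flux through the boundary. -/
structure IsTangentialField (Ω : Set Plane) (H : Plane → Plane) : Prop where
  differentiableAt : ∀ y ∈ Ω, DifferentiableAt ℝ H y
  locally_bounded : ∀ y ∈ Ω, ∃ C, ∀ᶠ z in 𝓝 y, ‖fderiv ℝ H z‖ ≤ C
  bounded : ∃ C, ∀ y ∈ Ω, ‖H y‖ ≤ C
  wall : ∀ p ∈ frontier Ω, ∀ g, IsDefiningFunctionAt Ω p g →
    Tendsto (fun y => inner ℝ (H y) (gradient g p)) (𝓝[Ω] p) (𝓝 0)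

lemma IsTangentialField.continuousOn {Ω : Set Plane} {H : Plane → Plane}
    (h : IsTangentialField Ω H) : ContinuousOn H Ω := fun y hy =>
  (h.differentiableAt y hy).continuousAt.continuousWithinAt

lemma integrable_fderiv_apply {H : Plane → Plane} {Ω : Set Plane} (hΩ : IsOpen Ω)
    (hH : ContinuousOn H Ω) {ψ : Plane → ℝ} (hψ : ContDiff ℝ 1 ψ) (hcs : HasCompactSupport ψ)
    (hsub : tsupport ψ ⊆ Ω) : Integrable fun y => fderiv ℝ ψ y (H y) := by
  refine Continuous.integrable_of_hasCompactSupport ?_ ?_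
  · refine ((hψ.continuous_fderiv one_ne_zero).continuousOn.clm_apply
      hH).continuous_of_tsupport_subset hΩ ((closure_mono ?_).trans
        ((tsupport_fderiv_subset ℝ (f := ψ)).trans hsub))
    intro y hy h0
    exact hy (by simp [h0])
  · refine (hcs.fderiv ℝ).mono fun y hy h0 => hy (by simp [h0])

/-! ### Limits of the boundary layer integrals -/

section Local

variable {Ω : Set Plane} {p : Plane} {r : ℝ} {g θ : Plane → ℝ} {H : Plane → Plane}

lemma hasCompactSupport_of_tsupport_subset_ball (hθ : tsupport θ ⊆ Metric.ball p r) :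
    HasCompactSupport θ :=
  Metric.isCompact_of_isClosed_isBounded (isClosed_tsupport θ) (Metric.isBounded_ball.subset hθ)

lemma tsupport_boundaryDensity (h : IsDefiningOnBall Ω p r g)
    (hθ : tsupport θ ⊆ Metric.ball p r) (n : ℕ) :
    tsupport (boundaryDensity g θ n) ⊆ tsupport θ ∩ Ω := by
  have hcl : IsClosed (tsupport θ ∩ {y | g y ≤ 0 ∧ 0 ≤ -((n : ℝ) + 1) * g y - 1}) := by
    have h2 : ContinuousOn (fun y => (g y, -((n : ℝ) + 1) * g y - 1)) (tsupport θ) :=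
      (h.continuousOn.mono hθ).prodMk
        ((continuousOn_const.mul (h.continuousOn.mono hθ)).sub continuousOn_const)
    exact h2.preimage_isClosed_of_isClosed (isClosed_tsupport θ) (isClosed_Iic.prod isClosed_Ici)
  refine (closure_minimal ?_ hcl).trans ?_
  · intro y hy
    obtain ⟨h1, h2, -⟩ := mem_strip_of_boundaryDensity_ne hy
    refine ⟨h1, h2.le, ?_⟩
    by_contra! ht
    refine right_ne_zero_of_mul (right_ne_zero_of_mul hy) ?_
    have : Real.smoothTransition =ᶠ[𝓝 (-((n : ℝ) + 1) * g y - 1)] fun _ => 0 := by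
      filter_upwards [gt_mem_nhds ht] with s hs using Real.smoothTransition.zero_of_nonpos hs.le
    rw [this.deriv_eq, deriv_const]
  · rintro y ⟨hy1, -, hy2⟩
    exact ⟨hy1, (h.mem_iff y (hθ hy1)).2 (neg_of_cutoff hy2)⟩

lemma integrable_boundaryDensity_mul (hΩ : IsOpen Ω) (h : IsDefiningOnBall Ω p r g)
    (hθ : tsupport θ ⊆ Metric.ball p r) (hθd : Continuous θ) (hH : ContinuousOn H Ω) (n : ℕ) :
    Integrable fun y => boundaryDensity g θ n y * fderiv ℝ g y (H y) := by
  refine Continuous.integrable_of_hasCompactSupport ?_ ?_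
  · refine continuous_mul_of_tsupport (hΩ.inter Metric.isOpen_ball)
      (continuous_boundaryDensity h hθ hθd n) (fun y hy => ?_)
      ((h.continuousOn_fderiv.mono inter_subset_right).clm_apply (hH.mono inter_subset_left))
    obtain ⟨h1, h2⟩ := tsupport_boundaryDensity h hθ n hy
    exact ⟨h2, hθ h1⟩
  · exact ((hasCompactSupport_of_tsupport_subset_ball hθ).mul_right).mul_right

/-- Test with the constant field `e`, the gradient of `g` at `p`. Its divergence is zero, so the
layer integrated against the derivative of `g` along `e`, which is at least `c`, equals the integral
of the cutoff times the derivative of `θ` along `e`. The latter is bounded independently of `n`. -/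
lemma integral_boundaryDensity_le (hΩ : IsOpen Ω) (h : IsDefiningOnBall Ω p r g)
    (hθ : tsupport θ ⊆ Metric.ball p r) (hθd : ContDiff ℝ 1 θ) (hθ0 : ∀ y, 0 ≤ θ y) :
    ∃ A, ∀ n, ∫ y, boundaryDensity g θ n y ≤ A := by
  obtain ⟨c, hc, hce⟩ := h.pos
  set e := gradient g p
  have hcs := hasCompactSupport_of_tsupport_subset_ball hθ
  refine ⟨(∫ y, |fderiv ℝ θ y e|) / c, fun n => ?_⟩
  have hts := tsupport_mul_cutoff h hθ n
  have hcsn : HasCompactSupport fun y => θ y * boundaryCutoff g n y := hcs.mul_right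
  have hcd := contDiff_mul_cutoff h hθ hθd n
  have h1 := integral_mul_planarDiv (H := fun _ => e) hΩ (fun y _ => differentiableAt_const e)
    (fun y _ => ⟨0, by simp⟩) hcd hcsn (hts.trans inter_subset_right)
  simp only [planarDiv, fderiv_fun_const, Pi.zero_apply, zero_apply,
    PiLp.zero_apply, Finset.sum_const_zero, mul_zero, integral_zero] at h1
  have i1 := integrable_fderiv_apply (H := fun _ => e) hΩ continuousOn_const hcd hcsn
    (hts.trans inter_subset_right)
  have i2 := integrable_boundaryDensity_mul (H := fun _ => e) hΩ h hθ hθd.continuous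
    continuousOn_const n
  have i3 : Integrable fun y => |fderiv ℝ θ y e| :=
    (((hθd.continuous_fderiv one_ne_zero).clm_apply
      continuous_const).integrable_of_hasCompactSupport (hcs.fderiv_apply ℝ e)).abs
  have i4 : Integrable (boundaryDensity g θ n) :=
    (continuous_boundaryDensity h hθ hθd.continuous n).integrable_of_hasCompactSupport
      hcs.mul_right
  rw [le_div_iff₀ hc, ← integral_mul_const]
  calc ∫ y, boundaryDensity g θ n y * c
      ≤ ∫ y, boundaryDensity g θ n y * fderiv ℝ g y e := by
        refine integral_mono (i4.mul_const c) i2 fun y => ?_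
        by_cases hy : boundaryDensity g θ n y = 0
        · simp [hy]
        · exact mul_le_mul_of_nonneg_left (hce y (hθ (mem_strip_of_boundaryDensity_ne hy).1))
            (boundaryDensity_nonneg hθ0 n y)
    _ = ∫ y, (fderiv ℝ (fun y => θ y * boundaryCutoff g n y) y e +
          boundaryDensity g θ n y * fderiv ℝ g y e) := by
        rw [integral_add i1 i2]; linarith
    _ ≤ ∫ y, |fderiv ℝ θ y e| := by
        refine integral_mono (i1.add i2) i3 fun y => ?_
        simp only [fderiv_mul_cutoff h hθ hθd, sub_add_cancel]
        calc boundaryCutoff g n y * fderiv ℝ θ y e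
            ≤ boundaryCutoff g n y * |fderiv ℝ θ y e| :=
              mul_le_mul_of_nonneg_left (le_abs_self _) (boundaryCutoff_nonneg _ _ _)
          _ ≤ 1 * |fderiv ℝ θ y e| :=
              mul_le_mul_of_nonneg_right (boundaryCutoff_le_one _ _ _) (abs_nonneg _)
          _ = _ := one_mul _

/-- The layers have uniformly bounded mass, and on them the normal component of the field is
uniformly small by `IsDefiningOnBall.exists_strip`. -/
lemma tendsto_integral_boundaryDensity_mul (hΩ : IsOpen Ω) (h : IsDefiningOnBall Ω p r g)
    (hθ : tsupport θ ⊆ Metric.ball p r) (hθd : ContDiff ℝ 1 θ) (hθ0 : ∀ y, 0 ≤ θ y)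
    (hH : IsTangentialField Ω H) :
    Tendsto (fun n => ∫ y, boundaryDensity g θ n y * fderiv ℝ g y (H y)) atTop (𝓝 0) := by
  obtain ⟨C, hC⟩ := hH.bounded
  obtain ⟨A, hA⟩ := integral_boundaryDensity_le hΩ h hθ hθd hθ0
  have hcs := hasCompactSupport_of_tsupport_subset_ball hθ
  have i4 : ∀ n, Integrable (boundaryDensity g θ n) := fun n =>
    (continuous_boundaryDensity h hθ hθd.continuous n).integrable_of_hasCompactSupport
      hcs.mul_right
  have hA0 : 0 ≤ A := (integral_nonneg (boundaryDensity_nonneg hθ0 0)).trans (hA 0)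
  rw [Metric.tendsto_atTop]
  intro ε hε
  have hδ : 0 < ε / (A + 1) := by positivity
  obtain ⟨s, hs, hstrip⟩ := h.exists_strip hC hH.wall hcs hθ hδ
  obtain ⟨N, hN⟩ := exists_nat_gt (2 / s)
  refine ⟨N, fun n hn => ?_⟩
  rw [dist_zero_right]
  have hpt : ∀ y, ‖boundaryDensity g θ n y * fderiv ℝ g y (H y)‖ ≤
      boundaryDensity g θ n y * (ε / (A + 1)) := by
    intro y
    by_cases hy : boundaryDensity g θ n y = 0
    · simp [hy]
    · obtain ⟨h1, h2, h3⟩ := mem_strip_of_boundaryDensity_ne hy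
      rw [norm_mul, Real.norm_of_nonneg (boundaryDensity_nonneg hθ0 n y)]
      refine mul_le_mul_of_nonneg_left (hstrip y h1 h2 (le_trans (neg_le_neg ?_) h3))
        (boundaryDensity_nonneg hθ0 n y)
      have h4 : (N : ℝ) ≤ n := by exact_mod_cast hn
      rw [div_le_iff₀ (by positivity)]
      have := (div_lt_iff₀ hs).1 hN
      nlinarith
  calc ‖∫ y, boundaryDensity g θ n y * fderiv ℝ g y (H y)‖
      ≤ ∫ y, boundaryDensity g θ n y * (ε / (A + 1)) :=
        norm_integral_le_of_norm_le ((i4 n).mul_const _) (ae_of_all _ hpt)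
    _ = (∫ y, boundaryDensity g θ n y) * (ε / (A + 1)) := integral_mul_const _ _
    _ ≤ A * (ε / (A + 1)) := mul_le_mul_of_nonneg_right (hA n) hδ.le
    _ < ε := by
        rw [mul_div_assoc', div_lt_iff₀ (by linarith)]; nlinarith

lemma tendsto_integral_cutoff_mul (h : IsDefiningOnBall Ω p r g) (hΩ : IsOpen Ω)
    (hθ : tsupport θ ⊆ Metric.ball p r) (hθd : ContDiff ℝ 1 θ)
    (hH : IsTangentialField Ω H) :
    Tendsto (fun n => ∫ y, boundaryCutoff g n y * fderiv ℝ θ y (H y)) atTop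
      (𝓝 (∫ y in Ω, fderiv ℝ θ y (H y))) := by
  obtain ⟨C, hC0, hC⟩ : ∃ C, 0 ≤ C ∧ ∀ y ∈ Ω, ‖H y‖ ≤ C :=
    hH.bounded.imp' (fun C => max C 0) fun C hC =>
      ⟨le_max_right _ _, fun y hy => (hC y hy).trans (le_max_left _ _)⟩
  have hcs := hasCompactSupport_of_tsupport_subset_ball hθ
  rw [← integral_indicator hΩ.measurableSet]
  have hzero : ∀ y, y ∉ tsupport θ → fderiv ℝ θ y = 0 := fun y hy => by
    have := fun h' => hy (tsupport_fderiv_subset ℝ (f := θ) h')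
    exact image_eq_zero_of_notMem_tsupport this
  have hcut0 : ∀ n, ∀ y, y ∈ tsupport θ → y ∉ Ω → boundaryCutoff g n y = 0 := by
    intro n y hy hyΩ
    by_contra hne
    exact hyΩ ((h.mem_iff y (hθ hy)).2 (neg_of_cutoff (lt_of_boundaryCutoff_ne_zero hne).le))
  refine tendsto_integral_of_dominated_convergence (fun y => ‖fderiv ℝ θ y‖ * C) ?_ ?_ ?_ ?_
  · intro n
    have i1 := integrable_fderiv_apply hΩ hH.continuousOn (contDiff_mul_cutoff h hθ hθd n)
      hcs.mul_right ((tsupport_mul_cutoff h hθ n).trans inter_subset_right)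
    have i2 := integrable_boundaryDensity_mul hΩ h hθ hθd.continuous hH.continuousOn n
    refine (i1.add i2).aestronglyMeasurable.congr (ae_of_all _ fun y => ?_)
    simp only [Pi.add_apply, fderiv_mul_cutoff h hθ hθd, sub_add_cancel]
  · exact ((hθd.continuous_fderiv one_ne_zero).norm.integrable_of_hasCompactSupport
      (hcs.fderiv ℝ).norm).mul_const C
  · refine fun n => ae_of_all _ fun y => ?_
    by_cases hy : y ∈ tsupport θ
    · by_cases hyΩ : y ∈ Ω
      · rw [norm_mul, Real.norm_of_nonneg (boundaryCutoff_nonneg _ _ _)]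
        calc boundaryCutoff g n y * ‖fderiv ℝ θ y (H y)‖
            ≤ 1 * ‖fderiv ℝ θ y (H y)‖ :=
              mul_le_mul_of_nonneg_right (boundaryCutoff_le_one _ _ _) (norm_nonneg _)
          _ ≤ ‖fderiv ℝ θ y‖ * ‖H y‖ := by
              rw [one_mul]; exact ContinuousLinearMap.le_opNorm _ _
          _ ≤ _ := mul_le_mul_of_nonneg_left (hC y hyΩ) (norm_nonneg _)
      · rw [hcut0 n y hy hyΩ, zero_mul, norm_zero]
        exact mul_nonneg (norm_nonneg _) hC0
    · simp [hzero y hy]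
  · refine ae_of_all _ fun y => ?_
    by_cases hyΩ : y ∈ Ω
    · rw [indicator_of_mem hyΩ]
      by_cases hy : y ∈ tsupport θ
      · simpa using (tendsto_boundaryCutoff y ((h.mem_iff y (hθ hy)).1 hyΩ)).mul_const
          (fderiv ℝ θ y (H y))
      · simp [hzero y hy]
    · rw [indicator_of_notMem hyΩ]
      by_cases hy : y ∈ tsupport θ
      · simp [hcut0 _ y hy hyΩ]
      · simp [hzero y hy]

end Local

/-! ### Vanishing of a nonnegative divergence on the cross-section -/

section Planar

variable {Ω : Set Plane} {p : Plane} {r : ℝ} {g θ : Plane → ℝ} {H : Plane → Plane}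

/-- The divergence is not known to be integrable up to the boundary, so the cutoffs are removed with
Fatou's lemma. This gives only an inequality, which suffices because the right-hand sides sum to
zero over a partition of unity. -/
lemma lintegral_mul_planarDiv_le_of_boundary (hΩ : IsOpen Ω) (h : IsDefiningOnBall Ω p r g)
    (hθ : tsupport θ ⊆ Metric.ball p r) (hθd : ContDiff ℝ 1 θ) (hθ0 : ∀ y, 0 ≤ θ y)
    (hH : IsTangentialField Ω H) (hdiv : ∀ y ∈ Ω, 0 ≤ planarDiv H y) :
    0 ≤ -∫ y in Ω, fderiv ℝ θ y (H y) ∧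
      ∫⁻ y in Ω, ENNReal.ofReal (θ y * planarDiv H y) ≤
        ENNReal.ofReal (-∫ y in Ω, fderiv ℝ θ y (H y)) := by
  have hcs := hasCompactSupport_of_tsupport_subset_ball hθ
  have hts := fun n => (tsupport_mul_cutoff h hθ n).trans (inter_subset_right (s := tsupport θ))
  have hcsn : ∀ n, HasCompactSupport fun y => θ y * boundaryCutoff g n y := fun n => hcs.mul_right
  have hcd := contDiff_mul_cutoff h hθ hθd
  have i1 := fun n => integrable_fderiv_apply hΩ hH.continuousOn (hcd n) (hcsn n) (hts n)
  have i2 := fun n => integrable_boundaryDensity_mul hΩ h hθ hθd.continuous hH.continuousOn n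
  have i5 := fun n =>
    integrable_mul_planarDiv hH.locally_bounded (hcd n).continuous (hcsn n) (hts n)
  have e1 : ∀ n, ∫ y, θ y * boundaryCutoff g n y * planarDiv H y =
      -(∫ y, boundaryCutoff g n y * fderiv ℝ θ y (H y)) +
        ∫ y, boundaryDensity g θ n y * fderiv ℝ g y (H y) := by
    intro n
    rw [integral_mul_planarDiv hΩ hH.differentiableAt hH.locally_bounded (hcd n) (hcsn n) (hts n)]
    have : ∫ y, boundaryCutoff g n y * fderiv ℝ θ y (H y) =
        ∫ y, (fderiv ℝ (fun y => θ y * boundaryCutoff g n y) y (H y) +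
          boundaryDensity g θ n y * fderiv ℝ g y (H y)) := by
      refine integral_congr_ae (ae_of_all _ fun y => ?_)
      simp only [fderiv_mul_cutoff h hθ hθd, sub_add_cancel]
    rw [this, integral_add (i1 n) (i2 n)]
    ring
  have hnn : ∀ n y, 0 ≤ θ y * boundaryCutoff g n y * planarDiv H y := by
    intro n y
    by_cases hy : y ∈ Ω
    · exact mul_nonneg (mul_nonneg (hθ0 y) (boundaryCutoff_nonneg _ _ _)) (hdiv y hy)
    · have : θ y * boundaryCutoff g n y = 0 :=
        image_eq_zero_of_notMem_tsupport (f := fun y => θ y * boundaryCutoff g n y)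
          fun h' => hy (hts n h')
      rw [this, zero_mul]
  have hlim : Tendsto (fun n => ∫ y, θ y * boundaryCutoff g n y * planarDiv H y) atTop
      (𝓝 (-∫ y in Ω, fderiv ℝ θ y (H y))) := by
    have := (tendsto_integral_cutoff_mul h hΩ hθ hθd hH).neg.add
      (tendsto_integral_boundaryDensity_mul hΩ h hθ hθd hθ0 hH)
    simp only [add_zero] at this
    exact this.congr fun n => (e1 n).symm
  refine ⟨ge_of_tendsto' hlim fun n => integral_nonneg (hnn n), ?_⟩
  have hl : ∀ n, ∫⁻ y in Ω, ENNReal.ofReal (θ y * boundaryCutoff g n y * planarDiv H y) ≤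
      ENNReal.ofReal (∫ y, θ y * boundaryCutoff g n y * planarDiv H y) := by
    intro n
    rw [ofReal_integral_eq_lintegral_ofReal (i5 n) (ae_of_all _ (hnn n))]
    exact setLIntegral_le_lintegral _ _
  calc ∫⁻ y in Ω, ENNReal.ofReal (θ y * planarDiv H y)
      ≤ ∫⁻ y in Ω, liminf (fun n => ENNReal.ofReal
          (θ y * boundaryCutoff g n y * planarDiv H y)) atTop := by
        refine setLIntegral_mono' hΩ.measurableSet fun y hy => ?_
        have ht : Tendsto (fun n => θ y * boundaryCutoff g n y * planarDiv H y) atTop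
            (𝓝 (θ y * planarDiv H y)) := by
          by_cases hyθ : y ∈ tsupport θ
          · simpa using ((tendsto_boundaryCutoff y ((h.mem_iff y (hθ hyθ)).1 hy)).const_mul
              (θ y)).mul_const (planarDiv H y)
          · simp [image_eq_zero_of_notMem_tsupport hyθ]
        exact (ENNReal.tendsto_ofReal ht).liminf_eq.ge
    _ ≤ liminf (fun n => ∫⁻ y in Ω, ENNReal.ofReal
          (θ y * boundaryCutoff g n y * planarDiv H y)) atTop :=
        lintegral_liminf_le fun n =>
          ((hcd n).continuous.measurable.mul (measurable_planarDiv H)).ennreal_ofReal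
    _ ≤ liminf (fun n => ENNReal.ofReal
          (∫ y, θ y * boundaryCutoff g n y * planarDiv H y)) atTop :=
        liminf_le_liminf (Eventually.of_forall hl)
    _ = _ := (ENNReal.tendsto_ofReal hlim).liminf_eq

lemma lintegral_mul_planarDiv_le_of_interior (hΩ : IsOpen Ω) (hr : Metric.ball p r ⊆ Ω)
    (hθ : tsupport θ ⊆ Metric.ball p r) (hθd : ContDiff ℝ 1 θ) (hθ0 : ∀ y, 0 ≤ θ y)
    (hH : IsTangentialField Ω H) (hdiv : ∀ y ∈ Ω, 0 ≤ planarDiv H y) :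
    0 ≤ -∫ y in Ω, fderiv ℝ θ y (H y) ∧
      ∫⁻ y in Ω, ENNReal.ofReal (θ y * planarDiv H y) ≤
        ENNReal.ofReal (-∫ y in Ω, fderiv ℝ θ y (H y)) := by
  have hcs := hasCompactSupport_of_tsupport_subset_ball hθ
  have hnn : ∀ y, 0 ≤ θ y * planarDiv H y := by
    intro y
    by_cases hy : y ∈ Ω
    · exact mul_nonneg (hθ0 y) (hdiv y hy)
    · rw [image_eq_zero_of_notMem_tsupport fun h' => hy (hr (hθ h')), zero_mul]
  have e : ∫ y in Ω, fderiv ℝ θ y (H y) = ∫ y, fderiv ℝ θ y (H y) := by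
    refine setIntegral_eq_integral_of_forall_compl_eq_zero fun y hy => ?_
    rw [image_eq_zero_of_notMem_tsupport (f := fderiv ℝ θ) fun h' =>
      hy (hr (hθ (tsupport_fderiv_subset ℝ h')))]
    rfl
  rw [e, ← integral_mul_planarDiv hΩ hH.differentiableAt hH.locally_bounded hθd hcs
    (hθ.trans hr)]
  refine ⟨integral_nonneg hnn, ?_⟩
  rw [ofReal_integral_eq_lintegral_ofReal
    (integrable_mul_planarDiv hH.locally_bounded hθd.continuous hcs (hθ.trans hr))
    (ae_of_all _ hnn)]
  exact setLIntegral_le_lintegral _ _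

lemma exists_ball_lintegral_le (hΩ : IsCrossSection Ω) (hH : IsTangentialField Ω H)
    (hdiv : ∀ y ∈ Ω, 0 ≤ planarDiv H y) (hp : p ∈ closure Ω) :
    ∃ r > 0, ∀ θ : Plane → ℝ, tsupport θ ⊆ Metric.ball p r → ContDiff ℝ 1 θ → (∀ y, 0 ≤ θ y) →
      0 ≤ -∫ y in Ω, fderiv ℝ θ y (H y) ∧
      ∫⁻ y in Ω, ENNReal.ofReal (θ y * planarDiv H y) ≤
        ENNReal.ofReal (-∫ y in Ω, fderiv ℝ θ y (H y)) := by
  by_cases hpΩ : p ∈ Ω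
  · obtain ⟨r, hr, hsub⟩ := Metric.isOpen_iff.1 hΩ.isOpen p hpΩ
    exact ⟨r, hr, fun θ h1 h2 h3 =>
      lintegral_mul_planarDiv_le_of_interior hΩ.isOpen hsub h1 h2 h3 hH hdiv⟩
  · obtain ⟨g, hg⟩ := hΩ.boundary p ⟨hp, fun h => hpΩ (interior_subset h)⟩
    obtain ⟨r, hr, hgr⟩ := hg.exists_ball
    exact ⟨r, hr, fun θ h1 h2 h3 =>
      lintegral_mul_planarDiv_le_of_boundary hΩ.isOpen hgr h1 h2 h3 hH hdiv⟩

/-- A field with no flux through the boundary and nonnegative divergence is divergence free. -/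
theorem planarDiv_ae_eq_zero (hΩ : IsCrossSection Ω) (hH : IsTangentialField Ω H)
    (hdiv : ∀ y ∈ Ω, 0 ≤ planarDiv H y) :
    ∀ᵐ y ∂(volume.restrict Ω), planarDiv H y = 0 := by
  have hK : IsCompact (closure Ω) := hΩ.isBounded.isCompact_closure
  choose! r hr hloc using fun p (hp : p ∈ closure Ω) => exists_ball_lintegral_le hΩ hH hdiv hp
  obtain ⟨t, htΩ, htc⟩ := hK.elim_nhds_subcover (fun p => Metric.ball p (r p))
    fun p hp => Metric.ball_mem_nhds p (hr p hp)
  obtain ⟨ρ, hρ⟩ := SmoothPartitionOfUnity.exists_isSubordinate (modelWithCornersSelf ℝ Plane)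
    hK.isClosed (fun i : t => Metric.ball (i : Plane) (r i)) (fun i => Metric.isOpen_ball)
    (htc.trans (by
      intro y hy
      simp only [mem_iUnion] at hy ⊢
      obtain ⟨i, hi, hy⟩ := hy
      exact ⟨⟨i, hi⟩, hy⟩))
  have hcd : ∀ i : t, ContDiff ℝ 1 (ρ i) := fun i =>
    ((ρ i).contMDiff.contDiff).of_le (by norm_num)
  have hmain := fun i : t =>
    hloc i (htΩ i i.2) (ρ i) (hρ i) (hcd i) (fun y => ρ.nonneg i y)
  have hsum : ∀ y ∈ closure Ω, ∑ i : t, ρ i y = 1 := fun y hy => by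
    rw [← finsum_eq_sum_of_fintype]; exact ρ.sum_eq_one hy
  obtain ⟨C, hC⟩ := hH.bounded
  have hint : ∀ i : t, IntegrableOn (fun y => fderiv ℝ (ρ i) y (H y)) Ω := by
    intro i
    have hcs : HasCompactSupport (ρ i) := hasCompactSupport_of_tsupport_subset_ball (hρ i)
    have hdc := (hcd i).continuous_fderiv one_ne_zero
    refine Integrable.mono' (g := fun y => ‖fderiv ℝ (ρ i) y‖ * C) ?_ ?_ ?_
    · exact ((hdc.norm.integrable_of_hasCompactSupport (hcs.fderiv ℝ).norm).mul_const C).integrableOn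
    · exact (hdc.continuousOn.clm_apply hH.continuousOn).aestronglyMeasurable
        hΩ.isOpen.measurableSet
    · refine (ae_restrict_iff' hΩ.isOpen.measurableSet).2 (ae_of_all _ fun y hy => ?_)
      exact (ContinuousLinearMap.le_opNorm _ _).trans
        (mul_le_mul_of_nonneg_left (hC y hy) (norm_nonneg _))
  -- The partition functions sum to one on the open set `Ω`, so their derivatives cancel there.
  have hzero : ∑ i : t, -∫ y in Ω, fderiv ℝ (ρ i) y (H y) = 0 := by
    rw [Finset.sum_neg_distrib, neg_eq_zero, ← integral_finsetSum _ fun i _ => hint i]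
    refine setIntegral_eq_zero_of_forall_eq_zero fun y hy => ?_
    have h1 : (fun y => ∑ i : t, ρ i y) =ᶠ[𝓝 y] fun _ => 1 := by
      filter_upwards [hΩ.isOpen.mem_nhds hy] with z hz using hsum z (subset_closure hz)
    have h2 : fderiv ℝ (fun y => ∑ i : t, ρ i y) y = ∑ i : t, fderiv ℝ (ρ i) y :=
      fderiv_fun_sum fun i _ => (hcd i).differentiable one_ne_zero y
    rw [h1.fderiv_eq, fderiv_fun_const] at h2
    rw [← sum_apply, ← h2]; rfl
  have hle : ∫⁻ y in Ω, ENNReal.ofReal (planarDiv H y) ≤ 0 := by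
    calc ∫⁻ y in Ω, ENNReal.ofReal (planarDiv H y)
        = ∫⁻ y in Ω, ∑ i : t, ENNReal.ofReal (ρ i y * planarDiv H y) := by
          refine setLIntegral_congr_fun hΩ.isOpen.measurableSet fun y hy => ?_
          rw [← ENNReal.ofReal_sum_of_nonneg fun i _ =>
            mul_nonneg (ρ.nonneg i y) (hdiv y hy), ← Finset.sum_mul,
            hsum y (subset_closure hy), one_mul]
      _ = ∑ i : t, ∫⁻ y in Ω, ENNReal.ofReal (ρ i y * planarDiv H y) :=
          lintegral_finsetSum _ fun i _ =>
            ((hcd i).continuous.measurable.mul (measurable_planarDiv H)).ennreal_ofReal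
      _ ≤ ∑ i : t, ENNReal.ofReal (-∫ y in Ω, fderiv ℝ (ρ i) y (H y)) :=
          Finset.sum_le_sum fun i _ => (hmain i).2
      _ = 0 := by
          rw [← ENNReal.ofReal_sum_of_nonneg fun i _ => (hmain i).1, hzero, ENNReal.ofReal_zero]
  have := (lintegral_eq_zero_iff (measurable_planarDiv H).ennreal_ofReal).1 (le_antisymm hle bot_le)
  filter_upwards [this, (ae_restrict_iff' hΩ.isOpen.measurableSet).2
    (ae_of_all _ fun y hy => hdiv y hy)] with y hy h0
  exact le_antisymm (ENNReal.ofReal_eq_zero.1 hy) h0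

end Planar

/-! ### Integration over axial columns between two graphs -/

section Column

variable {Ω : Set Plane} {a b : Plane → ℝ} {V : Space → Space} {C : ℝ}

/-- The height at fraction `s` between the graphs of `a` and `b`. -/
def columnHeight (a b : Plane → ℝ) (s : ℝ) (y : Plane) : ℝ := a y + s * (b y - a y)

/-- The point at fraction `s` between the graphs of `a` and `b`. -/
def columnPoint (a b : Plane → ℝ) (s : ℝ) (y : Plane) : Space := lift (columnHeight a b s y) y

lemma columnPoint_mem (hab : ∀ y ∈ Ω, a y < b y) {y : Plane} (hy : y ∈ Ω) {s : ℝ}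
    (hs : s ∈ Ioo (0 : ℝ) 1) : columnPoint a b s y ∈ graphRegion Ω a b := by
  rw [columnPoint, lift_mem_graphRegion, columnHeight]
  have := hab y hy
  exact ⟨hy, by nlinarith [hs.1], by nlinarith [hs.2]⟩

/-- The derivative of `columnHeight a b s`. -/
def columnSlope (a b : Plane → ℝ) (s : ℝ) (y : Plane) : Plane →L[ℝ] ℝ :=
  fderiv ℝ a y + s • (fderiv ℝ b y - fderiv ℝ a y)

lemma hasFDerivAt_columnPoint (s : ℝ) {y : Plane} (ha : DifferentiableAt ℝ a y)
    (hb : DifferentiableAt ℝ b y) :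
    HasFDerivAt (columnPoint a b s) ((columnSlope a b s y).smulRight axis + embed) y := by
  have h1 : HasFDerivAt (columnHeight a b s) (columnSlope a b s y) y :=
    ha.hasFDerivAt.add ((hb.hasFDerivAt.sub ha.hasFDerivAt).const_mul s)
  have h2 := (h1.smul_const axis).add embed.hasFDerivAt
  unfold columnPoint
  simp only [lift_eq]
  exact h2

lemma hasDerivAt_columnPoint (s : ℝ) (y : Plane) :
    HasDerivAt (fun s => columnPoint a b s y) ((b y - a y) • axis) s := by
  have h1 : HasDerivAt (fun s => columnHeight a b s y) (b y - a y) s := by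
    simpa [columnHeight] using ((hasDerivAt_id s).mul_const (b y - a y)).const_add (a y)
  unfold columnPoint
  simp only [lift_eq]
  exact (h1.smul_const axis).add_const _

lemma continuous_columnPoint (y : Plane) : Continuous fun s => columnPoint a b s y :=
  continuous_iff_continuousAt.2 fun s => (hasDerivAt_columnPoint s y).continuousAt

/-- The integrand of `columnFlux`. -/
def columnIntegrand (a b : Plane → ℝ) (V : Space → Space) (y : Plane) (s : ℝ) : Plane :=
  (b y - a y) • cross (V (columnPoint a b s y))

/-- The flux of the cross-sectional part of `V` through a column between two graphs. -/
def columnFlux (a b : Plane → ℝ) (V : Space → Space) (y : Plane) : Plane :=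
  ∫ s in (0 : ℝ)..1, columnIntegrand a b V y s

/-- The derivative of `columnIntegrand` in the cross-sectional variable. -/
def columnDeriv (a b : Plane → ℝ) (V : Space → Space) (y : Plane) (s : ℝ) : Plane →L[ℝ] Plane :=
  (b y - a y) • (crossL ∘L fderiv ℝ V (columnPoint a b s y) ∘L
      ((columnSlope a b s y).smulRight axis + embed)) +
    (fderiv ℝ b y - fderiv ℝ a y).smulRight (cross (V (columnPoint a b s y)))

lemma hasFDerivAt_columnIntegrand {s : ℝ} {y : Plane} (ha : DifferentiableAt ℝ a y)
    (hb : DifferentiableAt ℝ b y) (hV : DifferentiableAt ℝ V (columnPoint a b s y)) :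
    HasFDerivAt (fun y => columnIntegrand a b V y s) (columnDeriv a b V y s) y := by
  have h1 : HasFDerivAt (fun y => cross (V (columnPoint a b s y)))
      (crossL ∘L fderiv ℝ V (columnPoint a b s y) ∘L
      ((columnSlope a b s y).smulRight axis + embed)) y :=
    crossL.hasFDerivAt.comp y (hV.hasFDerivAt.comp y (hasFDerivAt_columnPoint s ha hb))
  exact (hb.hasFDerivAt.sub ha.hasFDerivAt).smul h1

lemma norm_crossL_le : ‖crossL‖ ≤ 1 :=
  ContinuousLinearMap.opNorm_le_bound _ zero_le_one fun x => by
    simpa using norm_cross_le x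

lemma norm_embed_le : ‖embed‖ ≤ 1 :=
  ContinuousLinearMap.opNorm_le_bound _ zero_le_one fun x => by
    simp [norm_embed]

lemma norm_columnDeriv_le {s K : ℝ} {y : Plane} (hs : s ∈ Ioo (0 : ℝ) 1) (hK : 0 ≤ K)
    (ha : ‖fderiv ℝ a y‖ ≤ K) (hb : ‖fderiv ℝ b y‖ ≤ K) (h2 : |b y - a y| ≤ 2)
    (hVC : ‖V (columnPoint a b s y)‖ ≤ C) (hDC : ‖fderiv ℝ V (columnPoint a b s y)‖ ≤ C) :
    ‖columnDeriv a b V y s‖ ≤ 2 * (1 * (C * (3 * K + 1))) + 2 * K * C := by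
  have hC : 0 ≤ C := (norm_nonneg _).trans hVC
  have hba : ‖fderiv ℝ b y - fderiv ℝ a y‖ ≤ 2 * K := (norm_sub_le _ _).trans (by linarith)
  have hsl : ‖columnSlope a b s y‖ ≤ 3 * K := by
    refine (norm_add_le _ _).trans ?_
    rw [norm_smul, Real.norm_of_nonneg hs.1.le]
    nlinarith [hs.1, hs.2, norm_nonneg (fderiv ℝ b y - fderiv ℝ a y)]
  have hL : ‖(columnSlope a b s y).smulRight axis + embed‖ ≤ 3 * K + 1 := by
    refine (norm_add_le _ _).trans (add_le_add ?_ norm_embed_le)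
    rw [ContinuousLinearMap.norm_smulRight_apply, norm_axis, mul_one]
    exact hsl
  refine (norm_add_le _ _).trans (add_le_add ?_ ?_)
  · rw [norm_smul]
    refine mul_le_mul h2 ?_ (norm_nonneg _) (by norm_num)
    refine (ContinuousLinearMap.opNorm_comp_le _ _).trans
      (mul_le_mul norm_crossL_le ?_ (norm_nonneg _) zero_le_one)
    exact (ContinuousLinearMap.opNorm_comp_le _ _).trans
      (mul_le_mul hDC hL (norm_nonneg _) hC)
  · rw [ContinuousLinearMap.norm_smulRight_apply]
    exact mul_le_mul hba ((norm_cross_le _).trans hVC) (norm_nonneg _) (by positivity)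

/-- The trace of an endomorphism of the plane. -/
def planarTrace : (Plane →L[ℝ] Plane) →L[ℝ] ℝ :=
  ∑ j : Fin 2, (EuclideanSpace.proj j : Plane →L[ℝ] ℝ) ∘L
    (ContinuousLinearMap.apply ℝ Plane (EuclideanSpace.single j (1 : ℝ)))

lemma planarTrace_apply (A : Plane →L[ℝ] Plane) :
    planarTrace A = ∑ j : Fin 2, A (EuclideanSpace.single j 1) j := by
  simp [planarTrace]

lemma planarTrace_smulRight (l : Plane →L[ℝ] ℝ) (w : Plane) :
    planarTrace (l.smulRight w) = l w := by
  rw [planarTrace_apply, clm_apply_eq_sum l w]; simp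

/-- The normal component of `V` with respect to the graph at fraction `s`. -/
def columnNormal (a b : Plane → ℝ) (V : Space → Space) (y : Plane) (s : ℝ) : ℝ :=
  V (columnPoint a b s y) 0 - columnSlope a b s y (cross (V (columnPoint a b s y)))

/-- The derivative of `columnNormal`. -/
def columnNormalDeriv (a b : Plane → ℝ) (V : Space → Space) (y : Plane) (s : ℝ) : ℝ :=
  (b y - a y) * (fderiv ℝ V (columnPoint a b s y) axis 0 -
    columnSlope a b s y (cross (fderiv ℝ V (columnPoint a b s y) axis))) -
    (fderiv ℝ b y - fderiv ℝ a y) (cross (V (columnPoint a b s y)))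

lemma hasDerivAt_columnNormal {s : ℝ} {y : Plane}
    (hV : DifferentiableAt ℝ V (columnPoint a b s y)) :
    HasDerivAt (columnNormal a b V y) (columnNormalDeriv a b V y s) s := by
  have h1 : HasDerivAt (fun s => V (columnPoint a b s y))
      ((b y - a y) • fderiv ℝ V (columnPoint a b s y) axis) s := by
    have := hV.hasFDerivAt.comp_hasDerivAt s (hasDerivAt_columnPoint (a := a) (b := b) s y)
    simp only [map_smul] at this
    exact this
  have h2 : HasDerivAt (fun s => V (columnPoint a b s y) 0)
      ((b y - a y) * fderiv ℝ V (columnPoint a b s y) axis 0) s := by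
    have := (EuclideanSpace.proj 0 : Space →L[ℝ] ℝ).hasFDerivAt.comp_hasDerivAt s h1
    simp only [map_smul] at this
    exact this
  have h3 : HasDerivAt (fun s => cross (V (columnPoint a b s y)))
      ((b y - a y) • cross (fderiv ℝ V (columnPoint a b s y) axis)) s := by
    have := crossL.hasFDerivAt.comp_hasDerivAt s h1
    simp only [map_smul] at this
    exact this
  have h4 : HasDerivAt (fun s => columnSlope a b s y) (fderiv ℝ b y - fderiv ℝ a y) s := by
    simpa [columnSlope] using
      ((hasDerivAt_id s).smul_const (fderiv ℝ b y - fderiv ℝ a y)).const_add (fderiv ℝ a y)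
  have h5 := h2.sub (h4.clm_apply h3)
  unfold columnNormal
  convert! h5 using 1
  simp [columnNormalDeriv]
  ring

/-- In the coordinates (s, y) that flatten the region, the Jacobian `b - a` times the divergence is
the planar divergence of the integrand plus the `s`-derivative of the normal component; the terms
with the slope cancel. -/
lemma planarTrace_columnDeriv (y : Plane) (s : ℝ) :
    planarTrace (columnDeriv a b V y s) + columnNormalDeriv a b V y s =
      (b y - a y) * divergence V (columnPoint a b s y) := by
  rw [columnDeriv, map_add, planarTrace_smulRight, divergence_eq_coord, columnNormalDeriv,
    map_smul]
  set D := fderiv ℝ V (columnPoint a b s y)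
  have : planarTrace (crossL ∘L D ∘L ((columnSlope a b s y).smulRight axis + embed)) =
      columnSlope a b s y (cross (D axis)) +
        ∑ j : Fin 2, cross (D (embed (EuclideanSpace.single j 1))) j := by
    rw [clm_apply_eq_sum (columnSlope a b s y), planarTrace_apply, ← Finset.sum_add_distrib]
    refine Finset.sum_congr rfl fun j _ => ?_
    simp
  rw [this]
  simp
  ring

end Column

/-- `V` is a `C¹` field between the graphs of `a` and `b` in the duct, bounded together with its
derivative and with no flux through the wall. -/
structure IsDuctField (Ω : Set Plane) (a b : Plane → ℝ) (V : Space → Space) : Prop where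
  bot_contDiff : ContDiffOn ℝ 1 a Ω
  top_contDiff : ContDiffOn ℝ 1 b Ω
  bot_lt_top : ∀ y ∈ Ω, a y < b y
  bot_ge : ∀ y ∈ Ω, -1 ≤ a y
  top_le : ∀ y ∈ Ω, b y ≤ 1
  contDiff : ContDiffOn ℝ 1 V (graphRegion Ω a b)
  bounded : ∃ C, ∀ x ∈ graphRegion Ω a b, ‖V x‖ ≤ C ∧ ‖fderiv ℝ V x‖ ≤ C
  wall : ∀ x ∈ wall Ω, ∀ n, IsOutwardUnitNormal Ω (cross x) n →
    Tendsto (fun z => inner ℝ (V z) (embed n)) (𝓝[graphRegion Ω a b] x) (𝓝 0)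

lemma tendsto_clm_apply {α E F : Type*} [NormedAddCommGroup E] [NormedSpace ℝ E]
    [NormedAddCommGroup F] [NormedSpace ℝ F] {l : Filter α} {A : α → E →L[ℝ] F} {A₀ : E →L[ℝ] F}
    {v : α → E} {v₀ : E} (hA : Tendsto A l (𝓝 A₀)) (hv : Tendsto v l (𝓝 v₀)) :
    Tendsto (fun s => A s (v s)) l (𝓝 (A₀ v₀)) :=
  (isBoundedBilinearMap_apply.continuous.tendsto (A₀, v₀)).comp (hA.prodMk_nhds hv)

/-! ### The divergence theorem in the duct -/

section Region

variable {Ω : Set Plane} {a b : Plane → ℝ} {V : Space → Space}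

lemma IsDuctField.isOpen (hV : IsDuctField Ω a b V) (hΩ : IsOpen Ω) :
    IsOpen (graphRegion Ω a b) :=
  isOpen_graphRegion hΩ hV.bot_contDiff.continuousOn hV.top_contDiff.continuousOn

lemma IsDuctField.differentiableAt_bot (hV : IsDuctField Ω a b V) (hΩ : IsOpen Ω) {y : Plane}
    (hy : y ∈ Ω) : DifferentiableAt ℝ a y :=
  (hV.bot_contDiff.contDiffAt (hΩ.mem_nhds hy)).differentiableAt one_ne_zero

lemma IsDuctField.differentiableAt_top (hV : IsDuctField Ω a b V) (hΩ : IsOpen Ω) {y : Plane}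
    (hy : y ∈ Ω) : DifferentiableAt ℝ b y :=
  (hV.top_contDiff.contDiffAt (hΩ.mem_nhds hy)).differentiableAt one_ne_zero

lemma IsDuctField.differentiableAt (hV : IsDuctField Ω a b V) (hΩ : IsOpen Ω) {x : Space}
    (hx : x ∈ graphRegion Ω a b) : DifferentiableAt ℝ V x :=
  (hV.contDiff.contDiffAt ((hV.isOpen hΩ).mem_nhds hx)).differentiableAt one_ne_zero

lemma IsDuctField.continuousOn_fderiv (hV : IsDuctField Ω a b V) (hΩ : IsOpen Ω) :
    ContinuousOn (fderiv ℝ V) (graphRegion Ω a b) :=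
  hV.contDiff.continuousOn_fderiv_of_isOpen (hV.isOpen hΩ) le_rfl

lemma IsDuctField.abs_sub_le (hV : IsDuctField Ω a b V) {y : Plane} (hy : y ∈ Ω) :
    |b y - a y| ≤ 2 := by
  have := hV.bot_lt_top y hy
  rw [abs_of_pos (by linarith)]
  linarith [hV.bot_ge y hy, hV.top_le y hy]

lemma continuousOn_column (hab : ∀ y ∈ Ω, a y < b y) {F : Type*} [TopologicalSpace F]
    {k : Space → F} (hk : ContinuousOn k (graphRegion Ω a b)) {y : Plane} (hy : y ∈ Ω) :
    ContinuousOn (fun s => k (columnPoint a b s y)) (Ioo 0 1) :=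
  hk.comp (continuous_columnPoint y).continuousOn fun _ hs => columnPoint_mem hab hy hs

lemma intervalIntegrable_of_continuousOn_Ioo {E : Type*} [NormedAddCommGroup E]
    {k : ℝ → E} (hk : ContinuousOn k (Ioo 0 1)) {C : ℝ}
    (hC : ∀ s ∈ Ioo (0 : ℝ) 1, ‖k s‖ ≤ C) : IntervalIntegrable k volume 0 1 := by
  rw [intervalIntegrable_iff_integrableOn_Ioo_of_le zero_le_one]
  exact IntegrableOn.of_bound (by simp) (hk.aestronglyMeasurable measurableSet_Ioo) C
    ((ae_restrict_iff' measurableSet_Ioo).2 (ae_of_all _ hC))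

lemma ae_Ioc_of_Ioo {P : ℝ → Prop} (h : ∀ s ∈ Ioo (0 : ℝ) 1, P s) :
    ∀ᵐ s, s ∈ Set.uIoc (0 : ℝ) 1 → P s := by
  rw [uIoc_of_le zero_le_one]
  have : ∀ᵐ s : ℝ, s ≠ 1 := by simp [ae_iff]
  filter_upwards [this] with s hs hs'
  exact h s ⟨hs'.1, lt_of_le_of_ne hs'.2 hs⟩

lemma IsDuctField.continuousOn_integrand (hV : IsDuctField Ω a b V) {y : Plane} (hy : y ∈ Ω) :
    ContinuousOn (columnIntegrand a b V y) (Ioo 0 1) :=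
  (crossL.continuous.comp_continuousOn
    (continuousOn_column hV.bot_lt_top hV.contDiff.continuousOn hy)).const_smul (b y - a y)

lemma continuous_columnSlope (y : Plane) : Continuous fun s => columnSlope a b s y :=
  continuous_const.add (continuous_id.smul continuous_const)

lemma IsDuctField.continuousOn_columnDeriv (hV : IsDuctField Ω a b V) (hΩ : IsOpen Ω) {y : Plane}
    (hy : y ∈ Ω) : ContinuousOn (columnDeriv a b V y) (Ioo 0 1) := by
  have h1 := continuousOn_column hV.bot_lt_top (hV.continuousOn_fderiv hΩ) hy
  have h2 := crossL.continuous.comp_continuousOn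
    (continuousOn_column hV.bot_lt_top hV.contDiff.continuousOn hy)
  refine continuousOn_clm_apply.2 fun k => ?_
  have h3 : Continuous fun s => columnSlope a b s y k • axis + embed k :=
    (((continuous_columnSlope y).clm_apply continuous_const).smul continuous_const).add
      continuous_const
  have h4 := crossL.continuous.comp_continuousOn (h1.clm_apply h3.continuousOn)
  exact (h4.const_smul (b y - a y)).add (h2.const_smul ((fderiv ℝ b y - fderiv ℝ a y) k))

lemma IsDuctField.exists_bound_columnDeriv (hV : IsDuctField Ω a b V) (hΩ : IsOpen Ω)
    {y₀ : Plane} (hy₀ : y₀ ∈ Ω) : ∃ B, ∀ᶠ y in 𝓝 y₀, y ∈ Ω ∧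
      ∀ s ∈ Ioo (0 : ℝ) 1, ‖columnDeriv a b V y s‖ ≤ B := by
  obtain ⟨C, hC⟩ := hV.bounded
  have ha := ((hV.bot_contDiff.continuousOn_fderiv_of_isOpen hΩ le_rfl).continuousAt
    (hΩ.mem_nhds hy₀)).norm.eventually_lt_const (lt_add_one _)
  have hb := ((hV.top_contDiff.continuousOn_fderiv_of_isOpen hΩ le_rfl).continuousAt
    (hΩ.mem_nhds hy₀)).norm.eventually_lt_const (lt_add_one _)
  set K := max (‖fderiv ℝ a y₀‖ + 1) (‖fderiv ℝ b y₀‖ + 1)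
  have hK : 0 ≤ K := le_max_of_le_left (by positivity)
  refine ⟨2 * (1 * (C * (3 * K + 1))) + 2 * K * C, ?_⟩
  filter_upwards [ha, hb, hΩ.mem_nhds hy₀] with y h1 h2 hy
  refine ⟨hy, fun s hs => ?_⟩
  have hm := hC _ (columnPoint_mem hV.bot_lt_top hy hs)
  exact norm_columnDeriv_le hs hK (h1.le.trans (le_max_left _ _)) (h2.le.trans (le_max_right _ _))
    (hV.abs_sub_le hy) hm.1 hm.2

lemma IsDuctField.intervalIntegrable_integrand (hV : IsDuctField Ω a b V) {y : Plane}
    (hy : y ∈ Ω) : IntervalIntegrable (columnIntegrand a b V y) volume 0 1 := by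
  obtain ⟨C, hC⟩ := hV.bounded
  refine intervalIntegrable_of_continuousOn_Ioo (hV.continuousOn_integrand hy) (C := 2 * C) ?_
  intro s hs
  rw [columnIntegrand, norm_smul]
  exact mul_le_mul (hV.abs_sub_le hy) ((norm_cross_le _).trans
    (hC _ (columnPoint_mem hV.bot_lt_top hy hs)).1) (norm_nonneg _) (by norm_num)

/-- Differentiation under the integral sign, dominated by the constant of
`exists_bound_columnDeriv`. The bounds on `V` and its derivative hold up to the graphs, so the open
ends of the column cause no trouble. -/
lemma IsDuctField.hasFDerivAt_columnFlux (hV : IsDuctField Ω a b V) (hΩ : IsOpen Ω)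
    {y₀ : Plane} (hy₀ : y₀ ∈ Ω) :
    HasFDerivAt (columnFlux a b V) (∫ s in (0 : ℝ)..1, columnDeriv a b V y₀ s) y₀ := by
  obtain ⟨B, hB⟩ := hV.exists_bound_columnDeriv hΩ hy₀
  have haes : ∀ {E : Type} [NormedAddCommGroup E] {k : ℝ → E}, ContinuousOn k (Ioo 0 1) →
      AEStronglyMeasurable k (volume.restrict (Set.uIoc (0 : ℝ) 1)) := by
    intro E _ k hk
    rw [uIoc_of_le zero_le_one, ← restrict_Ioo_eq_restrict_Ioc]
    exact hk.aestronglyMeasurable measurableSet_Ioo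
  refine intervalIntegral.hasFDerivAt_integral_of_dominated_of_fderiv_le
    (F := columnIntegrand a b V) (F' := columnDeriv a b V) (bound := fun _ => B) hB ?_
    (hV.intervalIntegrable_integrand hy₀) (haes (hV.continuousOn_columnDeriv hΩ hy₀)) ?_
    intervalIntegrable_const ?_
  · filter_upwards [hΩ.mem_nhds hy₀] with y hy using haes (hV.continuousOn_integrand hy)
  · exact ae_Ioc_of_Ioo fun s hs y hy => hy.2 s hs
  · exact ae_Ioc_of_Ioo fun s hs y hy =>
      hasFDerivAt_columnIntegrand (hV.differentiableAt_bot hΩ hy.1)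
        (hV.differentiableAt_top hΩ hy.1)
        (hV.differentiableAt hΩ (columnPoint_mem hV.bot_lt_top hy.1 hs))

lemma IsDuctField.intervalIntegrable_divergence (hV : IsDuctField Ω a b V) (hΩ : IsOpen Ω)
    {y : Plane} (hy : y ∈ Ω) :
    ContinuousOn (fun s => divergence V (columnPoint a b s y)) (Ioo 0 1) ∧
    IntervalIntegrable (fun s => divergence V (columnPoint a b s y)) volume 0 1 := by
  obtain ⟨C, hC⟩ := hV.bounded
  have hc : ContinuousOn (divergence V) (graphRegion Ω a b) := by
    unfold divergence
    refine continuousOn_finsetSum _ fun i _ => ?_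
    exact (EuclideanSpace.proj i : Space →L[ℝ] ℝ).continuous.comp_continuousOn
      ((hV.continuousOn_fderiv hΩ).clm_apply continuousOn_const)
  have h := continuousOn_column hV.bot_lt_top hc hy
  refine ⟨h, intervalIntegrable_of_continuousOn_Ioo h (C := ∑ i : Fin 3, C) fun s hs => ?_⟩
  refine (norm_sum_le _ _).trans (Finset.sum_le_sum fun i _ => ?_)
  refine (PiLp.norm_apply_le _ i).trans ((ContinuousLinearMap.le_opNorm _ _).trans ?_)
  simpa using (hC _ (columnPoint_mem hV.bot_lt_top hy hs)).2

lemma tendsto_columnHeight_bot (hab : ∀ y ∈ Ω, a y < b y) {y : Plane} (hy : y ∈ Ω) :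
    Tendsto (fun s => columnHeight a b s y) (𝓝[>] 0) (𝓝[>] a y) := by
  refine tendsto_nhdsWithin_iff.2 ⟨?_, ?_⟩
  · have : Continuous fun s => columnHeight a b s y := by unfold columnHeight; fun_prop
    simpa [columnHeight] using (this.tendsto 0).mono_left nhdsWithin_le_nhds
  · filter_upwards [self_mem_nhdsWithin] with s hs
    have : 0 < s * (b y - a y) := mul_pos hs (sub_pos.2 (hab y hy))
    simpa [columnHeight] using this

lemma tendsto_columnHeight_top (hab : ∀ y ∈ Ω, a y < b y) {y : Plane} (hy : y ∈ Ω) :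
    Tendsto (fun s => columnHeight a b s y) (𝓝[<] 1) (𝓝[<] b y) := by
  refine tendsto_nhdsWithin_iff.2 ⟨?_, ?_⟩
  · have : Continuous fun s => columnHeight a b s y := by unfold columnHeight; fun_prop
    simpa [columnHeight] using (this.tendsto 1).mono_left nhdsWithin_le_nhds
  · filter_upwards [self_mem_nhdsWithin] with s hs
    have : 0 < (1 - s) * (b y - a y) := mul_pos (sub_pos.2 hs) (sub_pos.2 (hab y hy))
    simp only [columnHeight, mem_Iio]
    linarith

/-- Integrate `planarTrace_columnDeriv` along the column. The end values of `columnNormal` are the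
fluxes through the two graphs; they enter as limits because `V` is controlled only strictly between
the graphs. -/
lemma IsDuctField.integral_columnNormalDeriv (hV : IsDuctField Ω a b V) (hΩ : IsOpen Ω)
    {y : Plane} (hy : y ∈ Ω) {va vb : Space}
    (hva : Tendsto (fun t => V (lift t y)) (𝓝[>] a y) (𝓝 va))
    (hvb : Tendsto (fun t => V (lift t y)) (𝓝[<] b y) (𝓝 vb)) :
    planarDiv (columnFlux a b V) y + (inner ℝ vb (frontNormal b y) -
      inner ℝ va (frontNormal a y)) =
      (b y - a y) * ∫ s in (0 : ℝ)..1, divergence V (columnPoint a b s y) := by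
  obtain ⟨B, hB⟩ := hV.exists_bound_columnDeriv hΩ hy
  have hB' := hB.self_of_nhds.2
  have i1 := intervalIntegrable_of_continuousOn_Ioo (hV.continuousOn_columnDeriv hΩ hy) hB'
  have i2 := (hV.intervalIntegrable_divergence hΩ hy).2.const_mul (b y - a y)
  have e1 : planarDiv (columnFlux a b V) y =
      ∫ s in (0 : ℝ)..1, planarTrace (columnDeriv a b V y s) := by
    rw [ContinuousLinearMap.intervalIntegral_comp_comm _ i1, planarTrace_apply, planarDiv,
      (hV.hasFDerivAt_columnFlux hΩ hy).fderiv]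
  have i3 : IntervalIntegrable (fun s => planarTrace (columnDeriv a b V y s)) volume 0 1 :=
    ⟨planarTrace.integrable_comp i1.1, planarTrace.integrable_comp i1.2⟩
  have e2 : columnNormalDeriv a b V y = fun s =>
      (b y - a y) * divergence V (columnPoint a b s y) - planarTrace (columnDeriv a b V y s) := by
    ext s; rw [← planarTrace_columnDeriv]; ring
  have i4 : IntervalIntegrable (columnNormalDeriv a b V y) volume 0 1 := by
    rw [e2]; exact i2.sub i3
  have hsl : ∀ s₀, ∀ l : Filter ℝ, l ≤ 𝓝 s₀ →
      Tendsto (fun s => columnSlope a b s y) l (𝓝 (columnSlope a b s₀ y)) := fun s₀ l hl =>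
    ((continuous_columnSlope y).tendsto s₀).mono_left hl
  have hlim : ∀ s₀, ∀ l : Filter ℝ, l ≤ 𝓝 s₀ → ∀ v : Space,
      Tendsto (fun s => V (columnPoint a b s y)) l (𝓝 v) →
      Tendsto (columnNormal a b V y) l (𝓝 (v 0 - columnSlope a b s₀ y (cross v))) := by
    intro s₀ l hl v hv
    exact (((continuous_coord 0).tendsto v).comp hv).sub
      (tendsto_clm_apply (hsl s₀ l hl) ((continuous_cross.tendsto v).comp hv))
  have e3 := intervalIntegral.integral_eq_sub_of_hasDerivAt_of_tendsto zero_lt_one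
    (fun s hs => hasDerivAt_columnNormal
      (hV.differentiableAt hΩ (columnPoint_mem hV.bot_lt_top hy hs))) i4
    (hlim 0 _ nhdsWithin_le_nhds va (hva.comp (tendsto_columnHeight_bot hV.bot_lt_top hy)))
    (hlim 1 _ nhdsWithin_le_nhds vb (hvb.comp (tendsto_columnHeight_top hV.bot_lt_top hy)))
  have s0 : columnSlope a b 0 y = fderiv ℝ a y := by simp [columnSlope]
  have s1 : columnSlope a b 1 y = fderiv ℝ b y := by simp [columnSlope]
  rw [s0, s1, ← inner_frontNormal, ← inner_frontNormal] at e3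
  rw [← e3, e1, ← intervalIntegral.integral_add i3 i4, ← intervalIntegral.integral_const_mul]
  refine intervalIntegral.integral_congr fun s _ => ?_
  exact planarTrace_columnDeriv y s

/-- Compactness of `[-1, 1]` makes the slip condition uniform along the line of the wall above `p`,
as needed for the integrated flux. -/
lemma IsDuctField.wall_uniform (hV : IsDuctField Ω a b V) {p : Plane} (hp : p ∈ frontier Ω)
    {n : Plane} (hn : IsOutwardUnitNormal Ω p n) {δ : ℝ} (hδ : 0 < δ) :
    ∀ᶠ y in 𝓝 p, ∀ t ∈ Icc (-1 : ℝ) 1, lift t y ∈ graphRegion Ω a b →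
      |inner ℝ (cross (V (lift t y))) n| < δ := by
  refine (isCompact_Icc (a := (-1 : ℝ)) (b := 1)).eventually_forall_of_forall_eventually ?_
  intro t ht
  have h1 := hV.wall (lift t p) ⟨by simpa using ht, by simpa using hp⟩ n (by simpa using hn)
  have h3 := eventually_nhdsWithin_iff.1 (h1.abs.eventually_lt_const (by simpa using hδ))
  have h4 : Tendsto (fun z : Plane × ℝ => lift z.2 z.1) (𝓝 (p, t)) (𝓝 (lift t p)) :=
    (continuous_lift.comp continuous_swap).tendsto (p, t)
  filter_upwards [h4.eventually h3] with z hz hzR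
  rw [← inner_embed]
  exact hz hzR

lemma IsDuctField.isTangentialField (hV : IsDuctField Ω a b V) (hΩ : IsOpen Ω) :
    IsTangentialField Ω (columnFlux a b V) where
  differentiableAt y hy := (hV.hasFDerivAt_columnFlux hΩ hy).differentiableAt
  locally_bounded y hy := by
    obtain ⟨B, hB⟩ := hV.exists_bound_columnDeriv hΩ hy
    refine ⟨B * |1 - 0|, ?_⟩
    filter_upwards [hB] with z hz
    rw [(hV.hasFDerivAt_columnFlux hΩ hz.1).fderiv]
    exact intervalIntegral.norm_integral_le_of_norm_le_const_ae (ae_Ioc_of_Ioo hz.2)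
  bounded := by
    obtain ⟨C, hC⟩ := hV.bounded
    refine ⟨2 * C * |1 - 0|, fun y hy => ?_⟩
    refine intervalIntegral.norm_integral_le_of_norm_le_const_ae (ae_Ioc_of_Ioo fun s hs => ?_)
    rw [columnIntegrand, norm_smul]
    exact mul_le_mul (hV.abs_sub_le hy) ((norm_cross_le _).trans
      (hC _ (columnPoint_mem hV.bot_lt_top hy hs)).1) (norm_nonneg _) (by norm_num)
  wall p hp g hg := by
    have hG : 0 < ‖gradient g p‖ := norm_pos_iff.2 hg.1
    rw [Metric.tendsto_nhds]
    intro ε hε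
    have hδ : 0 < ε / (4 * ‖gradient g p‖) := by positivity
    filter_upwards [mem_nhdsWithin_of_mem_nhds (hV.wall_uniform hp ⟨g, hg, rfl⟩ hδ),
      self_mem_nhdsWithin] with y hy hyΩ
    rw [dist_zero_right, real_inner_comm, columnFlux]
    have : inner ℝ (gradient g p) (∫ s in (0 : ℝ)..1, columnIntegrand a b V y s) =
        ∫ s in (0 : ℝ)..1, inner ℝ (gradient g p) (columnIntegrand a b V y s) :=
      (ContinuousLinearMap.intervalIntegral_comp_comm (innerSL ℝ (gradient g p))
        (hV.intervalIntegrable_integrand hyΩ)).symm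
    rw [this]
    refine (intervalIntegral.norm_integral_le_of_norm_le_const_ae
      (C := ε / 2) (ae_Ioc_of_Ioo fun s hs => ?_)).trans_lt (by norm_num; exact hε)
    have hm := columnPoint_mem hV.bot_lt_top hyΩ hs
    have hm' := lift_mem_graphRegion.1 hm
    have h1 := hy (columnHeight a b s y)
      ⟨(hV.bot_ge y hyΩ).trans hm'.2.1.le, hm'.2.2.le.trans (hV.top_le y hyΩ)⟩ hm
    rw [inner_smul_right, abs_mul, abs_of_pos (inv_pos.2 hG), inv_mul_lt_iff₀ hG] at h1
    rw [columnIntegrand, inner_smul_right, norm_mul, real_inner_comm]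
    calc ‖b y - a y‖ * ‖inner ℝ (cross (V (columnPoint a b s y))) (gradient g p)‖
        ≤ 2 * (‖gradient g p‖ * (ε / (4 * ‖gradient g p‖))) :=
          mul_le_mul (hV.abs_sub_le hyΩ) h1.le (norm_nonneg _) (by norm_num)
      _ = ε / 2 := by field_simp; norm_num

/-- A field in the duct with nonnegative divergence between two graphs, whose total flux through
the boundary is nonpositive, is divergence free. -/
theorem IsDuctField.divergence_eq_zero (hV : IsDuctField Ω a b V) (hΩ : IsCrossSection Ω)
    (hdiv : ∀ x ∈ graphRegion Ω a b, 0 ≤ divergence V x)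
    (hflux : ∀ y ∈ Ω, ∃ va vb : Space, Tendsto (fun t => V (lift t y)) (𝓝[>] a y) (𝓝 va) ∧
      Tendsto (fun t => V (lift t y)) (𝓝[<] b y) (𝓝 vb) ∧
      inner ℝ vb (frontNormal b y) ≤ inner ℝ va (frontNormal a y)) :
    ∀ x ∈ graphRegion Ω a b, divergence V x = 0 := by
  have hnn : ∀ y ∈ Ω, ∀ s ∈ Ioo (0 : ℝ) 1, 0 ≤ divergence V (columnPoint a b s y) :=
    fun y hy s hs => hdiv _ (columnPoint_mem hV.bot_lt_top hy hs)
  have hint0 : ∀ y ∈ Ω, 0 ≤ ∫ s in (0 : ℝ)..1, divergence V (columnPoint a b s y) := by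
    intro y hy
    rw [intervalIntegral.integral_of_le zero_le_one, integral_Ioc_eq_integral_Ioo]
    exact setIntegral_nonneg measurableSet_Ioo (hnn y hy)
  have hle : ∀ y ∈ Ω, (b y - a y) * ∫ s in (0 : ℝ)..1, divergence V (columnPoint a b s y) ≤
      planarDiv (columnFlux a b V) y := by
    intro y hy
    obtain ⟨va, vb, hva, hvb, hf⟩ := hflux y hy
    have := hV.integral_columnNormalDeriv hΩ.isOpen hy hva hvb
    linarith
  have hae := planarDiv_ae_eq_zero hΩ (hV.isTangentialField hΩ.isOpen) fun y hy =>
    (mul_nonneg (sub_nonneg.2 (hV.bot_lt_top y hy).le) (hint0 y hy)).trans (hle y hy)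
  -- On almost every column a continuous nonnegative function has zero integral, hence vanishes
  -- identically.
  have hcol : ∀ᵐ y ∂(volume.restrict Ω), ∀ s ∈ Ioo (0 : ℝ) 1,
      divergence V (columnPoint a b s y) = 0 := by
    filter_upwards [hae, ae_restrict_mem hΩ.isOpen.measurableSet] with y hy0 hy
    have h1 := hle y hy
    rw [hy0] at h1
    have hab := sub_pos.2 (hV.bot_lt_top y hy)
    have h2 : ∫ s in (0 : ℝ)..1, divergence V (columnPoint a b s y) = 0 :=
      le_antisymm (by nlinarith [hint0 y hy]) (hint0 y hy)
    obtain ⟨hc, hi⟩ := hV.intervalIntegrable_divergence hΩ.isOpen hy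
    rw [intervalIntegral.integral_of_le zero_le_one, integral_Ioc_eq_integral_Ioo,
      setIntegral_eq_zero_iff_of_nonneg_ae
        ((ae_restrict_iff' measurableSet_Ioo).2 (ae_of_all _ (hnn y hy)))
        ((intervalIntegrable_iff_integrableOn_Ioo_of_le zero_le_one).1 hi)] at h2
    exact Measure.eqOn_open_of_ae_eq h2 isOpen_Ioo hc continuousOn_const
  intro x hx
  -- From almost every column to every point: on the slice of the region through `x` the divergence
  -- is continuous and vanishes almost everywhere.
  have hopen : IsOpen {y | lift (x 0) y ∈ graphRegion Ω a b} :=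
    (hV.isOpen hΩ.isOpen).preimage (continuous_lift.comp (by fun_prop : Continuous fun y => (x 0, y)))
  have hcx : ContinuousOn (fun y => divergence V (lift (x 0) y))
      {y | lift (x 0) y ∈ graphRegion Ω a b} := by
    have hc : ContinuousOn (divergence V) (graphRegion Ω a b) := by
      unfold divergence
      refine continuousOn_finsetSum _ fun i _ => ?_
      exact (EuclideanSpace.proj i : Space →L[ℝ] ℝ).continuous.comp_continuousOn
        ((hV.continuousOn_fderiv hΩ.isOpen).clm_apply continuousOn_const)
    exact hc.comp (continuous_lift.comp
      (by fun_prop : Continuous fun y => (x 0, y))).continuousOn fun y hy => hy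
  have hsub : {y | lift (x 0) y ∈ graphRegion Ω a b} ⊆ Ω := fun y hy =>
    (lift_mem_graphRegion.1 hy).1
  have hae0 : (fun y => divergence V (lift (x 0) y))
      =ᵐ[volume.restrict {y | lift (x 0) y ∈ graphRegion Ω a b}] fun _ => (0 : ℝ) := by
    filter_upwards [ae_restrict_of_ae_restrict_of_subset hsub hcol,
      ae_restrict_mem hopen.measurableSet] with y hy hyR
    obtain ⟨h1, h2, h3⟩ := lift_mem_graphRegion.1 hyR
    have hab : 0 < b y - a y := by linarith
    have := hy ((x 0 - a y) / (b y - a y))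
      ⟨div_pos (by linarith) hab, (div_lt_one hab).2 (by linarith)⟩
    rwa [columnPoint, columnHeight, div_mul_cancel₀ _ hab.ne', add_sub_cancel] at this
  have := Measure.eqOn_open_of_ae_eq hae0 hopen hcx continuousOn_const
    (show cross x ∈ {y | lift (x 0) y ∈ graphRegion Ω a b} by simpa using hx)
  simpa using this

end Region

end Flux

/-! ### The relative axial momentum current -/

/-- The axial momentum current of the velocity `p` relative to the constant state `q`. -/
def relCurrent (γ b : ℝ) (q p : Space) : Space :=
  (p 0 - q 0) • (massFlux γ b p - massFlux γ b q) -
    (fluxPotential γ b p - fluxPotential γ b q - inner ℝ (massFlux γ b q) (p - q)) • axis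

@[simp] lemma relCurrent_self (γ b : ℝ) (q : Space) : relCurrent γ b q q = 0 := by
  simp [relCurrent]

lemma contDiffAt_relCurrent {γ b : ℝ} {q p : Space} {n : WithTop ℕ∞}
    (h : 0 < bernoulliBase γ b (‖p‖ ^ 2)) : ContDiffAt ℝ n (relCurrent γ b q) p := by
  unfold relCurrent
  have h0 : ContDiffAt ℝ n (fun p : Space => p 0 - q 0) p :=
    ((EuclideanSpace.proj 0 : Space →L[ℝ] ℝ).contDiff.contDiffAt).sub contDiffAt_const
  exact (h0.smul ((contDiffAt_massFlux h).sub contDiffAt_const)).sub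
    ((((contDiffAt_fluxPotential h).sub contDiffAt_const).sub
      (contDiffAt_const.inner ℝ (contDiffAt_id.sub contDiffAt_const))).smul contDiffAt_const)

lemma divergence_sub {V W : Space → Space} {x : Space} (hV : DifferentiableAt ℝ V x)
    (hW : DifferentiableAt ℝ W x) :
    divergence (fun z => V z - W z) x = divergence V x - divergence W x := by
  simp [divergence, fderiv_fun_sub hV hW, Finset.sum_sub_distrib]

lemma divergence_const (c x : Space) : divergence (fun _ => c) x = 0 := by
  simp [divergence]

/-- Conservation of axial momentum: by irrotationality (`hsymm`), the derivative of the axial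
velocity along F(p) - F(q) equals the axial derivative of Π(p) - F(q)·p, so the two contributions
cancel. -/
lemma divergence_relCurrent {γ b : ℝ} (hγ : 1 ≤ γ) {q x : Space} {P : Space → Space}
    (hP : DifferentiableAt ℝ P x) (hb : 0 < bernoulliBase γ b (‖P x‖ ^ 2))
    (hsymm : ∀ h k : Space, inner ℝ (fderiv ℝ P x h) k = inner ℝ (fderiv ℝ P x k) h)
    (hdiv : divergence (fun z => massFlux γ b (P z)) x = 0) :
    divergence (fun z => relCurrent γ b q (P z)) x = 0 := by
  have hF : DifferentiableAt ℝ (fun z => massFlux γ b (P z)) x :=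
    (hasFDerivAt_massFlux hb).differentiableAt.comp x hP
  have hs1 : HasFDerivAt (fun z => P z 0 - q 0)
      ((EuclideanSpace.proj 0 : Space →L[ℝ] ℝ) ∘L fderiv ℝ P x) x :=
    ((EuclideanSpace.proj 0 : Space →L[ℝ] ℝ).hasFDerivAt.comp x hP.hasFDerivAt).sub_const _
  have hs2 : HasFDerivAt (fun z => fluxPotential γ b (P z) - fluxPotential γ b q -
      inner ℝ (massFlux γ b q) (P z - q))
      ((innerSL ℝ (massFlux γ b (P x)) ∘L fderiv ℝ P x) -
        innerSL ℝ (massFlux γ b q) ∘L fderiv ℝ P x) x :=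
    (((hasFDerivAt_fluxPotential hγ hb).comp x hP.hasFDerivAt).sub_const _).sub
      ((innerSL ℝ (massFlux γ b q)).hasFDerivAt.comp x (hP.hasFDerivAt.sub_const q))
  have hd1 : DifferentiableAt ℝ (fun z => massFlux γ b (P z) - massFlux γ b q) x :=
    hF.sub (differentiableAt_const _)
  have hd2 : DifferentiableAt ℝ
      (fun z => (P z 0 - q 0) • (massFlux γ b (P z) - massFlux γ b q)) x :=
    hs1.differentiableAt.smul hd1
  have hd3 : DifferentiableAt ℝ (fun z => (fluxPotential γ b (P z) - fluxPotential γ b q -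
      inner ℝ (massFlux γ b q) (P z - q)) • axis) x :=
    hs2.differentiableAt.smul (differentiableAt_const _)
  unfold relCurrent
  rw [divergence_sub hd2 hd3,
    divergence_smul hs1 hd1, divergence_smul hs2 (differentiableAt_const _),
    divergence_sub hF (differentiableAt_const _), hdiv, divergence_const, divergence_const]
  have := hsymm axis (massFlux γ b (P x) - massFlux γ b q)
  rw [inner_axis] at this
  simp only [ContinuousLinearMap.comp_apply, PiLp.proj_apply, sub_apply,
    innerSL_apply_apply] at this ⊢
  rw [← this, inner_sub_right, real_inner_comm (massFlux γ b (P x)),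
    real_inner_comm (massFlux γ b q)]
  ring

lemma fluxDeriv_symm (γ b : ℝ) (q h k : Space) :
    inner ℝ (fluxDeriv γ b q h) k = inner ℝ (fluxDeriv γ b q k) h := by
  simp only [fluxDeriv_apply, inner_smul_left, inner_sub_left]
  rw [real_inner_comm h k]
  simp
  left; ring

lemma massFlux_expansion {γ b : ℝ} {q : Space} (hb : 0 < bernoulliBase γ b (‖q‖ ^ 2)) {ε : ℝ}
    (hε : 0 < ε) : ∀ᶠ p in 𝓝 q,
      ‖massFlux γ b p - massFlux γ b q - fluxDeriv γ b q (p - q)‖ ≤ ε * ‖p - q‖ :=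
  (hasFDerivAt_massFlux hb).isLittleO.def hε

lemma eventually_bernoulliBase_pos {γ b : ℝ} {q : Space}
    (hb : 0 < bernoulliBase γ b (‖q‖ ^ 2)) : ∀ᶠ p in 𝓝 q, 0 < bernoulliBase γ b (‖p‖ ^ 2) := by
  have : Continuous fun p : Space => bernoulliBase γ b (‖p‖ ^ 2) := by
    unfold bernoulliBase; fun_prop
  exact this.continuousAt.eventually_const_lt hb

/-- The gradient of the second order remainder is the first order remainder of the mass flux, which
is at most `ε * ‖p - q‖` on the ball through `p`; the mean value inequality does the rest. -/
lemma fluxPotential_expansion {γ b : ℝ} (hγ : 1 ≤ γ) {q : Space}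
    (hb : 0 < bernoulliBase γ b (‖q‖ ^ 2)) {ε : ℝ} (hε : 0 < ε) : ∀ᶠ p in 𝓝 q,
      |fluxPotential γ b p - fluxPotential γ b q - inner ℝ (massFlux γ b q) (p - q) -
        inner ℝ (fluxDeriv γ b q (p - q)) (p - q) / 2| ≤ ε * ‖p - q‖ ^ 2 := by
  obtain ⟨r, hr, hball⟩ := Metric.eventually_nhds_iff_ball.1
    ((massFlux_expansion hb hε).and (eventually_bernoulliBase_pos hb))
  filter_upwards [Metric.ball_mem_nhds q hr] with p hp
  set B := fluxDeriv γ b q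
  set K : Space → ℝ := fun p => fluxPotential γ b p - inner ℝ (massFlux γ b q) (p - q) -
        inner ℝ (B (p - q)) (p - q) / 2 with hK
  have hpr : ‖p - q‖ < r := by rwa [← dist_eq_norm]
  have hsub : ∀ x ∈ Metric.closedBall q ‖p - q‖, x ∈ Metric.ball q r := fun x hx =>
    Metric.closedBall_subset_ball hpr hx
  have hd : ∀ x ∈ Metric.closedBall q ‖p - q‖, HasFDerivWithinAt K
      (innerSL ℝ (massFlux γ b x - massFlux γ b q - B (x - q)))
      (Metric.closedBall q ‖p - q‖) x := by
    intro x hx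
    have h1 := hasFDerivAt_fluxPotential hγ (hball x (hsub x hx)).2
    have h0 : HasFDerivAt (fun p : Space => p - q) (ContinuousLinearMap.id ℝ Space) x :=
      (hasFDerivAt_id x).sub_const q
    have h2 := (innerSL ℝ (massFlux γ b q)).hasFDerivAt.comp x h0
    have h3 := ((B.hasFDerivAt.comp x h0).inner ℝ h0).const_mul (1 / 2 : ℝ)
    have h4 := ((h1.sub h2).sub h3).hasFDerivWithinAt (s := Metric.closedBall q ‖p - q‖)
    convert! h4 using 1
    · ext p
      simp only [hK, Pi.sub_apply, Function.comp_apply, innerSL_apply_apply]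
      ring
    · ext k
      have hs : inner ℝ (B k) (x - q) = inner ℝ (B (x - q)) k := fluxDeriv_symm γ b q k (x - q)
      simp only [innerSL_apply_apply, sub_apply, smul_apply, ContinuousLinearMap.comp_apply,
        fderivInnerCLM_apply, ContinuousLinearMap.prod_apply, ContinuousLinearMap.id_apply,
        Function.comp_apply, smul_eq_mul, hs]
      rw [inner_sub_left, inner_sub_left]
      ring
  have hbd : ∀ x ∈ Metric.closedBall q ‖p - q‖,
      ‖innerSL ℝ (massFlux γ b x - massFlux γ b q - B (x - q))‖ ≤ ε * ‖p - q‖ := by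
    intro x hx
    rw [innerSL_apply_norm]
    refine (hball x (hsub x hx)).1.trans (mul_le_mul_of_nonneg_left ?_ hε.le)
    simpa [dist_eq_norm] using hx
  have := (convex_closedBall q ‖p - q‖).norm_image_sub_le_of_norm_hasFDerivWithin_le hd hbd
    (Metric.mem_closedBall_self (norm_nonneg _)) (by simp [dist_eq_norm] : p ∈ _)
  rw [Real.norm_eq_abs] at this
  refine le_trans (le_of_eq ?_) (this.trans (le_of_eq (by ring)))
  congr 1
  simp [hK]
  ring

/-- The quadratic approximation of `relCurrent` at `q`. -/
def relCurrentQuad (γ b : ℝ) (q d : Space) : Space :=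
  d 0 • fluxDeriv γ b q d - (inner ℝ (fluxDeriv γ b q d) d / 2) • axis

lemma relCurrent_expansion {γ b : ℝ} (hγ : 1 ≤ γ) {q : Space}
    (hb : 0 < bernoulliBase γ b (‖q‖ ^ 2)) {ε : ℝ} (hε : 0 < ε) : ∀ᶠ p in 𝓝 q,
      ‖relCurrent γ b q p - relCurrentQuad γ b q (p - q)‖ ≤ ε * ‖p - q‖ ^ 2 := by
  filter_upwards [massFlux_expansion hb (half_pos hε), fluxPotential_expansion hγ hb (half_pos hε)]
    with p h1 h2
  have e : relCurrent γ b q p - relCurrentQuad γ b q (p - q) =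
      (p - q) 0 • (massFlux γ b p - massFlux γ b q - fluxDeriv γ b q (p - q)) -
      (fluxPotential γ b p - fluxPotential γ b q - inner ℝ (massFlux γ b q) (p - q) -
        inner ℝ (fluxDeriv γ b q (p - q)) (p - q) / 2) • axis := by
    simp only [relCurrent, relCurrentQuad, smul_sub, sub_smul, PiLp.sub_apply]
    abel
  rw [e]
  refine (norm_sub_le _ _).trans ?_
  rw [norm_smul, norm_smul, norm_axis, mul_one, Real.norm_eq_abs, Real.norm_eq_abs]
  have h3 := abs_zero_le_norm (p - q)
  have h4 : |(p - q) 0| * ‖massFlux γ b p - massFlux γ b q - fluxDeriv γ b q (p - q)‖ ≤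
      ‖p - q‖ * (ε / 2 * ‖p - q‖) := mul_le_mul h3 h1 (norm_nonneg _) (norm_nonneg _)
  nlinarith

/-- With M the Mach number of the axial state, the bracket is positive definite in `d` exactly when
`m 0 > 0` and |cross m|² < (M² - 1) (m 0)²: this is the cone of the hyperbolic operator. -/
lemma inner_relCurrentQuad {γ b u : ℝ} (d m : Space) :
    inner ℝ (relCurrentQuad γ b (u • axis) d) m =
      -(density γ b (u ^ 2) / 2) * ((u ^ 2 / bernoulliBase γ b (u ^ 2) - 1) * m 0 * d 0 ^ 2 -
        2 * d 0 * inner ℝ (cross d) (cross m) + m 0 * ‖cross d‖ ^ 2) := by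
  have hq : ‖u • axis‖ ^ 2 = u ^ 2 := by rw [norm_smul, norm_axis, mul_one, Real.norm_eq_abs, sq_abs]
  simp only [relCurrentQuad, fluxDeriv_apply, hq, inner_sub_left, inner_smul_left, axis_inner,
    real_inner_self_eq_norm_sq, norm_sq_eq_coord d, inner_eq_coord d m]
  simp
  ring

/-- Subtract `e` from both diagonal coefficients; by `h` the reduced form still has nonnegative
determinant in the worst case |s| = tτ. Multiply by its leading coefficient and complete the square.
-/
lemma cone_quadratic_bound {k m₀ e δ₀ t τ s : ℝ} (he2 : e < k * m₀)
    (h : τ ^ 2 ≤ (k * m₀ - e) * (m₀ - e)) (hs : |s| ≤ t * τ) :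
    e * (δ₀ ^ 2 + t ^ 2) ≤ k * m₀ * δ₀ ^ 2 - 2 * δ₀ * s + m₀ * t ^ 2 := by
  set A := k * m₀ - e
  set B := m₀ - e
  have hA : 0 < A := by simp only [A]; linarith
  have h1 : 0 ≤ A * (A * δ₀ ^ 2 - 2 * δ₀ * s + B * t ^ 2) := by
    have hs2 : s ^ 2 ≤ t ^ 2 * τ ^ 2 := by
      rw [← sq_abs s, ← mul_pow]; exact pow_le_pow_left₀ (abs_nonneg _) hs 2
    have h3 : t ^ 2 * τ ^ 2 ≤ t ^ 2 * (A * B) := mul_le_mul_of_nonneg_left h (sq_nonneg t)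
    nlinarith [sq_nonneg (A * δ₀ - s)]
  have h2 := nonneg_of_mul_nonneg_right h1 hA
  simp only [A, B] at h2
  linarith

/-- Definiteness is an open condition on the direction, and the remainder of the current is o(|p -
q|²). The bound thus holds for nearby `p` and nearby directions simultaneously, which is needed
because the shock normal moves with the state. -/
lemma relCurrent_cone {γ b u : ℝ} (hγ : 1 ≤ γ) (hb : 0 < bernoulliBase γ b (u ^ 2)) {m₀ : Space}
    (hm : 0 < m₀ 0)
    (hcone : ‖cross m₀‖ ^ 2 < (u ^ 2 / bernoulliBase γ b (u ^ 2) - 1) * m₀ 0 ^ 2) :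
    ∃ κ > 0, ∀ᶠ z : Space × Space in 𝓝 (u • axis, m₀),
      inner ℝ (relCurrent γ b (u • axis) z.1) z.2 ≤ -κ * ‖z.1 - u • axis‖ ^ 2 := by
  set k := u ^ 2 / bernoulliBase γ b (u ^ 2) - 1
  have hq : ‖u • axis‖ ^ 2 = u ^ 2 := by rw [norm_smul, norm_axis, mul_one, Real.norm_eq_abs, sq_abs]
  have hb' : 0 < bernoulliBase γ b (‖u • axis‖ ^ 2) := by rwa [hq]
  have hρ := density_pos_of_base hb
  have hk : 0 < k := by
    by_contra! h'
    nlinarith [sq_nonneg ‖cross m₀‖, sq_nonneg (m₀ 0)]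
  obtain ⟨e, he0, he1, he2, he3⟩ : ∃ e : ℝ, 0 < e ∧ e < m₀ 0 ∧ e < k * m₀ 0 ∧
      ‖cross m₀‖ ^ 2 < (k * m₀ 0 - e) * (m₀ 0 - e) := by
    have c1 : ContinuousAt (fun e : ℝ => (k * m₀ 0 - e) * (m₀ 0 - e)) 0 := by fun_prop
    have c2 := c1.eventually_const_lt (u := ‖cross m₀‖ ^ 2) (by linarith)
    have c3 := (c2.filter_mono (nhdsWithin_le_nhds (s := Ioi 0)))
    have c4 := Ioo_mem_nhdsGT (show (0 : ℝ) < min (m₀ 0) (k * m₀ 0) by positivity)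
    obtain ⟨e, h1, h2⟩ := (c3.and c4).exists
    exact ⟨e, h2.1, h2.2.trans_le (min_le_left _ _), h2.2.trans_le (min_le_right _ _), h1⟩
  have hm0 : Continuous fun m : Space => m 0 := continuous_coord 0
  have hev : ∀ᶠ m in 𝓝 m₀, e < m 0 ∧ e < k * m 0 ∧
      ‖cross m‖ ^ 2 < (k * m 0 - e) * (m 0 - e) ∧ ‖m‖ < ‖m₀‖ + 1 := by
    refine (hm0.continuousAt.eventually_const_lt he1).and
      (((continuous_const.mul hm0).continuousAt.eventually_const_lt he2).and
        (Eventually.and ?_ (continuous_norm.continuousAt.eventually_lt_const (lt_add_one _))))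
    exact ContinuousAt.eventually_lt (continuous_cross.norm.pow 2).continuousAt
      (((continuous_const.mul hm0).sub continuous_const).mul
        (hm0.sub continuous_const)).continuousAt he3
  set ρ := density γ b (u ^ 2)
  -- Of the coefficient `ρ * e / 2` gained from the quadratic part, the remainder paired with a
  -- direction of norm below `‖m₀‖ + 1` may cost half.
  have hε : 0 < ρ * e / (4 * (‖m₀‖ + 1)) := by positivity
  refine ⟨ρ * e / 4, by positivity, ?_⟩
  filter_upwards [(relCurrent_expansion hγ hb' hε).prod_nhds hev] with z hz
  obtain ⟨p, m⟩ := z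
  obtain ⟨h1, h2, h3, h4, h5⟩ := hz
  simp only at h1 h2 h3 h4 h5 ⊢
  set d := p - u • axis
  have hquad := cone_quadratic_bound (δ₀ := d 0) (t := ‖cross d‖) (τ := ‖cross m‖)
    (s := inner ℝ (cross d) (cross m)) h3 h4.le (abs_real_inner_le_norm _ _)
  have e1 : inner ℝ (relCurrent γ b (u • axis) p) m =
      inner ℝ (relCurrentQuad γ b (u • axis) d) m +
      inner ℝ (relCurrent γ b (u • axis) p - relCurrentQuad γ b (u • axis) d) m := by
    rw [← inner_add_left]; congr 1; abel
  have e2 : inner ℝ (relCurrent γ b (u • axis) p - relCurrentQuad γ b (u • axis) d) m ≤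
      ρ * e / 4 * ‖d‖ ^ 2 := by
    refine (real_inner_le_norm _ _).trans ?_
    calc _ ≤ (ρ * e / (4 * (‖m₀‖ + 1)) * ‖d‖ ^ 2) * (‖m₀‖ + 1) :=
          mul_le_mul h1 h5.le (norm_nonneg _) (by positivity)
      _ = _ := by field_simp
  rw [e1, inner_relCurrentQuad]
  rw [norm_sq_eq_coord d] at e2 ⊢
  have : ρ / 2 * (e * (d 0 ^ 2 + ‖cross d‖ ^ 2)) ≤ ρ / 2 *
      (k * m 0 * d 0 ^ 2 - 2 * d 0 * inner ℝ (cross d) (cross m) + m 0 * ‖cross d‖ ^ 2) :=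
    mul_le_mul_of_nonneg_left hquad (by positivity)
  simp only [ρ, k] at this e2 ⊢
  linarith

lemma continuousAt_inner_massFlux_sub {γ b : ℝ} {p r : Space}
    (hp : 0 < bernoulliBase γ b (‖p‖ ^ 2)) (hr : 0 < bernoulliBase γ b (‖r‖ ^ 2)) :
    ContinuousAt (fun z : Space × Space =>
      inner ℝ (massFlux γ b z.1 - massFlux γ b z.2) (z.1 - z.2)) (p, r) := by
  have cp : Tendsto (fun z : Space × Space => massFlux γ b z.1) (𝓝 (p, r)) (𝓝 (massFlux γ b p)) :=
    (hasFDerivAt_massFlux hp).continuousAt.tendsto.comp (continuous_fst.tendsto (p, r))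
  have cr : Tendsto (fun z : Space × Space => massFlux γ b z.2) (𝓝 (p, r)) (𝓝 (massFlux γ b r)) :=
    (hasFDerivAt_massFlux hr).continuousAt.tendsto.comp (continuous_snd.tendsto (p, r))
  exact (cp.sub cr).inner ((continuous_fst.sub continuous_snd).tendsto (p, r))

/-- Near a supersonic axial state, the relative current flows backwards through planes normal to the
axis and through admissible shock fronts. -/
theorem exists_relCurrent_sign {γ b u : ℝ} (hγ : 1 ≤ γ) (hc : 0 < criticalSpeed γ b)
    (hu : criticalSpeed γ b < u) (hb : 0 < bernoulliBase γ b (u ^ 2)) :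
    ∃ δ > 0, ∃ κ > 0, ∀ p : Space, ‖p - u • axis‖ ≤ δ →
      0 < bernoulliBase γ b (‖p‖ ^ 2) ∧ criticalSpeed γ b < p 0 ∧
      relCurrent γ b (u • axis) p 0 ≤ -κ * ‖p - u • axis‖ ^ 2 ∧
      ∀ r : Space, ‖r‖ ≤ criticalSpeed γ b →
        inner ℝ (massFlux γ b p - massFlux γ b r) (p - r) = 0 →
        inner ℝ (relCurrent γ b (u • axis) p) (p - r) ≤ 0 := by
  set q : Space := u • axis with hqdef
  have hu0 : 0 < u := hc.trans hu
  have hqn : ‖q‖ = u := by rw [hqdef, norm_smul, norm_axis, mul_one, Real.norm_of_nonneg hu0.le]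
  have hq0 : q 0 = u := by simp [hqdef]
  have hb' : 0 < bernoulliBase γ b (‖q‖ ^ 2) := by rwa [hqn]
  have hk : 0 < u ^ 2 / bernoulliBase γ b (u ^ 2) - 1 := by
    rw [sub_pos, one_lt_div hb]; exact bernoulliBase_lt_sq hγ hc hu
  obtain ⟨κ, hκ, hax⟩ := relCurrent_cone hγ hb (m₀ := axis) (by simp) (by simpa using hk)
  have hax' : ∀ᶠ p in 𝓝 q, relCurrent γ b q p 0 ≤ -κ * ‖p - q‖ ^ 2 := by
    have : Tendsto (fun p : Space => (p, axis)) (𝓝 q) (𝓝 (q, axis)) :=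
      (Continuous.prodMk_left axis).tendsto q
    filter_upwards [this.eventually hax] with p hp
    simpa using hp
  have hK := isCompact_closedBall (0 : Space) (criticalSpeed γ b)
  -- Compactness in `r`. Either `r` violates the shock relation with `q`, and then so do nearby
  -- pairs; or `q - r` lies in the open cone by `shock_normal_supersonic`, and `relCurrent_cone`
  -- applies.
  have hshock : ∀ᶠ p in 𝓝 q, ∀ r ∈ Metric.closedBall (0 : Space) (criticalSpeed γ b),
      inner ℝ (massFlux γ b p - massFlux γ b r) (p - r) = 0 →
        inner ℝ (relCurrent γ b q p) (p - r) ≤ 0 := by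
    refine hK.eventually_forall_of_forall_eventually fun r hr => ?_
    have hr' : ‖r‖ ≤ criticalSpeed γ b := by simpa using hr
    have hr0 : r 0 < u := ((le_abs_self _).trans ((abs_zero_le_norm r).trans hr')).trans_lt hu
    by_cases hE : inner ℝ (massFlux γ b q - massFlux γ b r) (q - r) = 0
    · have hqd : inner ℝ q (q - r) = u * (u - r 0) := by
        rw [hqdef, inner_smul_left, axis_inner]; simp
      have hn := shock_normal_supersonic hγ hc (hqn ▸ hu) hb' hr'
        (by rw [hqd]; exact mul_pos hu0 (sub_pos.2 hr0)) hE
      rw [hqd, hqn, norm_sq_eq_coord, PiLp.sub_apply, hq0] at hn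
      obtain ⟨κ', hκ', hev⟩ := relCurrent_cone hγ hb (m₀ := q - r)
        (by rw [PiLp.sub_apply, hq0]; linarith)
        (by
          rw [PiLp.sub_apply, hq0]
          have : ‖cross (q - r)‖ ^ 2 < (u ^ 2 * (u - r 0) ^ 2 -
              bernoulliBase γ b (u ^ 2) * (u - r 0) ^ 2) / bernoulliBase γ b (u ^ 2) := by
            rw [lt_div_iff₀ hb]; linarith
          refine this.trans_le (le_of_eq ?_)
          field_simp)
      have ht : Tendsto (fun z : Space × Space => (z.1, z.1 - z.2)) (𝓝 (q, r)) (𝓝 (q, q - r)) :=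
        (continuous_fst.prodMk (continuous_fst.sub continuous_snd)).tendsto (q, r)
      filter_upwards [ht.eventually hev] with z hz _
      exact hz.trans (by nlinarith [sq_nonneg ‖z.1 - u • axis‖])
    · have cE := continuousAt_inner_massFlux_sub hb'
        (bernoulliBase_pos_of_le hγ hc (norm_nonneg _) hr')
      filter_upwards [cE.eventually_ne hE] with z hz h0
      exact absurd h0 hz
  have hp0 : ∀ᶠ p in 𝓝 q, criticalSpeed γ b < p 0 :=
    (continuous_coord 0).continuousAt.eventually_const_lt (by simpa only [hq0] using hu)
  obtain ⟨δ, hδ, hball⟩ := Metric.eventually_nhds_iff_ball.1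
    ((eventually_bernoulliBase_pos hb').and (hp0.and (hax'.and hshock)))
  refine ⟨δ / 2, by positivity, κ, hκ, fun p hp => ?_⟩
  have hpb : p ∈ Metric.ball q δ := by
    rw [Metric.mem_ball, dist_eq_norm]; linarith
  obtain ⟨h1, h2, h3, h4⟩ := hball p hpb
  exact ⟨h1, h2, h3, fun r hr => h4 r (by simpa using hr)⟩

/-! ### One-sided limits -/

lemma exists_tendsto_of_lipschitzOnWith {S : Set Space} {F : Space → Space} {K : NNReal}
    (h : LipschitzOnWith K F S) (x : Space) : ∃ l, Tendsto F (𝓝[S] x) (𝓝 l) := by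
  obtain ⟨g, hg, he⟩ := h.extend_finite_dimension
  exact ⟨g x, ((hg.continuous.tendsto x).mono_left nhdsWithin_le_nhds).congr'
    (eventuallyEq_nhdsWithin_of_eqOn he.symm)⟩

/-- The part of the ball on the positive (`σ > 0`) or negative (`σ < 0`) side of the
cross-section through its centre. -/
def halfBall (w : Space) (r σ : ℝ) : Set Space := Metric.ball w r ∩ {z | 0 < σ * (z 0 - w 0)}

lemma convex_halfBall (w : Space) (r σ : ℝ) : Convex ℝ (halfBall w r σ) := by
  refine (convex_ball w r).inter ?_
  intro x hx y hy a b ha hb hab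
  simp only [mem_ofPred_eq, PiLp.add_apply, PiLp.smul_apply, smul_eq_mul] at hx hy ⊢
  have e : σ * (a * x 0 + b * y 0 - w 0) = a * (σ * (x 0 - w 0)) + b * (σ * (y 0 - w 0)) := by
    have : b = 1 - a := by linarith
    subst this; ring
  rw [e]
  rcases ha.eq_or_lt with h | h
  · have : b = 1 := by linarith
    subst this; subst h; simpa using hy
  · have := mul_pos h hx
    have := mul_nonneg hb hy.le
    linarith

lemma isOpen_halfBall (w : Space) (r σ : ℝ) : IsOpen (halfBall w r σ) :=
  Metric.isOpen_ball.inter (isOpen_lt continuous_const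
    (continuous_const.mul ((continuous_coord 0).sub continuous_const)))

lemma mem_closure_halfBall {w z : Space} {r σ : ℝ} (hσ : σ ≠ 0) (hz : z ∈ Metric.ball w r)
    (h0 : z 0 = w 0) : z ∈ closure (halfBall w r σ) := by
  have ht : Tendsto (fun t : ℝ => z + (t * σ) • axis) (𝓝[>] 0) (𝓝 z) := by
    have : Continuous fun t : ℝ => z + (t * σ) • axis := by fun_prop
    simpa using (this.tendsto 0).mono_left nhdsWithin_le_nhds
  refine mem_closure_of_tendsto ht ?_
  filter_upwards [ht.eventually (Metric.isOpen_ball.mem_nhds hz), self_mem_nhdsWithin] with t h1 h2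
  refine ⟨h1, ?_⟩
  have : 0 < t * (σ * σ) := mul_pos h2 (mul_self_pos.2 hσ)
  simp only [mem_ofPred_eq, PiLp.add_apply, PiLp.smul_apply, axis_zero, h0, smul_eq_mul]
  linarith

/-- A function that is `C¹` up to a cross-section from one side has the corresponding tangential
derivatives in the cross-section. -/
lemma hasDerivAt_tangential_of_halfBall {G : Space → ℝ} {w : Space} {r σ : ℝ} (hr : 0 < r)
    (hσ : σ ≠ 0) {A : Space →L[ℝ] ℝ} (hc : ∀ z ∈ Metric.closedBall w r, ContinuousAt G z)
    (hd : DifferentiableOn ℝ G (halfBall w r σ))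
    (ht : Tendsto (fderiv ℝ G) (𝓝[halfBall w r σ] w) (𝓝 A)) (k : Plane) :
    HasDerivAt (fun s : ℝ => G (w + s • embed k)) (A (embed k)) 0 := by
  have hcl : closure (halfBall w r σ) ⊆ Metric.closedBall w r :=
    (closure_mono inter_subset_left).trans Metric.closure_ball_subset_closedBall
  have h1 := hasFDerivWithinAt_closure_of_tendsto_fderiv hd (convex_halfBall w r σ)
    (isOpen_halfBall w r σ) (fun y hy => (hc y (hcl hy)).continuousWithinAt) ht
  have hcurve : HasDerivAt (fun s : ℝ => w + s • embed k) (embed k) 0 := by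
    simpa using ((hasDerivAt_id (0 : ℝ)).smul_const (embed k)).const_add w
  have hmem : ∀ᶠ s : ℝ in 𝓝 0, w + s • embed k ∈ closure (halfBall w r σ) := by
    have : Tendsto (fun s : ℝ => w + s • embed k) (𝓝 0) (𝓝 w) := by
      simpa using hcurve.continuousAt.tendsto
    filter_upwards [this.eventually (Metric.ball_mem_nhds w hr)] with s hs
    exact mem_closure_halfBall hσ hs (by simp)
  have h2 : HasFDerivWithinAt G A (closure (halfBall w r σ)) (w + (0 : ℝ) • embed k) := by
    simpa using h1
  have h3 := h2.comp_hasDerivWithinAt (f := fun s : ℝ => w + s • embed k)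
    (s := {s : ℝ | w + s • embed k ∈ closure (halfBall w r σ)})
    0 hcurve.hasDerivWithinAt (fun s hs => hs)
  exact h3.hasDerivAt hmem

/-! ### Solutions -/

/-- A transonic shock solution in a duct, with the standing assumptions on the data. -/
structure IsFlow (γ b u c₁ : ℝ) (Ω : Set Plane) (f : Plane → ℝ) (φ : Space → ℝ) : Prop where
  one_le : 1 ≤ γ
  critical_pos : 0 < criticalSpeed γ b
  critical_lt : criticalSpeed γ b < u
  base_pos : 0 < bernoulliBase γ b (u ^ 2)
  crossSection : IsCrossSection Ω
  exit_lt : c₁ < criticalSpeed γ b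
  sol : IsTransonicShockSolution γ b u c₁ Ω f φ

namespace IsFlow

variable {γ b u c₁ : ℝ} {Ω : Set Plane} {f : Plane → ℝ} {φ : Space → ℝ}
  (h : IsFlow γ b u c₁ Ω f φ)
include h

lemma entry_pos : 0 < u := h.critical_pos.trans h.critical_lt

lemma contDiffOn_front : ContDiffOn ℝ 1 f Ω := h.sol.front_contDiff.mono subset_closure

lemma continuousAt_front {y : Plane} (hy : y ∈ Ω) : ContinuousAt f y :=
  h.contDiffOn_front.continuousOn.continuousAt (h.crossSection.isOpen.mem_nhds hy)

lemma isOpen_upstream : IsOpen (upstream Ω f) := by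
  have e : upstream Ω f = graphRegion Ω (fun _ => -1) f ∩ {x | x 0 < 1} := by
    ext x
    simp only [upstream, duct, graphRegion, mem_ofPred_eq, mem_Ioo, mem_inter_iff]
    tauto
  rw [e]
  exact (isOpen_graphRegion h.crossSection.isOpen continuousOn_const
    h.contDiffOn_front.continuousOn).inter (isOpen_lt (continuous_coord 0) continuous_const)

lemma isOpen_downstream : IsOpen (downstream Ω f) := by
  have e : downstream Ω f = graphRegion Ω f (fun _ => 1) ∩ {x | -1 < x 0} := by
    ext x
    simp only [downstream, duct, graphRegion, mem_ofPred_eq, mem_Ioo, mem_inter_iff]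
    tauto
  rw [e]
  exact (isOpen_graphRegion h.crossSection.isOpen h.contDiffOn_front.continuousOn
    continuousOn_const).inter (isOpen_lt continuous_const (continuous_coord 0))

lemma isOpen_smoothRegion : IsOpen (smoothRegion Ω f) := h.isOpen_upstream.union h.isOpen_downstream

lemma contDiffAt {x : Space} (hx : x ∈ smoothRegion Ω f) : ContDiffAt ℝ 2 φ x :=
  h.sol.contDiff.contDiffAt (h.isOpen_smoothRegion.mem_nhds hx)

lemma contDiffAt_gradient {x : Space} (hx : x ∈ smoothRegion Ω f) :
    ContDiffAt ℝ 1 (gradient φ) x := by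
  have h1 : ContDiffAt ℝ 1 (fderiv ℝ φ) x := (h.contDiffAt hx).fderiv_right (by norm_num)
  exact (InnerProductSpace.toDual ℝ Space).symm.toContinuousLinearEquiv.contDiff.contDiffAt.comp
    x h1

lemma differentiableAt_gradient {x : Space} (hx : x ∈ smoothRegion Ω f) :
    DifferentiableAt ℝ (gradient φ) x :=
  (h.contDiffAt_gradient hx).differentiableAt one_ne_zero

lemma differentiableAt {x : Space} (hx : x ∈ smoothRegion Ω f) : DifferentiableAt ℝ φ x :=
  (h.contDiffAt hx).differentiableAt two_ne_zero

lemma hasFDerivAt {x : Space} (hx : x ∈ smoothRegion Ω f) :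
    HasFDerivAt φ (innerSL ℝ (gradient φ x)) x := by
  convert! (h.differentiableAt hx).hasFDerivAt using 1
  ext k
  rw [innerSL_apply_apply, inner_gradient_left]

lemma fderiv_gradient_symm {x : Space} (hx : x ∈ smoothRegion Ω f) (k l : Space) :
    inner ℝ (fderiv ℝ (gradient φ) x k) l = inner ℝ (fderiv ℝ (gradient φ) x l) k := by
  have key : ∀ k l : Space, inner ℝ (fderiv ℝ (gradient φ) x k) l =
      fderiv ℝ (fderiv ℝ φ) x k l := by
    intro k l
    have e : (fun z => fderiv ℝ φ z l) = fun z => inner ℝ (gradient φ z) l := by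
      ext z; rw [inner_gradient_left]
    have hd : DifferentiableAt ℝ (fderiv ℝ φ) x :=
      ((h.contDiffAt hx).fderiv_right (m := 1) (by norm_num)).differentiableAt one_ne_zero
    have h1 := (hd.hasFDerivAt.clm_apply (hasFDerivAt_const l x)).fderiv
    have h2 := ((h.differentiableAt_gradient hx).hasFDerivAt.inner ℝ
      (hasFDerivAt_const l x)).fderiv
    rw [e, h2] at h1
    have h3 := congrArg (fun A => A k) h1
    simpa using h3
  rw [key, key]
  exact ((h.contDiffAt hx).isSymmSndFDerivAt (by simp)).eq k l

lemma norm_gradient_sub_le {M : ℝ} (hM : ∀ x ∈ smoothRegion Ω f, ‖fderiv ℝ (gradient φ) x‖ ≤ M)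
    {S : Set Space} (hS : Convex ℝ S) (hsub : S ⊆ smoothRegion Ω f) {x z : Space} (hx : x ∈ S)
    (hz : z ∈ S) : ‖gradient φ x - gradient φ z‖ ≤ M * ‖x - z‖ :=
  hS.norm_image_sub_le_of_norm_fderiv_le (fun _ hy => h.differentiableAt_gradient (hsub hy))
    (fun y hy => hM y (hsub hy)) hz hx

lemma exists_hessian_bound :
    ∃ M, 0 < M ∧ ∀ x ∈ smoothRegion Ω f, ‖fderiv ℝ (gradient φ) x‖ ≤ M := by
  obtain ⟨M, hM⟩ := h.sol.bounded_hessian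
  exact ⟨max M 1, by positivity, fun x hx => (hM x hx).trans (le_max_left _ _)⟩

/-- The bounded second derivatives make the gradient Lipschitz on convex sets, so it has limits at
their boundary points. This supplies the full velocity at the entry and the exit. -/
lemma exists_tendsto_gradient {S : Set Space} (hS : Convex ℝ S) (hsub : S ⊆ smoothRegion Ω f)
    (x : Space) : ∃ l, Tendsto (gradient φ) (𝓝[S] x) (𝓝 l) := by
  obtain ⟨M, hM0, hM⟩ := h.exists_hessian_bound
  refine exists_tendsto_of_lipschitzOnWith (K := ⟨M, hM0.le⟩)
    (LipschitzOnWith.of_dist_le_mul fun _ hy _ hz => ?_) x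
  rw [dist_eq_norm, dist_eq_norm]
  exact h.norm_gradient_sub_le hM hS hsub hy hz

lemma norm_gradient_lt {x : Space} (hx : x ∈ downstream Ω f) :
    ‖gradient φ x‖ < criticalSpeed γ b :=
  lt_criticalSpeed_of_subsonic h.one_le h.critical_pos (norm_nonneg _)
    (h.sol.density_pos x (Or.inr hx)) (h.sol.subsonic x hx)

lemma lt_norm_gradient {x : Space} (hx : x ∈ upstream Ω f) :
    criticalSpeed γ b < ‖gradient φ x‖ :=
  criticalSpeed_lt_of_supersonic h.one_le h.critical_pos (norm_nonneg _)
    (h.sol.density_pos x (Or.inl hx)) (h.sol.supersonic x hx)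

omit h in
lemma tendsto_lift {S : Set Space} {l : Filter ℝ} {t : ℝ} {y : Plane} (hl : l ≤ 𝓝 t)
    (hS : ∀ᶠ s in l, lift s y ∈ S) : Tendsto (fun s => lift s y) l (𝓝[S] (lift t y)) :=
  tendsto_nhdsWithin_iff.2 ⟨((continuous_lift.comp (Continuous.prodMk_left y)).tendsto t).mono_left
    hl, hS⟩

/-- Otherwise the column would be subsonic right behind the entry, contradicting the prescribed
supersonic axial velocity. -/
lemma neg_one_lt_front {y : Plane} (hy : y ∈ Ω) : -1 < f y := by
  by_contra! hf
  have hS : ∀ᶠ t in 𝓝[>] (-1 : ℝ), lift t y ∈ downstream Ω f := by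
    filter_upwards [Ioo_mem_nhdsGT (show (-1 : ℝ) < 1 by norm_num)] with t ht
    exact ⟨⟨by simpa using ht, by simpa using hy⟩, by simpa using hf.trans_lt ht.1⟩
  have h1 := (h.sol.entry_velocity (lift (-1) y) ⟨by simp, by simpa using hy⟩).comp
    (tendsto_lift nhdsWithin_le_nhds (hS.mono fun t ht => Or.inr ht))
  have h2 : u ≤ criticalSpeed γ b := le_of_tendsto h1 (hS.mono fun t ht =>
    ((le_abs_self _).trans (abs_zero_le_norm _)).trans (h.norm_gradient_lt ht).le)
  exact absurd h.critical_lt (not_lt.2 h2)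

/-- Otherwise the column would be supersonic up to the exit, where the prescribed speed is subsonic.
-/
lemma front_lt_one {y : Plane} (hy : y ∈ Ω) : f y < 1 := by
  by_contra! hf
  have hS : ∀ᶠ t in 𝓝[<] (1 : ℝ), lift t y ∈ upstream Ω f := by
    filter_upwards [Ioo_mem_nhdsLT (show (-1 : ℝ) < 1 by norm_num)] with t ht
    exact ⟨⟨by simpa using ht, by simpa using hy⟩, by simpa using ht.2.trans_le hf⟩
  have h1 := (h.sol.exit_speed (lift 1 y) ⟨by simp, by simpa using hy⟩).comp
    (tendsto_lift nhdsWithin_le_nhds (hS.mono fun t ht => Or.inl ht))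
  have h2 : criticalSpeed γ b ≤ c₁ := ge_of_tendsto h1 (hS.mono fun t ht =>
    (h.lt_norm_gradient ht).le)
  exact absurd h.exit_lt (not_lt.2 h2)

lemma upstream_eq : upstream Ω f = graphRegion Ω (fun _ => -1) f := by
  ext x
  simp only [upstream, duct, graphRegion, mem_ofPred_eq, mem_Ioo]
  constructor
  · rintro ⟨⟨⟨h1, h2⟩, h3⟩, h4⟩; exact ⟨h3, h1, h4⟩
  · rintro ⟨h1, h2, h3⟩; exact ⟨⟨⟨h2, h3.trans (h.front_lt_one h1)⟩, h1⟩, h3⟩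

lemma downstream_eq : downstream Ω f = graphRegion Ω f (fun _ => 1) := by
  ext x
  simp only [downstream, duct, graphRegion, mem_ofPred_eq, mem_Ioo]
  constructor
  · rintro ⟨⟨⟨h1, h2⟩, h3⟩, h4⟩; exact ⟨h3, h4, h2⟩
  · rintro ⟨h1, h2, h3⟩; exact ⟨⟨⟨(h.neg_one_lt_front h1).trans h2, h3⟩, h1⟩, h2⟩

/-- The potential extends to a Lipschitz function on the whole space. -/
lemma exists_extension : ∃ Φ : Space → ℝ, (∃ K, LipschitzWith K Φ) ∧ EqOn φ Φ (duct Ω) := by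
  obtain ⟨K, hK⟩ := h.sol.lipschitz
  obtain ⟨Φ, h1, h2⟩ := hK.extend_real
  exact ⟨Φ, ⟨K, h1⟩, h2⟩

omit h in
lemma smoothRegion_subset_duct : smoothRegion Ω f ⊆ duct Ω :=
  union_subset (fun _ hx => hx.1) fun _ hx => hx.1

omit h in
lemma isOpen_duct (hΩ : IsOpen Ω) : IsOpen (duct Ω) :=
  (isOpen_Ioo.preimage (continuous_coord 0)).inter (hΩ.preimage continuous_cross)

lemma eventuallyEq_extension {Φ : Space → ℝ} (hΦ : EqOn φ Φ (duct Ω)) {x : Space}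
    (hx : x ∈ duct Ω) : φ =ᶠ[𝓝 x] Φ :=
  hΦ.eventuallyEq_of_mem ((isOpen_duct h.crossSection.isOpen).mem_nhds hx)

lemma hasFDerivAt_extension {Φ : Space → ℝ} (hΦ : EqOn φ Φ (duct Ω)) {x : Space}
    (hx : x ∈ smoothRegion Ω f) : HasFDerivAt Φ (innerSL ℝ (gradient φ x)) x :=
  (h.hasFDerivAt hx).congr_of_eventuallyEq
    (h.eventuallyEq_extension hΦ (smoothRegion_subset_duct hx)).symm

/-! #### The entry -/

lemma exists_halfBall_entry {y : Plane} (hy : y ∈ Ω) :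
    ∃ r > 0, halfBall (lift (-1) y) r 1 ⊆ upstream Ω f ∧
      ∀ z ∈ Metric.ball (lift (-1) y) r, cross z ∈ Ω := by
  have h1 : ∀ᶠ z in 𝓝 (lift (-1) y), cross z ∈ Ω :=
    continuous_cross.continuousAt.eventually (by simpa using h.crossSection.isOpen.mem_nhds hy)
  have h2 : ∀ᶠ z : Space in 𝓝 (lift (-1) y), z 0 < f (cross z) := by
    refine ContinuousAt.eventually_lt (continuous_coord 0).continuousAt ?_ ?_
    · exact ContinuousAt.comp (g := f) (by simpa using h.continuousAt_front hy)
        continuous_cross.continuousAt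
    · simpa using h.neg_one_lt_front hy
  obtain ⟨r, hr, hball⟩ := Metric.eventually_nhds_iff_ball.1 (h1.and h2)
  refine ⟨r, hr, ?_, fun z hz => (hball z hz).1⟩
  rintro z ⟨hz, hz0⟩
  rw [h.upstream_eq]
  simp at hz0
  exact ⟨(hball z hz).1, by linarith, (hball z hz).2⟩

omit h in
lemma smoothRegion_inter_ball_subset_entry {y : Plane} {r : ℝ} :
    halfBall (lift (-1) y) r 1 ∈ 𝓝[smoothRegion Ω f] (lift (-1) y) ∨ r ≤ 0 := by
  by_cases hr : r ≤ 0
  · exact Or.inr hr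
  refine Or.inl ?_
  filter_upwards [mem_nhdsWithin_of_mem_nhds (Metric.ball_mem_nhds _ (not_le.1 hr)),
    self_mem_nhdsWithin] with z hz hzs
  refine ⟨hz, ?_⟩
  have := (smoothRegion_subset_duct hzs).1.1
  simp; linarith

/-- The velocity on the entry is axial. -/
lemma tendsto_gradient_entry {y : Plane} (hy : y ∈ Ω) :
    Tendsto (gradient φ) (𝓝[smoothRegion Ω f] (lift (-1) y)) (𝓝 (u • axis)) := by
  obtain ⟨r, hr, hsub, hΩr⟩ := h.exists_halfBall_entry hy
  have hsub' : halfBall (lift (-1) y) r 1 ⊆ smoothRegion Ω f := hsub.trans subset_union_left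
  obtain ⟨P, hP⟩ := h.exists_tendsto_gradient (convex_halfBall _ r 1) hsub' (lift (-1) y)
  have hnhds := (smoothRegion_inter_ball_subset_entry (Ω := Ω) (f := f) (y := y)
    (r := r)).resolve_right (not_le.2 hr)
  have hle : 𝓝[smoothRegion Ω f] (lift (-1) y) ≤ 𝓝[halfBall (lift (-1) y) r 1] (lift (-1) y) :=
    nhdsWithin_le_iff.2 hnhds
  have hPs := hP.mono_left hle
  have hvert : ∀ z ∈ Ω, ∀ᶠ t in 𝓝[>] (-1 : ℝ), lift t z ∈ smoothRegion Ω f := by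
    intro z hz
    filter_upwards [Ioo_mem_nhdsGT (h.neg_one_lt_front hz)] with t ht
    refine Or.inl ?_
    rw [h.upstream_eq, lift_mem_graphRegion]
    exact ⟨hz, ht⟩
  have htl : ∀ z ∈ Ω, Tendsto (fun t => lift t z) (𝓝[>] (-1 : ℝ))
      (𝓝[smoothRegion Ω f] (lift (-1) z)) := fun z hz =>
    tendsto_lift nhdsWithin_le_nhds (hvert z hz)
  have hP0 : P 0 = u :=
    tendsto_nhds_unique (((continuous_coord 0).tendsto P).comp (hPs.comp (htl y hy)))
      ((h.sol.entry_velocity (lift (-1) y) ⟨by simp, by simpa using hy⟩).comp (htl y hy))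
  obtain ⟨Φ, ⟨K, hK⟩, hΦ⟩ := h.exists_extension
  have hbd : ∀ z ∈ Ω, Φ (lift (-1) z) = -u := by
    intro z hz
    have h1 := (h.sol.entry_potential (lift (-1) z) ⟨by simp, by simpa using hz⟩).comp (htl z hz)
    have h2 : Tendsto (fun t => Φ (lift t z)) (𝓝[>] (-1 : ℝ)) (𝓝 (Φ (lift (-1) z))) :=
      (hK.continuous.tendsto _).comp ((htl z hz).mono_right nhdsWithin_le_nhds)
    refine tendsto_nhds_unique h2 (h1.congr' ?_)
    filter_upwards [hvert z hz] with t ht using hΦ (smoothRegion_subset_duct ht)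
  -- The potential is constant on the entry, so its tangential derivatives vanish there, and they
  -- are the cross-sectional components of the limit `P`.
  have hcross : cross P = 0 := by
    refine ext_inner_right ℝ fun k => ?_
    have hd := hasDerivAt_tangential_of_halfBall (G := Φ) hr one_ne_zero
      (A := innerSL ℝ P) (fun z _ => hK.continuous.continuousAt)
      (fun z hz => (h.hasFDerivAt_extension hΦ (hsub' hz)).differentiableAt.differentiableWithinAt)
      (by
        refine (((innerSL ℝ (E := Space)).continuous.tendsto P).comp hP).congr' ?_
        filter_upwards [self_mem_nhdsWithin] with z hz
        exact (h.hasFDerivAt_extension hΦ (hsub' hz)).fderiv.symm) k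
    have hconst : (fun s : ℝ => Φ (lift (-1) y + s • embed k)) =ᶠ[𝓝 0] fun _ => -u := by
      have ht : Tendsto (fun s : ℝ => lift (-1) y + s • embed k) (𝓝 0) (𝓝 (lift (-1) y)) := by
        have : Continuous fun s : ℝ => lift (-1) y + s • embed k := by fun_prop
        simpa using this.tendsto 0
      filter_upwards [ht.eventually (Metric.ball_mem_nhds _ hr)] with s hs
      have h1 := hbd _ (hΩr _ hs)
      rw [← lift_cross (lift (-1) y + s • embed k)]
      simpa using h1
    have h0 := (hd.congr_of_eventuallyEq hconst.symm).unique (hasDerivAt_const (0 : ℝ) (-u))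
    rw [inner_zero_left, ← inner_embed]
    simpa using h0
  have : P = u • axis := space_ext (by simp [hP0]) (by simp [hcross, cross_smul])
  rw [← this]
  exact hPs

/-! #### The front -/

/-- The velocities on the two sides of the front differ by a multiple of its normal. -/
lemma jump_normal {y : Plane} (hy : y ∈ Ω) {wm wp : Space}
    (hm : Tendsto (gradient φ) (𝓝[upstream Ω f] (lift (f y) y)) (𝓝 wm))
    (hp : Tendsto (gradient φ) (𝓝[downstream Ω f] (lift (f y) y)) (𝓝 wp)) :
    wm - wp = (wm 0 - wp 0) • frontNormal f y := by
  obtain ⟨Φ, ⟨K, hK⟩, hΦ⟩ := h.exists_extension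
  -- The shear `T` carries the plane of zero axial coordinate to the front. The single continuous
  -- function `Φ ∘ T` then has tangential derivatives computable from either side, and they must
  -- agree.
  set T : Space → Space := fun w => w + f (cross w) • axis with hT
  set w₀ : Space := lift 0 y with hw₀
  have hcr : ∀ w, cross (T w) = cross w := fun w => by simp [hT, cross_add, cross_smul]
  have hT0 : ∀ w, T w 0 = w 0 + f (cross w) := fun w => by simp [hT]
  have hTw : T w₀ = lift (f y) y := space_ext (by simp [hT0, hw₀]) (by simp [hcr, hw₀])
  have hdf : ∀ z ∈ Ω, DifferentiableAt ℝ f z := fun z hz =>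
    (h.contDiffOn_front.contDiffAt (h.crossSection.isOpen.mem_nhds hz)).differentiableAt one_ne_zero
  have hTd : ∀ w, cross w ∈ Ω → HasFDerivAt T
      (ContinuousLinearMap.id ℝ Space + ((fderiv ℝ f (cross w)).comp crossL).smulRight axis) w := by
    intro w hw
    exact (hasFDerivAt_id w).add
      (((hdf _ hw).hasFDerivAt.comp w crossL.hasFDerivAt).smul_const axis)
  have hev : ∀ᶠ w in 𝓝 w₀, cross w ∈ Ω ∧ T w ∈ duct Ω := by
    have h1 : ∀ᶠ w in 𝓝 w₀, cross w ∈ Ω :=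
      continuous_cross.continuousAt.eventually
        (by simpa [hw₀] using h.crossSection.isOpen.mem_nhds hy)
    have h2 : ∀ᶠ w in 𝓝 w₀, T w ∈ duct Ω := by
      refine (hTd w₀ (by simpa [hw₀] using hy)).continuousAt.eventually
        ((isOpen_duct h.crossSection.isOpen).mem_nhds ?_)
      rw [hTw]
      exact ⟨by simpa using ⟨h.neg_one_lt_front hy, h.front_lt_one hy⟩, by simpa using hy⟩
    exact h1.and h2
  obtain ⟨r, hr, hball⟩ := Metric.nhds_basis_closedBall.eventually_iff.1 hev
  have hw₀r : w₀ ∈ Metric.closedBall w₀ r := Metric.mem_closedBall_self hr.le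
  have hside : ∀ (σ : ℝ) (R : Set Space) (wl : Space), σ ≠ 0 → R ⊆ smoothRegion Ω f →
      (∀ w ∈ halfBall w₀ r σ, T w ∈ R) →
      Tendsto (gradient φ) (𝓝[R] (lift (f y) y)) (𝓝 wl) → ∀ k : Plane,
      HasDerivAt (fun s : ℝ => Φ (T (w₀ + s • embed k)))
        (inner ℝ wl (embed k + fderiv ℝ f y k • axis)) 0 := by
    intro σ R wl hσ hR hmem hl k
    have hsubb : halfBall w₀ r σ ⊆ Metric.closedBall w₀ r :=
      inter_subset_left.trans Metric.ball_subset_closedBall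
    have hGd : ∀ w ∈ halfBall w₀ r σ, HasFDerivAt (fun w => Φ (T w))
        ((innerSL ℝ (gradient φ (T w))).comp (ContinuousLinearMap.id ℝ Space +
          ((fderiv ℝ f (cross w)).comp crossL).smulRight axis)) w := fun w hw =>
      (h.hasFDerivAt_extension hΦ (hR (hmem w hw))).comp w (hTd w (hball (hsubb hw)).1)
    have hTt : Tendsto T (𝓝[halfBall w₀ r σ] w₀) (𝓝[R] (lift (f y) y)) := by
      refine tendsto_nhdsWithin_iff.2 ⟨?_, ?_⟩
      · have := (hTd w₀ (hball hw₀r).1).continuousAt.tendsto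
        rw [hTw] at this
        exact this.mono_left nhdsWithin_le_nhds
      · filter_upwards [self_mem_nhdsWithin] with w hw using hmem w hw
    have hft : Tendsto (fun w => ContinuousLinearMap.id ℝ Space +
          ((fderiv ℝ f (cross w)).comp crossL).smulRight axis) (𝓝[halfBall w₀ r σ] w₀)
        (𝓝 (ContinuousLinearMap.id ℝ Space +
          ((fderiv ℝ f y).comp crossL).smulRight axis)) := by
      have h1 : ContinuousAt (fderiv ℝ f) y :=
        (h.contDiffOn_front.continuousOn_fderiv_of_isOpen h.crossSection.isOpen
          le_rfl).continuousAt (h.crossSection.isOpen.mem_nhds hy)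
      have h2 : Tendsto cross (𝓝[halfBall w₀ r σ] w₀) (𝓝 y) := by
        have := (continuous_cross.tendsto w₀).mono_left
          (nhdsWithin_le_nhds (s := halfBall w₀ r σ))
        simpa [hw₀] using this
      have h3 : Continuous fun A : Plane →L[ℝ] ℝ => ContinuousLinearMap.id ℝ Space +
          (A.comp crossL).smulRight axis := by
        refine continuous_clm_apply.2 fun k => ?_
        simp only [add_apply, ContinuousLinearMap.smulRight_apply, ContinuousLinearMap.comp_apply]
        fun_prop
      exact (h3.tendsto _).comp (h1.tendsto.comp h2)
    have := hasDerivAt_tangential_of_halfBall (G := fun w => Φ (T w)) hr hσ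
      (A := (innerSL ℝ wl).comp (ContinuousLinearMap.id ℝ Space +
          ((fderiv ℝ f y).comp crossL).smulRight axis))
      (fun z hz => hK.continuous.continuousAt.comp (hTd z (hball hz).1).continuousAt)
      (fun z hz => (hGd z hz).differentiableAt.differentiableWithinAt)
      (by
        have hc : Continuous fun z : (Space →L[ℝ] ℝ) × (Space →L[ℝ] Space) => z.1.comp z.2 :=
          isBoundedBilinearMap_comp.continuous
        have h1 := (((innerSL ℝ (E := Space)).continuous.tendsto wl).comp (hl.comp hTt))
        refine ((hc.tendsto _).comp (h1.prodMk_nhds hft)).congr' ?_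
        filter_upwards [self_mem_nhdsWithin] with w hw
        exact (hGd w hw).fderiv.symm) k
    simpa [inner_add_right, inner_smul_right] using this
  have hminus := hside (-1) (upstream Ω f) wm (by norm_num) subset_union_left
    (fun w hw => ⟨(hball (Metric.ball_subset_closedBall hw.1)).2, by
      have := hw.2
      simp [hw₀] at this
      rw [hT0, hcr]; linarith⟩) hm
  have hplus := hside 1 (downstream Ω f) wp (by norm_num) subset_union_right
    (fun w hw => ⟨(hball (Metric.ball_subset_closedBall hw.1)).2, by
      have := hw.2
      simp [hw₀] at this
      rw [hT0, hcr]; linarith⟩) hp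
  refine space_ext (by simp [frontNormal_zero]) (ext_inner_right ℝ fun k => ?_)
  have e := (hminus k).unique (hplus k)
  simp only [inner_add_right, inner_smul_right, inner_axis, inner_embed] at e
  rw [cross_sub, cross_smul, cross_frontNormal, inner_sub_left, inner_smul_left, inner_neg_left,
    inner_gradient_left]
  simp
  linarith

end IsFlow

/-! ### The squared positive part -/

/-- The square of the positive part. -/
def posSq (t : ℝ) : ℝ := max t 0 ^ 2

lemma hasDerivAt_posSq (t : ℝ) : HasDerivAt posSq (2 * max t 0) t := by
  unfold posSq
  rcases lt_trichotomy t 0 with ht | rfl | ht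
  · rw [max_eq_right ht.le, mul_zero]
    refine (hasDerivAt_const t (0 : ℝ)).congr_of_eventuallyEq ?_
    filter_upwards [gt_mem_nhds ht] with s hs
    simp [max_eq_right hs.le]
  · rw [max_self, mul_zero, hasDerivAt_iff_isLittleO]
    refine Asymptotics.IsBigO.trans_isLittleO (g := fun s : ℝ => s ^ 2) ?_ ?_
    · refine Asymptotics.IsBigO.of_bound 1 (Eventually.of_forall fun s => ?_)
      simp only [max_self, ne_eq, OfNat.ofNat_ne_zero, not_false_eq_true, zero_pow, sub_zero,
        smul_eq_mul, mul_zero, norm_pow, Real.norm_eq_abs, one_mul]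
      refine pow_le_pow_left₀ (abs_nonneg _) ?_ 2
      rw [abs_of_nonneg (le_max_right _ _)]
      exact max_le (le_abs_self _) (abs_nonneg _)
    · simpa using Asymptotics.isLittleO_pow_id (𝕜 := ℝ) (one_lt_two)
  · rw [max_eq_left ht.le]
    have := hasDerivAt_pow 2 t
    simp only [Nat.add_one_sub_one, pow_one, Nat.cast_ofNat] at this
    refine this.congr_of_eventuallyEq ?_
    filter_upwards [lt_mem_nhds ht] with s hs
    simp [max_eq_left hs.le]

lemma contDiff_posSq : ContDiff ℝ 1 posSq := by
  rw [contDiff_one_iff_deriv]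
  refine ⟨fun t => (hasDerivAt_posSq t).differentiableAt, ?_⟩
  have : deriv posSq = fun t => 2 * max t 0 := funext fun t => (hasDerivAt_posSq t).deriv
  rw [this]; fun_prop

/-! ### Functions of one variable with constant derivative -/

lemma sub_eq_of_hasDerivAt_Ioo {g : ℝ → ℝ} {a b c : ℝ}
    (hd : ∀ t ∈ Ioo a b, HasDerivAt g c t) {s t : ℝ} (hs : s ∈ Ioo a b) (ht : t ∈ Ioo a b) :
    g t - g s = c * (t - s) := by
  have h1 : ∀ t ∈ Ioo a b, HasDerivWithinAt (fun t => g t - c * t) 0 (Ioo a b) t := by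
    intro t ht
    have := ((hd t ht).sub ((hasDerivAt_id t).const_mul c)).hasDerivWithinAt (s := Ioo a b)
    rw [mul_one, sub_self] at this
    exact this
  have := (convex_Ioo a b).norm_image_sub_le_of_norm_hasDerivWithin_le h1
    (C := 0) (fun _ _ => by simp) hs ht
  simp only [zero_mul, norm_le_zero_iff] at this
  linarith

/-- Recovers the function from its limit at an end point; in each use `L` is a one-sided
neighbourhood filter. -/
lemma eq_of_hasDerivAt_of_tendsto {g : ℝ → ℝ} {a b c e l : ℝ} {L : Filter ℝ} [L.NeBot]
    (hd : ∀ t ∈ Ioo a b, HasDerivAt g c t) (hL : ∀ᶠ s in L, s ∈ Ioo a b) (hLe : L ≤ 𝓝 e)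
    (hg : Tendsto g L (𝓝 l)) {t : ℝ} (ht : t ∈ Ioo a b) : g t = l + c * (t - e) := by
  have h1 : Tendsto (fun s => g s + c * (t - s)) L (𝓝 (l + c * (t - e))) :=
    hg.add (((tendsto_const_nhds.sub (tendsto_id.mono_right hLe))).const_mul c)
  refine tendsto_nhds_unique (tendsto_const_nhds.congr' ?_) h1
  filter_upwards [hL] with s hs
  have := sub_eq_of_hasDerivAt_Ioo hd hs ht
  linarith

lemma norm_smul_and_fderiv_le {ξ : Space → ℝ} {G : Space → Space} {x : Space} {A B : ℝ}
    (hξ : DifferentiableAt ℝ ξ x) (hG : DifferentiableAt ℝ G x) (h1 : |ξ x| ≤ A)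
    (h2 : ‖fderiv ℝ ξ x‖ ≤ A) (h3 : ‖G x‖ ≤ B) (h4 : ‖fderiv ℝ G x‖ ≤ B) :
    ‖ξ x • G x‖ ≤ 2 * (A * B) ∧ ‖fderiv ℝ (fun z => ξ z • G z) x‖ ≤ 2 * (A * B) := by
  have hA : 0 ≤ A := (abs_nonneg _).trans h1
  have hB : 0 ≤ B := (norm_nonneg _).trans h3
  constructor
  · rw [norm_smul]
    have := mul_le_mul h1 h3 (norm_nonneg _) hA
    rw [Real.norm_eq_abs]
    linarith [mul_nonneg hA hB]
  · have : fderiv ℝ (fun z => ξ z • G z) x = ξ x • fderiv ℝ G x + (fderiv ℝ ξ x).smulRight (G x) :=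
      (hξ.hasFDerivAt.smul hG.hasFDerivAt).fderiv
    rw [this]
    refine (norm_add_le _ _).trans ?_
    rw [norm_smul, ContinuousLinearMap.norm_smulRight_apply, Real.norm_eq_abs]
    have e1 := mul_le_mul h1 h4 (norm_nonneg _) hA
    have e2 := mul_le_mul h2 h3 (norm_nonneg _) hA
    linarith

/-! ### Uniformity of the flow ahead of the front -/

namespace IsFlow

variable {γ b u c₁ : ℝ} {Ω : Set Plane} {f : Plane → ℝ} {φ : Space → ℝ}
  (h : IsFlow γ b u c₁ Ω f φ)
include h

lemma hasDerivAt_vertical {t : ℝ} {y : Plane} (ht : lift t y ∈ smoothRegion Ω f) :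
    HasDerivAt (fun t => φ (lift t y)) (gradient φ (lift t y) 0) t := by
  have h1 : HasDerivAt (fun t => lift t y) axis t := by
    simp only [lift_eq]
    simpa using ((hasDerivAt_id t).smul_const axis).add_const (embed y)
  have := (h.hasFDerivAt ht).comp_hasDerivAt t h1
  rw [innerSL_apply_apply, inner_axis] at this
  exact this

omit h in
lemma convex_column (y : Plane) (s t : ℝ) :
    Convex ℝ {z : Space | cross z = y ∧ z 0 ∈ Ioo s t} := by
  have e : {z : Space | cross z = y ∧ z 0 ∈ Ioo s t} =
      crossL ⁻¹' {y} ∩ (EuclideanSpace.proj 0 : Space →L[ℝ] ℝ) ⁻¹' Ioo s t := rfl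
  rw [e]
  exact ((convex_singleton y).linear_preimage crossL.toLinearMap).inter
    ((convex_Ioo s t).linear_preimage (EuclideanSpace.proj 0 : Space →L[ℝ] ℝ).toLinearMap)

lemma norm_gradient_vertical_le {M : ℝ}
    (hM : ∀ x ∈ smoothRegion Ω f, ‖fderiv ℝ (gradient φ) x‖ ≤ M) {y : Plane} {l r s t : ℝ}
    (hsub : ∀ τ ∈ Ioo l r, lift τ y ∈ smoothRegion Ω f) (hs : s ∈ Ioo l r) (ht : t ∈ Ioo l r) :
    ‖gradient φ (lift t y) - gradient φ (lift s y)‖ ≤ M * |t - s| := by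
  have := h.norm_gradient_sub_le hM (convex_column y l r) (x := lift t y) (z := lift s y)
    (by rintro z ⟨rfl, hz⟩; simpa using hsub _ hz) ⟨by simp, by simpa using ht⟩
    ⟨by simp, by simpa using hs⟩
  rwa [norm_lift_sub_lift] at this

lemma lift_mem_upstream {y : Plane} (hy : y ∈ Ω) {t : ℝ} (ht : t ∈ Ioo (-1) (f y)) :
    lift t y ∈ upstream Ω f := by
  rw [h.upstream_eq, lift_mem_graphRegion]; exact ⟨hy, ht⟩

lemma lift_mem_downstream {y : Plane} (hy : y ∈ Ω) {t : ℝ} (ht : t ∈ Ioo (f y) 1) :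
    lift t y ∈ downstream Ω f := by
  rw [h.downstream_eq, lift_mem_graphRegion]; exact ⟨hy, ht⟩

lemma tendsto_lift_entry {y : Plane} (hy : y ∈ Ω) :
    Tendsto (fun t => lift t y) (𝓝[>] (-1 : ℝ)) (𝓝[smoothRegion Ω f] (lift (-1) y)) := by
  refine tendsto_lift nhdsWithin_le_nhds ?_
  filter_upwards [Ioo_mem_nhdsGT (h.neg_one_lt_front hy)] with t ht
  exact Or.inl (h.lift_mem_upstream hy ht)

lemma tendsto_lift_exit {y : Plane} (hy : y ∈ Ω) :
    Tendsto (fun t => lift t y) (𝓝[<] (1 : ℝ)) (𝓝[smoothRegion Ω f] (lift 1 y)) := by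
  refine tendsto_lift nhdsWithin_le_nhds ?_
  filter_upwards [Ioo_mem_nhdsLT (h.front_lt_one hy)] with t ht
  exact Or.inr (h.lift_mem_downstream hy ht)

lemma tendsto_lift_front_left {y : Plane} (hy : y ∈ Ω) :
    Tendsto (fun t => lift t y) (𝓝[<] (f y)) (𝓝[upstream Ω f] (lift (f y) y)) := by
  refine tendsto_lift nhdsWithin_le_nhds ?_
  filter_upwards [Ioo_mem_nhdsLT (h.neg_one_lt_front hy)] with t ht
  exact h.lift_mem_upstream hy ht

lemma tendsto_lift_front_right {y : Plane} (hy : y ∈ Ω) :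
    Tendsto (fun t => lift t y) (𝓝[>] (f y)) (𝓝[downstream Ω f] (lift (f y) y)) := by
  refine tendsto_lift nhdsWithin_le_nhds ?_
  filter_upwards [Ioo_mem_nhdsGT (h.front_lt_one hy)] with t ht
  exact h.lift_mem_downstream hy ht

lemma lift_mem_front {y : Plane} (hy : y ∈ Ω) : lift (f y) y ∈ front Ω f :=
  ⟨⟨by simpa using ⟨h.neg_one_lt_front hy, h.front_lt_one hy⟩, by simpa using hy⟩, by simp⟩

omit h in
/-- The relative current, cut off away from the state `u • axis`. -/
def cutCurrent (γ b u : ℝ) (χ : ContDiffBump (u • axis)) (p : Space) : Space :=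
  χ p • relCurrent γ b (u • axis) p

-- The density is smooth only where the base is positive; the bump function confines the current to
-- such states and makes it a compactly supported `C¹` function of every velocity.
omit h in
lemma contDiff_cutCurrent {γ b u : ℝ} {χ : ContDiffBump (u • axis)}
    (hχ : ∀ p : Space, ‖p - u • axis‖ ≤ χ.rOut → 0 < bernoulliBase γ b (‖p‖ ^ 2)) :
    ContDiff ℝ 1 (cutCurrent γ b u χ) := by
  refine contDiff_iff_contDiffAt.2 fun p => ?_
  by_cases hp : p ∈ tsupport χ
  · rw [χ.tsupport_eq, Metric.mem_closedBall, dist_eq_norm] at hp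
    exact χ.contDiff.contDiffAt.smul (contDiffAt_relCurrent (hχ p hp))
  · refine contDiffAt_const (c := (0 : Space)) |>.congr_of_eventuallyEq ?_
    filter_upwards [notMem_tsupport_iff_eventuallyEq.1 hp] with z hz
    simp [cutCurrent, hz]

omit h in
lemma exists_bound_cutCurrent {γ b u : ℝ} {χ : ContDiffBump (u • axis)}
    (hχ : ∀ p : Space, ‖p - u • axis‖ ≤ χ.rOut → 0 < bernoulliBase γ b (‖p‖ ^ 2)) :
    ∃ C, ∀ p, ‖cutCurrent γ b u χ p‖ ≤ C ∧ ‖fderiv ℝ (cutCurrent γ b u χ) p‖ ≤ C := by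
  have hcs : HasCompactSupport (cutCurrent γ b u χ) := χ.hasCompactSupport.smul_right
  have hcd := contDiff_cutCurrent hχ
  obtain ⟨C, hC⟩ := hcd.continuous.bounded_above_of_compact_support hcs
  obtain ⟨C', hC'⟩ := (hcd.continuous_fderiv one_ne_zero).bounded_above_of_compact_support
    (hcs.fderiv ℝ)
  exact ⟨max C C', fun p => ⟨(hC p).trans (le_max_left _ _), (hC' p).trans (le_max_right _ _)⟩⟩

-- Against a cross-sectional direction the axial terms and the constant flux of `u • axis` drop out.
-- The current is then a bounded multiple of the normal velocity, so the slip condition kills it on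
-- the wall.
omit h in
lemma inner_cutCurrent_embed (γ b u : ℝ) (χ : ContDiffBump (u • axis)) (p : Space) (n : Plane) :
    inner ℝ (cutCurrent γ b u χ p) (embed n) =
      χ p * ((p 0 - u) * density γ b (‖p‖ ^ 2)) * inner ℝ p (embed n) := by
  simp [cutCurrent, relCurrent, massFlux, inner_smul_left, inner_sub_left]
  ring

omit h in
lemma exists_bound_cutCoefficient {γ b u : ℝ} {χ : ContDiffBump (u • axis)}
    (hχ : ∀ p : Space, ‖p - u • axis‖ ≤ χ.rOut → 0 < bernoulliBase γ b (‖p‖ ^ 2)) :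
    ∃ C, ∀ p : Space, |χ p * ((p 0 - u) * density γ b (‖p‖ ^ 2))| ≤ C := by
  have hcont : Continuous fun p : Space => χ p * ((p 0 - u) * density γ b (‖p‖ ^ 2)) := by
    refine continuous_iff_continuousAt.2 fun p => ?_
    by_cases hp : p ∈ tsupport χ
    · rw [χ.tsupport_eq, Metric.mem_closedBall, dist_eq_norm] at hp
      refine χ.continuous.continuousAt.mul
        (((continuous_coord 0).sub continuous_const).continuousAt.mul ?_)
      exact ContinuousAt.comp (g := density γ b)
        (contDiffAt_density (n := 1) (hχ p hp)).continuousAt (continuous_norm.pow 2).continuousAt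
    · refine (continuousAt_const (y := (0 : ℝ))).congr ?_
      filter_upwards [notMem_tsupport_iff_eventuallyEq.1 hp] with z hz
      simp [hz]
  exact hcont.bounded_above_of_compact_support χ.hasCompactSupport.mul_right

/-- If the upstream flow is uniform near the entry, then it is uniform a little further on. -/
lemma upstream_step {δ κ M : ℝ} (hδ : 0 < δ) (hκ : 0 < κ) (hM0 : 0 < M)
    (hM : ∀ x ∈ smoothRegion Ω f, ‖fderiv ℝ (gradient φ) x‖ ≤ M)
    (hsign : ∀ p : Space, ‖p - u • axis‖ ≤ δ →
      0 < bernoulliBase γ b (‖p‖ ^ 2) ∧ criticalSpeed γ b < p 0 ∧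
      relCurrent γ b (u • axis) p 0 ≤ -κ * ‖p - u • axis‖ ^ 2 ∧
      ∀ r : Space, ‖r‖ ≤ criticalSpeed γ b →
        inner ℝ (massFlux γ b p - massFlux γ b r) (p - r) = 0 →
        inner ℝ (relCurrent γ b (u • axis) p) (p - r) ≤ 0)
    {s : ℝ} (hs1 : -1 ≤ s)
    (hs : ∀ x ∈ upstream Ω f, x 0 < s → gradient φ x = u • axis) :
    ∀ x ∈ upstream Ω f, x 0 < s + δ / (8 * M) → gradient φ x = u • axis := by
  set q : Space := u • axis with hq
  -- Over an axial distance `2 * d` the gradient moves by at most `M * (2 * d) = δ / 4`; starting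
  -- within `δ / 4` of `q` it stays within `δ / 2`.
  set d := δ / (8 * M) with hd
  have hd0 : 0 < d := by positivity
  have hMd : M * (2 * d) = δ / 4 := by rw [hd]; field_simp; norm_num
  have hup : upstream Ω f ⊆ smoothRegion Ω f := subset_union_left
  have hnear : ∀ x ∈ upstream Ω f, x 0 < s + d → ‖gradient φ x - q‖ ≤ δ / 2 := by
    intro x hx hxs
    rcases lt_or_ge (x 0) s with hlt | hge
    · rw [hs x hx hlt]; simp; positivity
    set y := cross x
    have hx' := hx
    rw [h.upstream_eq] at hx'
    obtain ⟨hy, hx1, hx2⟩ := hx'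
    -- A reference point on the column where the gradient is already close to `q`: just behind the
    -- entry if `s = -1`, otherwise in the part already known to be uniform.
    obtain ⟨t, ht1, ht2, ht3⟩ : ∃ t ∈ Ioo (-1 : ℝ) (x 0), x 0 - t ≤ 2 * d ∧
        ‖gradient φ (lift t y) - q‖ ≤ δ / 4 := by
      rcases hs1.eq_or_lt with hs1 | hs1
      · have h1 := ((h.tendsto_gradient_entry hy).comp (h.tendsto_lift_entry hy)).sub_const q
        rw [sub_self] at h1
        have h2 := (h1.norm).eventually_lt_const (u := δ / 4) (by rw [norm_zero]; positivity)
        obtain ⟨t, ht, ht'⟩ := (h2.and (Ioo_mem_nhdsGT hx1)).exists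
        exact ⟨t, ht', by linarith [ht'.1], ht.le⟩
      · have hlt : max (-1) (s - d) < s := max_lt hs1 (by linarith)
        obtain ⟨t, ht1, ht2⟩ := exists_between hlt
        rw [max_lt_iff] at ht1
        have htx : t ∈ Ioo (-1 : ℝ) (x 0) := ⟨ht1.1, ht2.trans_le hge⟩
        refine ⟨t, htx, by linarith, ?_⟩
        rw [hs (lift t y) (h.lift_mem_upstream hy ⟨htx.1, htx.2.trans hx2⟩) (by simpa using ht2)]
        simp; positivity
    have h3 := h.norm_gradient_vertical_le hM (y := y) (l := -1) (r := f y) (s := t) (t := x 0)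
      (fun τ hτ => hup (h.lift_mem_upstream hy hτ)) ⟨ht1.1, ht1.2.trans hx2⟩ ⟨hx1, hx2⟩
    rw [lift_cross, abs_of_pos (sub_pos.2 ht1.2)] at h3
    calc ‖gradient φ x - q‖ ≤ ‖gradient φ x - gradient φ (lift t y)‖ +
          ‖gradient φ (lift t y) - q‖ := norm_sub_le_norm_sub_add_norm_sub _ _ _
      _ ≤ M * (2 * d) + δ / 4 :=
          add_le_add (h3.trans (mul_le_mul_of_nonneg_left ht2 hM0.le)) ht3
      _ = δ / 2 := by rw [hMd]; ring
  let χ : ContDiffBump q := ⟨δ / 2, δ, by positivity, by linarith⟩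
  have hχ : ∀ p : Space, ‖p - q‖ ≤ χ.rOut → 0 < bernoulliBase γ b (‖p‖ ^ 2) := fun p hp =>
    (hsign p hp).1
  have hχ1 : ∀ p : Space, ‖p - q‖ ≤ δ / 2 → cutCurrent γ b u χ p = relCurrent γ b q p := by
    intro p hp
    have : χ p = 1 := χ.one_of_mem_closedBall (by rwa [Metric.mem_closedBall, dist_eq_norm])
    rw [cutCurrent, this, one_smul]
  obtain ⟨C, hC⟩ := exists_bound_cutCurrent hχ
  obtain ⟨C', hC'⟩ := exists_bound_cutCoefficient hχ
  have hcd := contDiff_cutCurrent hχ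
  -- The weight decreases in the axial direction, which gives the divergence of the weighted current
  -- its sign, and vanishes beyond `s + d`, where nothing is known about the gradient.
  set ζ : Space → ℝ := fun x => posSq (s + d - x 0) with hζ
  have hζd : ∀ x, HasFDerivAt ζ
      ((2 * max (s + d - x 0) 0) • (-(EuclideanSpace.proj 0 : Space →L[ℝ] ℝ))) x := by
    intro x
    have h1 : HasFDerivAt (fun x : Space => s + d - x 0)
        (-(EuclideanSpace.proj 0 : Space →L[ℝ] ℝ)) x :=
      (EuclideanSpace.proj 0 : Space →L[ℝ] ℝ).hasFDerivAt.const_sub _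
    exact (hasDerivAt_posSq _).comp_hasFDerivAt x h1
  have hζc : ContDiff ℝ 1 ζ :=
    contDiff_posSq.comp (contDiff_const.sub (EuclideanSpace.proj 0 : Space →L[ℝ] ℝ).contDiff)
  set G : Space → Space := fun x => cutCurrent γ b u χ (gradient φ x) with hG
  have hGd : ∀ x ∈ smoothRegion Ω f, HasFDerivAt G
      ((fderiv ℝ (cutCurrent γ b u χ) (gradient φ x)).comp (fderiv ℝ (gradient φ) x)) x :=
    fun x hx => ((hcd.differentiable one_ne_zero _).hasFDerivAt).comp x
      (h.differentiableAt_gradient hx).hasFDerivAt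
  set S := s + d + 1
  have hS0 : 0 < S := by simp only [S]; linarith
  have hζb : ∀ x ∈ upstream Ω f, |ζ x| ≤ max (S ^ 2) (2 * S) ∧
      ‖fderiv ℝ ζ x‖ ≤ max (S ^ 2) (2 * S) := by
    intro x hx
    have hx1 : -1 < x 0 := hx.1.1.1
    have hm : max (s + d - x 0) 0 ≤ S := max_le (by simp only [S]; linarith) hS0.le
    have hm0 : 0 ≤ max (s + d - x 0) 0 := le_max_right _ _
    constructor
    · refine le_trans ?_ (le_max_left _ _)
      simp only [hζ, posSq]
      rw [abs_of_nonneg (by positivity)]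
      exact pow_le_pow_left₀ hm0 hm 2
    · refine le_trans ?_ (le_max_right _ _)
      rw [(hζd x).fderiv, norm_smul, norm_neg, Real.norm_of_nonneg (by positivity)]
      have hp : ‖(EuclideanSpace.proj 0 : Space →L[ℝ] ℝ)‖ ≤ 1 :=
        ContinuousLinearMap.opNorm_le_bound _ zero_le_one fun x => by
          simpa using PiLp.norm_apply_le x 0
      nlinarith [norm_nonneg (EuclideanSpace.proj 0 : Space →L[ℝ] ℝ)]
  have hfield : IsDuctField Ω (fun _ => -1) f (fun x => ζ x • G x) := by
    refine ⟨contDiffOn_const, h.contDiffOn_front, fun y hy => h.neg_one_lt_front hy,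
      fun y _ => le_rfl, fun y hy => (h.front_lt_one hy).le, ?_, ?_, ?_⟩
    · rw [← h.upstream_eq]
      exact fun x hx => (hζc.contDiffAt.smul (hcd.contDiffAt.comp x
        (h.contDiffAt_gradient (hup hx)))).contDiffWithinAt
    · rw [← h.upstream_eq]
      refine ⟨2 * (max (S ^ 2) (2 * S) * max C (C * M)), fun x hx => ?_⟩
      refine norm_smul_and_fderiv_le (hζd x).differentiableAt (hGd x (hup hx)).differentiableAt
        (hζb x hx).1 (hζb x hx).2 ((hC _).1.trans (le_max_left _ _)) ?_
      rw [(hGd x (hup hx)).fderiv]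
      refine ((ContinuousLinearMap.opNorm_comp_le _ _).trans ?_).trans (le_max_right _ _)
      exact mul_le_mul (hC _).2 (hM x (hup hx)) (norm_nonneg _)
        ((norm_nonneg _).trans (hC 0).1)
    · intro x hx n hn
      rw [← h.upstream_eq]
      have hslip : Tendsto (fun z => inner ℝ (gradient φ z) (embed n)) (𝓝[upstream Ω f] x) (𝓝 0) :=
        (h.sol.slip x hx n hn).mono_left (nhdsWithin_mono x hup)
      refine squeeze_zero_norm' (a := fun z => max (S ^ 2) (2 * S) * (C' *
        |inner ℝ (gradient φ z) (embed n)|)) ?_ ?_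
      · filter_upwards [self_mem_nhdsWithin] with z hz
        rw [inner_smul_left, norm_mul]
        simp only [hG, inner_cutCurrent_embed, norm_mul]
        refine mul_le_mul (by simpa using (hζb z hz).1) ?_ (by positivity)
          ((abs_nonneg _).trans (hζb z hz).1)
        refine mul_le_mul_of_nonneg_right ?_ (norm_nonneg _)
        simpa using hC' (gradient φ z)
      · have := ((hslip.abs).const_mul C').const_mul (max (S ^ 2) (2 * S))
        rw [abs_zero, mul_zero, mul_zero] at this
        exact this
  have hdivV : ∀ x ∈ upstream Ω f, divergence (fun x => ζ x • G x) x =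
      -(2 * max (s + d - x 0) 0 * relCurrent γ b q (gradient φ x) 0) := by
    intro x hx
    rw [divergence_smul (hζd x) (hGd x (hup hx)).differentiableAt]
    rcases lt_or_ge (x 0) (s + d) with hlt | hge
    · have hev : G =ᶠ[𝓝 x] fun z => relCurrent γ b q (gradient φ z) := by
        filter_upwards [h.isOpen_upstream.mem_nhds hx,
          (continuous_coord 0).continuousAt.eventually_lt_const hlt] with z hz hz'
        exact hχ1 _ (hnear z hz hz')
      have h0 : divergence G x = 0 := by
        have : divergence G x = divergence (fun z => relCurrent γ b q (gradient φ z)) x := by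
          simp only [divergence, hev.fderiv_eq]
        rw [this]
        exact divergence_relCurrent h.one_le (h.differentiableAt_gradient (hup hx))
          (h.sol.density_pos x (hup hx)) (h.fderiv_gradient_symm (hup hx))
          (h.sol.equation x (hup hx))
      rw [h0, hev.self_of_nhds]
      simp
    · have hm : max (s + d - x 0) 0 = 0 := max_eq_right (by linarith)
      simp [hζ, posSq, hm]
  have hsgn : ∀ x ∈ upstream Ω f, x 0 < s + d → relCurrent γ b q (gradient φ x) 0 ≤
      -κ * ‖gradient φ x - q‖ ^ 2 := fun x hx hxs =>
    (hsign _ ((hnear x hx hxs).trans (by linarith))).2.2.1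
  have hzero := hfield.divergence_eq_zero h.crossSection (by
    rw [← h.upstream_eq]
    intro x hx
    rw [hdivV x hx]
    rcases lt_or_ge (x 0) (s + d) with hlt | hge
    · have h1 := hsgn x hx hlt
      have h2 : 0 ≤ κ * ‖gradient φ x - q‖ ^ 2 := by positivity
      have h3 : 0 ≤ 2 * max (s + d - x 0) 0 := by positivity
      nlinarith
    · have hm : max (s + d - x 0) 0 = 0 := max_eq_right (by linarith)
      simp [hm]) (by
    intro y hy
    obtain ⟨wm, wp, hwm, hwp, hflux, -, -⟩ := h.sol.jump _ (h.lift_mem_front hy)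
    have hζt : ∀ (l : Filter ℝ) (t : ℝ), l ≤ 𝓝 t →
        Tendsto (fun t => ζ (lift t y)) l (𝓝 (ζ (lift t y))) := fun l t hl =>
      ((hζc.continuous.comp (continuous_lift.comp (Continuous.prodMk_left y))).tendsto t).mono_left
        hl
    have hGe := (hcd.continuous.tendsto q).comp
      ((h.tendsto_gradient_entry hy).comp (h.tendsto_lift_entry hy))
    have hGf := (hcd.continuous.tendsto wm).comp (hwm.comp (h.tendsto_lift_front_left hy))
    refine ⟨_, _, (hζt _ _ nhdsWithin_le_nhds).smul hGe, (hζt _ _ nhdsWithin_le_nhds).smul hGf, ?_⟩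
    rw [hχ1 q (by simp; positivity), relCurrent_self, smul_zero, inner_zero_left, inner_smul_left]
    -- Where the front lies inside the slab, its normal is a positive multiple of `wm - wp`, so
    -- `hsign` bounds the flux; elsewhere the weight is zero.
    rcases lt_or_ge (f y) (s + d) with hlt | hge
    · have hwmq : ‖wm - q‖ ≤ δ / 2 := by
        refine le_of_tendsto ((hwm.comp (h.tendsto_lift_front_left hy)).sub_const q).norm ?_
        filter_upwards [Ioo_mem_nhdsLT (h.neg_one_lt_front hy)] with t ht
        exact hnear _ (h.lift_mem_upstream hy ht) (by simpa using ht.2.trans hlt)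
      have hwpn : ‖wp‖ ≤ criticalSpeed γ b := by
        refine le_of_tendsto (hwp.comp (h.tendsto_lift_front_right hy)).norm ?_
        filter_upwards [Ioo_mem_nhdsGT (h.front_lt_one hy)] with t ht
        exact (h.norm_gradient_lt (h.lift_mem_downstream hy ht)).le
      obtain ⟨-, hwm0, -, hr⟩ := hsign wm (hwmq.trans (by linarith))
      have hjump := h.jump_normal hy hwm hwp
      have hκ' : 0 < wm 0 - wp 0 := by
        have := (le_abs_self (wp 0)).trans ((abs_zero_le_norm wp).trans hwpn)
        linarith
      rw [cross_lift] at hflux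
      have hle := hr wp hwpn (by
        rw [hjump, inner_smul_right, inner_sub_left, hflux, sub_self, mul_zero])
      rw [hjump, inner_smul_right] at hle
      rw [hχ1 wm hwmq]
      have hle' : inner ℝ (relCurrent γ b q wm) (frontNormal f y) ≤ 0 := by
        by_contra! hcon
        exact absurd hle (not_le.2 (mul_pos hκ' hcon))
      exact mul_nonpos_of_nonneg_of_nonpos (by simp [hζ, posSq]) hle'
    · have hm : max (s + d - f y) 0 = 0 := max_eq_right (by linarith)
      simp [hζ, posSq, hm])
  rw [← h.upstream_eq] at hzero
  intro x hx hxs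
  have h0 := hzero x hx
  rw [hdivV x hx, max_eq_left (by linarith)] at h0
  have h1 := hsgn x hx hxs
  have h2 : relCurrent γ b q (gradient φ x) 0 = 0 := by
    have : 0 < s + d - x 0 := by linarith
    have := mul_ne_zero two_ne_zero this.ne'
    exact (mul_eq_zero.1 (neg_eq_zero.1 h0)).resolve_left this
  rw [h2] at h1
  have h3 : ‖gradient φ x - q‖ ^ 2 = 0 := by
    have : 0 ≤ ‖gradient φ x - q‖ ^ 2 := by positivity
    nlinarith
  exact sub_eq_zero.1 (norm_eq_zero.1 (pow_eq_zero_iff two_ne_zero |>.1 h3))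

/-- The flow is uniform ahead of the front. -/
theorem gradient_upstream {x : Space} (hx : x ∈ upstream Ω f) : gradient φ x = u • axis := by
  obtain ⟨δ, hδ, κ, hκ, hsign⟩ := exists_relCurrent_sign h.one_le h.critical_pos h.critical_lt
    h.base_pos
  obtain ⟨M, hM0, hM⟩ := h.exists_hessian_bound
  have hd : 0 < δ / (8 * M) := by positivity
  -- The step length depends only on `δ` and `M`, so any point is reached after finitely many steps.
  have key : ∀ n : ℕ, ∀ x ∈ upstream Ω f, x 0 < -1 + n * (δ / (8 * M)) →
      gradient φ x = u • axis := by
    intro n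
    induction n with
    | zero =>
      intro x hx hx0
      have := hx.1.1.1
      simp at hx0; linarith
    | succ n ih =>
      intro x hx hx0
      refine h.upstream_step hδ hκ hM0 hM hsign (s := -1 + n * (δ / (8 * M)))
        (by have : 0 ≤ (n : ℝ) * (δ / (8 * M)) := by positivity
            linarith) ih x hx (hx0.trans_eq ?_)
      push_cast; ring
  obtain ⟨n, hn⟩ := exists_nat_gt ((x 0 + 1) / (δ / (8 * M)))
  exact key n x hx (by have := (div_lt_iff₀ hd).1 hn; linarith)

theorem potential_upstream {x : Space} (hx : x ∈ upstream Ω f) : φ x = u * x 0 := by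
  have hx' := hx
  rw [h.upstream_eq] at hx'
  obtain ⟨hy, hx1, hx2⟩ := hx'
  have hd : ∀ t ∈ Ioo (-1) (f (cross x)), HasDerivAt (fun t => φ (lift t (cross x))) u t := by
    intro t ht
    have hm := h.lift_mem_upstream hy ht
    have := h.hasDerivAt_vertical (Or.inl hm)
    rw [h.gradient_upstream hm] at this
    simpa using this
  have := eq_of_hasDerivAt_of_tendsto hd (Ioo_mem_nhdsGT (h.neg_one_lt_front hy))
    nhdsWithin_le_nhds
    ((h.sol.entry_potential (lift (-1) (cross x)) ⟨by simp, by simpa using hy⟩).comp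
      (h.tendsto_lift_entry hy)) ⟨hx1, hx2⟩
  rw [lift_cross] at this
  rw [this]; ring

end IsFlow

lemma norm_smul_axis {s : ℝ} (hs : 0 ≤ s) : ‖s • axis‖ = s := by
  rw [norm_smul, norm_axis, mul_one, Real.norm_of_nonneg hs]

lemma frontNormal_const (c : ℝ) (y : Plane) : frontNormal (fun _ => c) y = axis :=
  space_ext (by simp [frontNormal_zero]) (by rw [cross_frontNormal]; simp)

lemma massFlux_smul_axis {γ b s : ℝ} (hs : 0 ≤ s) :
    massFlux γ b (s • axis) = (density γ b (s ^ 2) * s) • axis := by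
  rw [massFlux, norm_smul_axis hs, smul_smul]

lemma exists_bound_massFlux {γ b : ℝ} (hγ : 1 ≤ γ) (hc : 0 < criticalSpeed γ b) :
    ∃ C, ∀ p : Space, ‖p‖ ≤ criticalSpeed γ b → ‖massFlux γ b p‖ ≤ C ∧ ‖fluxDeriv γ b p‖ ≤ C := by
  have hb : ∀ p ∈ Metric.closedBall (0 : Space) (criticalSpeed γ b),
      0 < bernoulliBase γ b (‖p‖ ^ 2) := fun p hp =>
    bernoulliBase_pos_of_le hγ hc (norm_nonneg _) (by simpa using hp)
  have hK := isCompact_closedBall (0 : Space) (criticalSpeed γ b)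
  obtain ⟨C, hC⟩ := hK.exists_bound_of_continuousOn (f := massFlux γ b) fun p hp =>
    (hasFDerivAt_massFlux (hb p hp)).continuousAt.continuousWithinAt
  obtain ⟨C', hC'⟩ := hK.exists_bound_of_continuousOn (f := fderiv ℝ (massFlux γ b)) fun p hp =>
    ((contDiffAt_massFlux (n := 2) (hb p hp)).fderiv_right
      (m := 0) (by norm_num)).continuousAt.continuousWithinAt
  refine ⟨max C C', fun p hp => ?_⟩
  have hp' : p ∈ Metric.closedBall (0 : Space) (criticalSpeed γ b) := by simpa using hp
  refine ⟨(hC p hp').trans (le_max_left _ _), ?_⟩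
  rw [← (hasFDerivAt_massFlux (hb p hp')).fderiv]
  exact (hC' p hp').trans (le_max_right _ _)

namespace IsFlow

variable {γ b u c₁ : ℝ} {Ω : Set Plane} {f : Plane → ℝ} {φ : Space → ℝ}
  (h : IsFlow γ b u c₁ Ω f φ)
include h

/-! #### The exit -/

lemma exists_halfBall_exit {y : Plane} (hy : y ∈ Ω) :
    ∃ r > 0, halfBall (lift 1 y) r (-1) ⊆ downstream Ω f := by
  have h1 : ∀ᶠ z in 𝓝 (lift 1 y), cross z ∈ Ω :=
    continuous_cross.continuousAt.eventually (by simpa using h.crossSection.isOpen.mem_nhds hy)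
  have h2 : ∀ᶠ z : Space in 𝓝 (lift 1 y), f (cross z) < z 0 := by
    refine ContinuousAt.eventually_lt ?_ (continuous_coord 0).continuousAt ?_
    · exact ContinuousAt.comp (g := f) (by simpa using h.continuousAt_front hy)
        continuous_cross.continuousAt
    · simpa using h.front_lt_one hy
  obtain ⟨r, hr, hball⟩ := Metric.eventually_nhds_iff_ball.1 (h1.and h2)
  refine ⟨r, hr, ?_⟩
  rintro z ⟨hz, hz0⟩
  rw [h.downstream_eq]
  simp at hz0
  exact ⟨(hball z hz).1, (hball z hz).2, by linarith⟩

lemma exists_tendsto_gradient_exit {y : Plane} (hy : y ∈ Ω) :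
    ∃ P : Space, Tendsto (gradient φ) (𝓝[smoothRegion Ω f] (lift 1 y)) (𝓝 P) ∧ ‖P‖ = c₁ := by
  obtain ⟨r, hr, hsub⟩ := h.exists_halfBall_exit hy
  obtain ⟨P, hP⟩ := h.exists_tendsto_gradient (convex_halfBall _ r (-1))
    (hsub.trans subset_union_right) (lift 1 y)
  have hnhds : halfBall (lift 1 y) r (-1) ∈ 𝓝[smoothRegion Ω f] (lift 1 y) := by
    filter_upwards [mem_nhdsWithin_of_mem_nhds (Metric.ball_mem_nhds _ hr),
      self_mem_nhdsWithin] with z hz hzs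
    refine ⟨hz, ?_⟩
    have := (smoothRegion_subset_duct hzs).1.2
    simp; linarith
  have hPs := hP.mono_left (nhdsWithin_le_iff.2 hnhds)
  exact ⟨P, hPs, tendsto_nhds_unique (hPs.norm.comp (h.tendsto_lift_exit hy))
    ((h.sol.exit_speed (lift 1 y) ⟨by simp, by simpa using hy⟩).comp (h.tendsto_lift_exit hy))⟩

/-! #### Behind the front -/

/-- Ahead of the front the flux is axial, and the front normal has axial component one, so the flux
per unit cross-section does not depend on the slope of the front. -/
lemma exists_tendsto_gradient_front {y : Plane} (hy : y ∈ Ω) :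
    ∃ w : Space, Tendsto (gradient φ) (𝓝[downstream Ω f] (lift (f y) y)) (𝓝 w) ∧
      inner ℝ (massFlux γ b w) (frontNormal f y) = density γ b (u ^ 2) * u := by
  obtain ⟨wm, wp, hm, hp, hflux, -, -⟩ := h.sol.jump _ (h.lift_mem_front hy)
  refine ⟨wp, hp, ?_⟩
  have hwm : wm = u • axis := by
    refine tendsto_nhds_unique (hm.comp (h.tendsto_lift_front_left hy))
      (tendsto_const_nhds.congr' ?_)
    filter_upwards [Ioo_mem_nhdsLT (h.neg_one_lt_front hy)] with t ht
    exact (h.gradient_upstream (h.lift_mem_upstream hy ht)).symm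
  rw [cross_lift, hwm, massFlux_smul_axis h.entry_pos.le] at hflux
  rw [hflux, inner_smul_left, axis_inner, frontNormal_zero]
  simp

lemma exists_bound_potential {Φ : Space → ℝ} (hΦ : Continuous Φ) (v : ℝ) :
    ∃ A, ∀ y ∈ closure Ω, ∀ t ∈ Icc (-1 : ℝ) 1, |Φ (lift t y) - v * t| ≤ A := by
  have hc : Continuous fun z : ℝ × Plane => Φ (lift z.1 z.2) - v * z.1 :=
    (hΦ.comp continuous_lift).sub (continuous_const.mul continuous_fst)
  obtain ⟨A, hA⟩ := ((isCompact_Icc (a := (-1 : ℝ)) (b := 1)).prod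
    h.crossSection.isBounded.isCompact_closure).exists_bound_of_continuousOn hc.continuousOn
  exact ⟨A, fun y hy t ht => hA (t, y) ⟨ht, hy⟩⟩

lemma hasFDerivAt_excess {v : ℝ} {x : Space} (hx : x ∈ smoothRegion Ω f) :
    HasFDerivAt (fun z => φ z - v * z 0) (innerSL ℝ (gradient φ x - v • axis)) x := by
  have h1 := (h.hasFDerivAt hx).sub
    (((EuclideanSpace.proj 0 : Space →L[ℝ] ℝ).hasFDerivAt (x := x)).const_mul v)
  convert! h1 using 1
  ext k
  simp only [innerSL_apply_apply, sub_apply, smul_apply, inner_sub_left, inner_smul_left,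
    axis_inner, PiLp.proj_apply, smul_eq_mul]
  rfl

/-- If the excess potential `W = φ - v x₁` times the excess flux, cut off by a nondecreasing
function of `W`, does not flow out through the exit, then the flow is uniform where the cut-off
increases. -/
lemma downstream_rigidity {v : ℝ} (hv : IsDownstreamSpeed γ b u v) {Φ : Space → ℝ}
    (hΦc : Continuous Φ) (hΦ : EqOn φ Φ (duct Ω)) {θ θ' : ℝ → ℝ}
    (hθ : ∀ s, HasDerivAt θ (θ' s) s) (hθc : Continuous θ') (hθ0 : ∀ s, 0 ≤ θ' s)
    (hexit : ∀ y ∈ Ω, ∀ P : Space, ‖P‖ = c₁ → θ (Φ (lift 1 y) - v) *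
      (density γ b (c₁ ^ 2) * P 0 - density γ b (v ^ 2) * v) ≤ 0) {x : Space}
    (hx : x ∈ downstream Ω f) : θ' (φ x - v * x 0) = 0 ∨ gradient φ x = v • axis := by
  obtain ⟨hv0, hvc, hvu⟩ := hv
  have hdn : downstream Ω f ⊆ smoothRegion Ω f := subset_union_right
  have hθd : ContDiff ℝ 1 θ := by
    rw [contDiff_one_iff_deriv]
    refine ⟨fun s => (hθ s).differentiableAt, ?_⟩
    rwa [show deriv θ = θ' from funext fun s => (hθ s).deriv]
  obtain ⟨A, hA⟩ := h.exists_bound_potential hΦc v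
  obtain ⟨B, hB⟩ := (isCompact_Icc (a := -A) (b := A)).exists_bound_of_continuousOn
    hθd.continuous.continuousOn
  obtain ⟨B', hB'⟩ := (isCompact_Icc (a := -A) (b := A)).exists_bound_of_continuousOn
    hθc.continuousOn
  obtain ⟨M, hM0, hM⟩ := h.exists_hessian_bound
  obtain ⟨C, hC⟩ := exists_bound_massFlux h.one_le h.critical_pos
  have hcm : ∀ x ∈ downstream Ω f, ‖gradient φ x‖ < criticalSpeed γ b := fun x hx =>
    h.norm_gradient_lt hx
  have hvn : ‖v • axis‖ = v := norm_smul_axis hv0.le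
  have hWA : ∀ x ∈ downstream Ω f, φ x - v * x 0 ∈ Icc (-A) A := by
    intro x hx
    have := hA (cross x) (subset_closure hx.1.2) (x 0) ⟨hx.1.1.1.le, hx.1.1.2.le⟩
    rw [lift_cross, ← hΦ hx.1] at this
    exact abs_le.1 this
  set ξ : Space → ℝ := fun x => θ (φ x - v * x 0) with hξ
  have hξd : ∀ x ∈ downstream Ω f, HasFDerivAt ξ
      (θ' (φ x - v * x 0) • innerSL ℝ (gradient φ x - v • axis)) x := fun x hx =>
    (hθ _).comp_hasFDerivAt x (h.hasFDerivAt_excess (hdn hx))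
  set G : Space → Space := fun x => massFlux γ b (gradient φ x) - massFlux γ b (v • axis) with hG
  have hGd : ∀ x ∈ downstream Ω f, HasFDerivAt G
      ((fluxDeriv γ b (gradient φ x)).comp (fderiv ℝ (gradient φ) x)) x := fun x hx =>
    ((hasFDerivAt_massFlux (h.sol.density_pos x (hdn hx))).comp x
      (h.differentiableAt_gradient (hdn hx)).hasFDerivAt).sub_const _
  set E := max B (B' * (criticalSpeed γ b + v))
  have hξb : ∀ x ∈ downstream Ω f, |ξ x| ≤ E ∧ ‖fderiv ℝ ξ x‖ ≤ E := by
    intro x hx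
    refine ⟨(hB _ (hWA x hx)).trans (le_max_left _ _), ?_⟩
    rw [(hξd x hx).fderiv, norm_smul, innerSL_apply_norm]
    refine (mul_le_mul (hB' _ (hWA x hx)) ((norm_sub_le _ _).trans
      (add_le_add (hcm x hx).le hvn.le)) (norm_nonneg _) ?_).trans (le_max_right _ _)
    exact (norm_nonneg _).trans (hB' _ (hWA x hx))
  have hinnerG : ∀ (p : Space) (n : Plane), inner ℝ (massFlux γ b p - massFlux γ b (v • axis))
      (embed n) = density γ b (‖p‖ ^ 2) * inner ℝ p (embed n) := by
    intro p n
    rw [massFlux_smul_axis hv0.le, inner_sub_left, massFlux, inner_smul_left, inner_smul_left,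
      axis_inner, embed_zero_coord]
    simp
  obtain ⟨B₂, hB₂⟩ := (isCompact_Icc (a := (0 : ℝ)) (b := criticalSpeed γ b))
    |>.exists_bound_of_continuousOn (f := fun s => density γ b (s ^ 2)) fun s hs =>
      (ContinuousAt.comp (f := fun s : ℝ => s ^ 2) (g := density γ b) (contDiffAt_density (n := 1)
        (bernoulliBase_pos_of_le h.one_le h.critical_pos hs.1 hs.2)).continuousAt
        (continuous_pow 2).continuousAt).continuousWithinAt
  have hfield : IsDuctField Ω f (fun _ => 1) (fun x => ξ x • G x) := by
    refine ⟨h.contDiffOn_front, contDiffOn_const, fun y hy => h.front_lt_one hy,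
      fun y hy => (h.neg_one_lt_front hy).le, fun y _ => le_rfl, ?_, ?_, ?_⟩
    · rw [← h.downstream_eq]
      intro x hx
      have h1 : ContDiffAt ℝ 1 (fun z => φ z - v * z 0) x :=
        ((h.contDiffAt (hdn hx)).of_le (by norm_num)).sub
          (contDiffAt_const.mul (EuclideanSpace.proj 0 : Space →L[ℝ] ℝ).contDiff.contDiffAt)
      have h2 : ContDiffAt ℝ 1 G x :=
        ((contDiffAt_massFlux (h.sol.density_pos x (hdn hx))).comp x
          (h.contDiffAt_gradient (hdn hx))).sub contDiffAt_const
      exact ((hθd.contDiffAt.comp x h1).smul h2).contDiffWithinAt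
    · rw [← h.downstream_eq]
      refine ⟨2 * (E * max (C + C) (C * M)), fun x hx => ?_⟩
      refine norm_smul_and_fderiv_le (hξd x hx).differentiableAt (hGd x hx).differentiableAt
        (hξb x hx).1 (hξb x hx).2 ?_ ?_
      · refine ((norm_sub_le _ _).trans (add_le_add (hC _ (hcm x hx).le).1 (hC _ ?_).1)).trans
          (le_max_left _ _)
        rw [hvn]; exact hvc.le
      · rw [(hGd x hx).fderiv]
        refine ((ContinuousLinearMap.opNorm_comp_le _ _).trans ?_).trans (le_max_right _ _)
        exact mul_le_mul (hC _ (hcm x hx).le).2 (hM x (hdn hx)) (norm_nonneg _)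
          ((norm_nonneg _).trans (hC _ (hcm x hx).le).2)
    · intro x hx n hn
      rw [← h.downstream_eq]
      have hslip : Tendsto (fun z => inner ℝ (gradient φ z) (embed n))
          (𝓝[downstream Ω f] x) (𝓝 0) :=
        (h.sol.slip x hx n hn).mono_left (nhdsWithin_mono x hdn)
      refine squeeze_zero_norm' (a := fun z => E * (B₂ *
        |inner ℝ (gradient φ z) (embed n)|)) ?_ ?_
      · filter_upwards [self_mem_nhdsWithin] with z hz
        rw [inner_smul_left, norm_mul]
        simp only [hG, hinnerG, norm_mul]
        refine mul_le_mul (by simpa using (hξb z hz).1) ?_ (by positivity)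
          ((abs_nonneg _).trans (hξb z hz).1)
        exact mul_le_mul_of_nonneg_right (hB₂ _ ⟨norm_nonneg _, (hcm z hz).le⟩) (norm_nonneg _)
      · have := ((hslip.abs).const_mul B₂).const_mul E
        rw [abs_zero, mul_zero, mul_zero] at this
        exact this
  have hdivV : ∀ x ∈ downstream Ω f, divergence (fun x => ξ x • G x) x =
      θ' (φ x - v * x 0) * inner ℝ (G x) (gradient φ x - v • axis) := by
    intro x hx
    rw [divergence_smul (hξd x hx) (hGd x hx).differentiableAt]
    have h0 : divergence G x = 0 := by
      have hF : DifferentiableAt ℝ (fun z => massFlux γ b (gradient φ z)) x :=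
        ((hasFDerivAt_massFlux (h.sol.density_pos x (hdn hx))).comp x
          (h.differentiableAt_gradient (hdn hx)).hasFDerivAt).differentiableAt
      rw [hG, divergence_sub hF (differentiableAt_const _), h.sol.equation x (hdn hx), divergence_const, sub_zero]
    rw [h0, mul_zero, zero_add, smul_apply, innerSL_apply_apply, smul_eq_mul, real_inner_comm]
  have hmono : ∀ x ∈ downstream Ω f, gradient φ x ≠ v • axis →
      0 < inner ℝ (G x) (gradient φ x - v • axis) := fun x hx hne =>
    massFlux_strictMono h.one_le h.critical_pos (hcm x hx) (hvn.trans_lt hvc) hne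
  have hzero := hfield.divergence_eq_zero h.crossSection (by
    rw [← h.downstream_eq]
    intro x hx
    rw [hdivV x hx]
    by_cases hne : gradient φ x = v • axis
    · simp [hne]
    · exact mul_nonneg (hθ0 _) (hmono x hx hne).le) (by
    intro y hy
    obtain ⟨w, hw, hwflux⟩ := h.exists_tendsto_gradient_front hy
    obtain ⟨P, hP, hPn⟩ := h.exists_tendsto_gradient_exit hy
    have hξt : ∀ (l : Filter ℝ) (t : ℝ), l ≤ 𝓝 t → (∀ᶠ s in l, lift s y ∈ downstream Ω f) →
        Tendsto (fun t => ξ (lift t y)) l (𝓝 (θ (Φ (lift t y) - v * t))) := by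
      intro l t hl hev
      have h1 : Continuous fun t => θ (Φ (lift t y) - v * t) :=
        hθd.continuous.comp ((hΦc.comp (continuous_lift.comp (Continuous.prodMk_left y))).sub
          (continuous_const.mul continuous_id))
      refine ((h1.tendsto t).mono_left hl).congr' ?_
      filter_upwards [hev] with s hs
      simp only [hξ, lift_zero, hΦ hs.1]
    have hGt : ∀ (l : Filter ℝ) (p : Space), Tendsto (fun t => gradient φ (lift t y)) l (𝓝 p) →
        ‖p‖ ≤ criticalSpeed γ b → Tendsto (fun t => G (lift t y)) l
          (𝓝 (massFlux γ b p - massFlux γ b (v • axis))) := fun l p hp hpn =>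
      ((hasFDerivAt_massFlux (bernoulliBase_pos_of_le h.one_le h.critical_pos (norm_nonneg p)
        hpn)).continuousAt.tendsto.comp hp).sub_const _
    have hev1 : ∀ᶠ t in 𝓝[>] (f y), lift t y ∈ downstream Ω f := by
      filter_upwards [Ioo_mem_nhdsGT (h.front_lt_one hy)] with t ht
      exact h.lift_mem_downstream hy ht
    have hev2 : ∀ᶠ t in 𝓝[<] (1 : ℝ), lift t y ∈ downstream Ω f := by
      filter_upwards [Ioo_mem_nhdsLT (h.front_lt_one hy)] with t ht
      exact h.lift_mem_downstream hy ht
    have hwc : ‖w‖ ≤ criticalSpeed γ b :=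
      le_of_tendsto (hw.comp (h.tendsto_lift_front_right hy)).norm
        (hev1.mono fun t ht => (hcm _ ht).le)
    refine ⟨_, _, (hξt _ _ nhdsWithin_le_nhds hev1).smul
      (hGt _ w (hw.comp (h.tendsto_lift_front_right hy)) hwc),
      (hξt _ _ nhdsWithin_le_nhds hev2).smul (hGt _ P (hP.comp (h.tendsto_lift_exit hy))
        (hPn.le.trans h.exit_lt.le)), ?_⟩
    have e2 := hexit y hy P hPn
    have e3 : ∀ z : Space, z 0 = 1 →
        inner ℝ (massFlux γ b (v • axis)) z = density γ b (v ^ 2) * v := by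
      intro z hz
      rw [massFlux_smul_axis hv0.le, inner_smul_left, axis_inner, hz]; simp
    have e4 : inner ℝ (massFlux γ b P) axis = density γ b (c₁ ^ 2) * P 0 := by
      rw [inner_axis, massFlux, hPn]; simp
    -- Through the front both mass fluxes carry `density γ b (u ^ 2) * u` per unit cross-section, so
    -- the front contributes nothing whatever its shape and `θ`; only the exit term remains.
    rw [inner_smul_left, inner_smul_left, frontNormal_const, inner_sub_left, inner_sub_left, hwflux,
      e3 _ axis_zero, e3 _ (frontNormal_zero f y), e4, hvu, sub_self, mul_zero, mul_one]
    rw [hvu] at e2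
    exact e2)
  rw [← h.downstream_eq] at hzero
  have h0 := hzero x hx
  rw [hdivV x hx] at h0
  by_cases hne : gradient φ x = v • axis
  · exact Or.inr hne
  · exact Or.inl ((mul_eq_zero.1 h0).resolve_right (hmono x hx hne).ne')

/-- If the exit speed is at most `v`, the flow is uniform behind the front. -/
theorem gradient_downstream_of_le {v : ℝ} (hv : IsDownstreamSpeed γ b u v) (hcv : c₁ ≤ v)
    {x : Space} (hx : x ∈ downstream Ω f) : gradient φ x = v • axis := by
  obtain ⟨Φ, ⟨K, hK⟩, hΦ⟩ := h.exists_extension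
  obtain ⟨A, hA⟩ := h.exists_bound_potential hK.continuous v
  -- The shift by the bound `A` makes the factor at the exit nonnegative. The excess flux there is
  -- nonpositive because `c₁ ≤ v` and the flux increases on subsonic speeds.
  refine (h.downstream_rigidity hv hK.continuous hΦ (θ := fun s => s + A) (θ' := fun _ => 1)
    (fun s => (hasDerivAt_id s).add_const A) continuous_const (fun _ => zero_le_one) ?_
    hx).resolve_left one_ne_zero
  intro y hy P hP
  have h1 := hA y (subset_closure hy) 1 (by simp)
  rw [mul_one] at h1
  have hc0 : 0 ≤ c₁ := hP ▸ norm_nonneg P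
  have hρ := density_pos_of_base (bernoulliBase_pos_of_le h.one_le h.critical_pos hc0 h.exit_lt.le)
  have h2 : P 0 ≤ c₁ := hP ▸ (le_abs_self _).trans (abs_zero_le_norm P)
  have h3 : density γ b (c₁ ^ 2) * c₁ ≤ density γ b (v ^ 2) * v :=
    (strictMonoOn_flux h.one_le h.critical_pos).monotoneOn ⟨hc0, h.exit_lt.le⟩
      ⟨hv.1.le, hv.2.1.le⟩ hcv
  refine mul_nonpos_of_nonneg_of_nonpos (by linarith [(abs_le.1 h1).1]) ?_
  nlinarith

/-- The excess potential is bounded below by its infimum over the exit. -/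
lemma le_excess_of_le_exit {v k : ℝ} (hv : IsDownstreamSpeed γ b u v) {Φ : Space → ℝ}
    (hΦc : Continuous Φ) (hΦ : EqOn φ Φ (duct Ω)) (hk : ∀ y ∈ Ω, k ≤ Φ (lift 1 y) - v)
    {x : Space} (hx : x ∈ downstream Ω f) : k ≤ φ x - v * x 0 := by
  -- This `θ` is nondecreasing, vanishes at values at least `k`, hence on the exit, and has positive
  -- derivative exactly below `k`.
  have key : ∀ x ∈ downstream Ω f, 2 * max (k - (φ x - v * x 0)) 0 = 0 ∨
      gradient φ x = v • axis := fun x hx =>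
    h.downstream_rigidity hv hΦc hΦ (θ := fun s => -posSq (k - s))
      (θ' := fun s => 2 * max (k - s) 0)
      (fun s => by
        have := ((hasDerivAt_posSq (k - s)).comp s ((hasDerivAt_id s).const_sub k)).neg
        rwa [mul_neg_one, neg_neg] at this)
      (by fun_prop) (fun s => by positivity)
      (fun y hy P _ => by
        have : posSq (k - (Φ (lift 1 y) - v)) = 0 := by
          rw [posSq, max_eq_right (by linarith [hk y hy])]; norm_num
        simp [this]) hx
  set y := cross x with hy
  have hx' := hx
  rw [h.downstream_eq] at hx'
  obtain ⟨hyΩ, hx1, hx2⟩ := hx'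
  -- Where the excess potential is below `k` its gradient vanishes, so the squared deficit is
  -- constant along the column; at the exit it is zero.
  have hd : ∀ t ∈ Ioo (f y) 1, HasDerivAt (fun t => posSq (k - (φ (lift t y) - v * t))) 0 t := by
    intro t ht
    have hm := h.lift_mem_downstream hyΩ ht
    have h1 : HasDerivAt (fun t => k - (φ (lift t y) - v * t))
        (-(gradient φ (lift t y) 0 - v)) t := by
      have := ((h.hasDerivAt_vertical (Or.inr hm)).sub
        ((hasDerivAt_id t).const_mul v)).const_sub k
      rwa [mul_one] at this
    have h2 := (hasDerivAt_posSq _).comp t h1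
    have h3 : 2 * max (k - (φ (lift t y) - v * t)) 0 * -(gradient φ (lift t y) 0 - v) = 0 := by
      rcases key _ hm with h0 | h0
      · rw [lift_zero] at h0; rw [h0, zero_mul]
      · have h0' : gradient φ (lift t y) = v • axis := h0
        simp [h0']
    rwa [h3] at h2
  have hlim : Tendsto (fun t => posSq (k - (φ (lift t y) - v * t))) (𝓝[<] 1)
      (𝓝 (posSq (k - (Φ (lift 1 y) - v * 1)))) := by
    have hc : Continuous fun t => posSq (k - (Φ (lift t y) - v * t)) :=
      contDiff_posSq.continuous.comp (continuous_const.sub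
        ((hΦc.comp (continuous_lift.comp (Continuous.prodMk_left y))).sub
          (continuous_const.mul continuous_id)))
    refine ((hc.tendsto 1).mono_left nhdsWithin_le_nhds).congr' ?_
    filter_upwards [Ioo_mem_nhdsLT (h.front_lt_one hyΩ)] with t ht
    rw [hΦ (h.lift_mem_downstream hyΩ ht).1]
  have h1 := eq_of_hasDerivAt_of_tendsto hd (Ioo_mem_nhdsLT (h.front_lt_one hyΩ))
    nhdsWithin_le_nhds hlim ⟨hx1, hx2⟩
  have h2 : posSq (k - (Φ (lift 1 y) - v * 1)) = 0 := by
    rw [posSq, max_eq_right (by linarith [hk y hyΩ])]; norm_num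
  rw [h2, hy, lift_cross, zero_mul, add_zero, posSq, sq_eq_zero_iff] at h1
  have := (le_max_left (k - (φ x - v * x 0)) 0).trans_eq h1
  linarith

end IsFlow

/-! ### Cones of directions pointing into the cross-section -/

/-- The truncated cone with apex `0` spanned by the ball of radius `η` around `d`. -/
def coneBall (d : Plane) (η σ : ℝ) : Set Plane := {z | ∃ s ∈ Ioo 0 σ, ‖z - s • d‖ < s * η}

lemma convex_coneBall (d : Plane) (η σ : ℝ) : Convex ℝ (coneBall d η σ) := by
  rintro x ⟨s, hs, hx⟩ y ⟨t, ht, hy⟩ a b ha hb hab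
  refine ⟨a * s + b * t, (convex_Ioo 0 σ) hs ht ha hb hab, ?_⟩
  have e : a • x + b • y - (a * s + b * t) • d = a • (x - s • d) + b • (y - t • d) := by
    simp only [smul_sub, add_smul, mul_smul]; abel
  rw [e]
  refine (norm_add_le _ _).trans_lt ?_
  rw [norm_smul, norm_smul, Real.norm_of_nonneg ha, Real.norm_of_nonneg hb]
  rcases ha.eq_or_lt with h | h
  · have : b = 1 := by linarith
    subst this; subst h; simpa using hy
  · have h1 := mul_lt_mul_of_pos_left hx h
    have h2 := mul_le_mul_of_nonneg_left hy.le hb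
    linarith

lemma isOpen_coneBall (d : Plane) (η σ : ℝ) : IsOpen (coneBall d η σ) := by
  have : coneBall d η σ = ⋃ s ∈ Ioo 0 σ, {z | ‖z - s • d‖ < s * η} := by
    ext z; simp [coneBall]
  rw [this]
  exact isOpen_biUnion fun s _ => isOpen_lt (by fun_prop) continuous_const

lemma smul_mem_coneBall {d e : Plane} {η σ s : ℝ} (hs : s ∈ Ioo 0 σ) (he : ‖e - d‖ < η) :
    s • e ∈ coneBall d η σ := by
  refine ⟨s, hs, ?_⟩
  rw [← smul_sub, norm_smul, Real.norm_of_nonneg hs.1.le]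
  exact mul_lt_mul_of_pos_left he hs.1

/-- A cross-section contains a truncated cone at each point of its closure; at a boundary point
its axis can be chosen to be the inward normal. -/
lemma IsCrossSection.exists_cone {Ω : Set Plane} (hΩ : IsCrossSection Ω) {p : Plane}
    (hp : p ∈ closure Ω) : ∃ (d : Plane) (η σ : ℝ), 0 < η ∧ 0 < σ ∧
      (∀ z ∈ coneBall d η σ, p + z ∈ Ω) ∧
      (d = 0 ∨ p ∈ frontier Ω ∧ IsOutwardUnitNormal Ω p (-d)) := by
  by_cases hpΩ : p ∈ Ω
  · obtain ⟨r, hr, hball⟩ := Metric.isOpen_iff.1 hΩ.isOpen p hpΩ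
    refine ⟨0, r, 1, hr, one_pos, ?_, Or.inl rfl⟩
    rintro z ⟨s, hs, hz⟩
    refine hball ?_
    rw [smul_zero, sub_zero] at hz
    rw [Metric.mem_ball, dist_eq_norm, add_sub_cancel_left]
    nlinarith [hs.2, hs.1]
  · have hfr : p ∈ frontier Ω := by rw [hΩ.isOpen.frontier_eq]; exact ⟨hp, hpΩ⟩
    obtain ⟨g, hg⟩ := hΩ.boundary p hfr
    have hg' := hg
    obtain ⟨hne, U, hU, hgU, hgΩ⟩ := hg
    have hpU := mem_of_mem_nhds hU
    set N := gradient g p with hN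
    have hN0 : 0 < ‖N‖ := norm_pos_iff.2 hne
    set n := ‖N‖⁻¹ • N with hn
    have hn1 : ‖n‖ = 1 := by rw [hn, norm_smul, norm_inv, norm_norm, inv_mul_cancel₀ hN0.ne']
    have hNn : inner ℝ N n = ‖N‖ := by
      rw [hn, inner_smul_right, real_inner_self_eq_norm_sq]; field_simp
    have hdiff : DifferentiableAt ℝ g p :=
      (hgU.contDiffAt hU).differentiableAt (by norm_num)
    have hgp : g p ≤ 0 := by
      by_contra! hpos
      have hc : ContinuousAt g p := hdiff.continuousAt
      obtain ⟨z, hz, hzΩ⟩ := mem_closure_iff_nhds.1 hp _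
        (inter_mem hU (hc.eventually_const_lt hpos))
      exact absurd ((hgΩ z hz.1).1 hzΩ) (not_lt.2 (le_of_lt hz.2))
    -- With error constant `‖N‖ / 8` and `‖z‖ ≤ 3 / 2 * s`, the error is at most (3/16) s‖N‖, while
    -- the linear part is at most -s‖N‖/2, so `g` is negative on the cone.
    have hex : ∀ᶠ y in 𝓝 p, |g y - g p - inner ℝ N (y - p)| ≤ ‖N‖ / 8 * ‖y - p‖ := by
      have := hdiff.hasFDerivAt.isLittleO.def (c := ‖N‖ / 8) (by positivity)
      filter_upwards [this] with y hy
      rwa [← inner_gradient_left, Real.norm_eq_abs] at hy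
    obtain ⟨r, hr, hball⟩ := Metric.eventually_nhds_iff_ball.1 (hex.and hU)
    refine ⟨-n, 1 / 2, r / 2, by norm_num, by positivity, ?_, Or.inr ⟨hfr, g, hg', neg_neg n⟩⟩
    rintro z ⟨s, hs, hz⟩
    have hzn : ‖z‖ ≤ 3 / 2 * s := by
      have e : z = (z - s • -n) + s • -n := by abel
      rw [e]
      refine (norm_add_le _ _).trans ?_
      rw [norm_smul, norm_neg, hn1, Real.norm_of_nonneg hs.1.le]
      linarith
    have hzb : p + z ∈ Metric.ball p r := by
      rw [Metric.mem_ball, dist_eq_norm, add_sub_cancel_left]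
      linarith [hs.2]
    obtain ⟨h1, h2⟩ := hball _ hzb
    rw [hgΩ _ h2]
    rw [add_sub_cancel_left] at h1
    have h3 : inner ℝ N z ≤ -(s * ‖N‖) + ‖N‖ * (s * (1 / 2)) := by
      have e : inner ℝ N z = inner ℝ N (z - s • -n) + -(s * ‖N‖) := by
        rw [inner_sub_right, inner_smul_right, inner_neg_right, hNn]; ring
      rw [e]
      have := (real_inner_le_norm N (z - s • -n)).trans
        (mul_le_mul_of_nonneg_left hz.le hN0.le)
      linarith
    have h4 := (abs_le.1 h1).2
    have h5 := mul_le_mul_of_nonneg_left hzn (by positivity : 0 ≤ ‖N‖ / 8)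
    have h6 := mul_pos hs.1 hN0
    nlinarith

/-- A vector orthogonal to `d` whose cross-sectional pairings with all directions near `d` are
bounded below in this way is axial. -/
lemma eq_axis_of_cone {P : Space} {v η : ℝ} {d : Plane} (hη : 0 < η)
    (hPd : inner ℝ (cross P) d = 0)
    (hle : ∀ α > 0, ∀ e : Plane, ‖e - d‖ < η → 0 ≤ α * (v - P 0) + inner ℝ (cross P) e) :
    P 0 ≤ v ∧ P = P 0 • axis := by
  have h0 : P 0 ≤ v := by
    have := hle 1 one_pos d (by simpa using hη)
    rw [hPd] at this; linarith
  refine ⟨h0, ?_⟩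
  have hcross : cross P = 0 := by
    by_contra hne
    have hpos : 0 < ‖cross P‖ := norm_pos_iff.2 hne
    -- Tilting `d` against `cross P` by this amount stays within `η`; as `α` tends to zero the
    -- inequality would give 0 ≤ -s |cross P|².
    set s := η / (2 * ‖cross P‖) with hs
    have hs0 : 0 < s := by positivity
    have hn : ‖(d - s • cross P) - d‖ < η := by
      rw [sub_sub_cancel_left, norm_neg, norm_smul, Real.norm_of_nonneg hs0.le, hs]
      have : η / (2 * ‖cross P‖) * ‖cross P‖ = η / 2 := by field_simp
      rw [this]; linarith
    have hlim : Tendsto (fun α : ℝ => α * (v - P 0) + inner ℝ (cross P) (d - s • cross P))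
        (𝓝[>] 0) (𝓝 (0 * (v - P 0) + inner ℝ (cross P) (d - s • cross P))) := by
      have : Continuous fun α : ℝ => α * (v - P 0) + inner ℝ (cross P) (d - s • cross P) := by
        fun_prop
      exact (this.tendsto 0).mono_left nhdsWithin_le_nhds
    have := ge_of_tendsto hlim (by
      filter_upwards [self_mem_nhdsWithin] with α hα using hle α hα _ hn)
    rw [zero_mul, zero_add, inner_sub_right, hPd, inner_smul_right,
      real_inner_self_eq_norm_sq] at this
    have := mul_pos hs0 (pow_pos hpos 2)
    linarith
  exact space_ext (by simp) (by simp [hcross, cross_smul])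

/-! ### The exit speed is at most the normal shock speed -/

namespace IsFlow

variable {γ b u c₁ : ℝ} {Ω : Set Plane} {f : Plane → ℝ} {φ : Space → ℝ}
  (h : IsFlow γ b u c₁ Ω f φ)
include h

lemma tendsto_extension_front {Φ : Space → ℝ} (hΦc : Continuous Φ) (hΦ : EqOn φ Φ (duct Ω))
    {y : Plane} (hy : y ∈ Ω) : Φ (lift (f y) y) = u * f y := by
  have h1 : Tendsto (fun t => Φ (lift t y)) (𝓝[<] (f y)) (𝓝 (Φ (lift (f y) y))) :=
    (hΦc.tendsto _).comp ((h.tendsto_lift_front_left hy).mono_right nhdsWithin_le_nhds)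
  have h2 : Tendsto (fun t => u * t) (𝓝[<] (f y)) (𝓝 (u * f y)) :=
    ((continuous_const.mul continuous_id).tendsto _).mono_left nhdsWithin_le_nhds
  refine tendsto_nhds_unique h1 (h2.congr' ?_)
  filter_upwards [Ioo_mem_nhdsLT (h.neg_one_lt_front hy)] with t ht
  have hm := h.lift_mem_upstream hy ht
  rw [← hΦ hm.1, h.potential_upstream hm, lift_zero]

lemma front_le_one {p : Plane} (hp : p ∈ closure Ω) : f p ≤ 1 := by
  have hne : (𝓝[Ω] p).NeBot := mem_closure_iff_nhdsWithin_neBot.1 hp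
  exact le_of_tendsto ((h.sol.front_contDiff.continuousOn p hp).mono subset_closure)
    (by filter_upwards [self_mem_nhdsWithin] with y hy using (h.front_lt_one hy).le)

/-- The front does not reach the exit at a minimum point of the potential on the exit. -/
lemma front_lt_one_of_le_excess {v k : ℝ} (hvu : v < u) {Φ : Space → ℝ} (hΦc : Continuous Φ)
    (hΦ : EqOn φ Φ (duct Ω)) {p : Plane} (hp : p ∈ closure Ω) (hkp : Φ (lift 1 p) - v = k)
    (hk : ∀ x ∈ downstream Ω f, k ≤ φ x - v * x 0) : f p < 1 := by
  refine lt_of_le_of_ne (h.front_le_one hp) fun hf => ?_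
  have hne : (𝓝[Ω] p).NeBot := mem_closure_iff_nhdsWithin_neBot.1 hp
  have hft : Tendsto f (𝓝[Ω] p) (𝓝 1) := by
    have := (h.sol.front_contDiff.continuousOn p hp).mono subset_closure
    rw [ContinuousWithinAt, hf] at this
    exact this
  -- If the front reached the exit at `p`, the minimum `k` would be `u - v`; but over a point `y` of
  -- `Ω` the excess on the front is `(u - v) * f y`, which is smaller.
  have hΦp : Φ (lift 1 p) = u := by
    have h1 : Tendsto (fun y => Φ (lift (f y) y)) (𝓝[Ω] p) (𝓝 (Φ (lift 1 p))) :=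
      ((hΦc.comp continuous_lift).tendsto (1, p)).comp
        (hft.prodMk_nhds (tendsto_id.mono_left nhdsWithin_le_nhds))
    have h2 : Tendsto (fun y => u * f y) (𝓝[Ω] p) (𝓝 (u * 1)) := hft.const_mul u
    rw [mul_one] at h2
    refine tendsto_nhds_unique h1 (h2.congr' ?_)
    filter_upwards [self_mem_nhdsWithin] with y hy
    exact (h.tendsto_extension_front hΦc hΦ hy).symm
  obtain ⟨y, hy⟩ := h.crossSection.isConnected.nonempty
  have h3 : k ≤ u * f y - v * f y := by
    have h1 : Tendsto (fun t => Φ (lift t y) - v * t) (𝓝[>] (f y))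
        (𝓝 (Φ (lift (f y) y) - v * f y)) := by
      have hc : Continuous fun t => Φ (lift t y) - v * t :=
        (hΦc.comp (continuous_lift.comp (Continuous.prodMk_left y))).sub
          (continuous_const.mul continuous_id)
      exact (hc.tendsto _).mono_left nhdsWithin_le_nhds
    rw [h.tendsto_extension_front hΦc hΦ hy] at h1
    refine ge_of_tendsto h1 ?_
    filter_upwards [Ioo_mem_nhdsGT (h.front_lt_one hy)] with t ht
    have hm := h.lift_mem_downstream hy ht
    have := hk _ hm
    rwa [hΦ hm.1, lift_zero] at this
  have := h.front_lt_one hy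
  nlinarith

/-- At a minimum point of the potential on the exit, the velocity is axial and at most `v`. -/
lemma exit_speed_le_of_le_excess {v k : ℝ} (hH : NoBackflow Ω f φ) {Φ : Space → ℝ}
    (hΦc : Continuous Φ) (hΦ : EqOn φ Φ (duct Ω)) {p : Plane} (hp : p ∈ closure Ω)
    (hkp : Φ (lift 1 p) - v = k) (hk : ∀ x ∈ downstream Ω f, k ≤ φ x - v * x 0)
    (hfp : f p < 1) : c₁ ≤ v := by
  obtain ⟨d, η, σ₀, hη, hσ₀, hcone, hd⟩ := h.crossSection.exists_cone hp
  -- a small cone behind the front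
  obtain ⟨σ, hσ, hσle, hσ2⟩ : ∃ σ > 0, σ ≤ σ₀ ∧ ∀ z ∈ coneBall d η σ, f (p + z) < 1 - σ := by
    obtain ⟨m, hm1, hm2⟩ := exists_between hfp
    have hft : ∀ᶠ y in 𝓝[Ω] p, f y < m :=
      ((h.sol.front_contDiff.continuousOn p hp).mono subset_closure).eventually_lt_const hm1
    obtain ⟨r, hr, hball⟩ := Metric.mem_nhdsWithin_iff.1 hft
    refine ⟨min σ₀ (min (1 - m) (r / (‖d‖ + η + 1))), lt_min hσ₀ (lt_min (by linarith)
      (by positivity)), min_le_left _ _, ?_⟩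
    rintro z ⟨s, hs, hz⟩
    have hzΩ : p + z ∈ Ω := hcone z ⟨s, ⟨hs.1, hs.2.trans_le (min_le_left _ _)⟩, hz⟩
    have hzn : ‖z‖ < r := by
      have e : z = (z - s • d) + s • d := by abel
      have h1 : ‖z‖ ≤ s * η + s * ‖d‖ := by
        rw [e]
        refine (norm_add_le _ _).trans ?_
        rw [norm_smul, Real.norm_of_nonneg hs.1.le]
        linarith
      have h2 := hs.2.trans_le ((min_le_right _ _).trans (min_le_right _ _))
      rw [lt_div_iff₀ (by positivity)] at h2
      linarith [hs.1]
    have h3 : f (p + z) < m := hball ⟨by simpa [dist_eq_norm] using hzn, hzΩ⟩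
    have h4 := (min_le_right σ₀ (min (1 - m) (r / (‖d‖ + η + 1)))).trans (min_le_left _ _)
    linarith
  set x₀ : Space := lift 1 p with hx₀
  set S : Set Space := {x | x 0 ∈ Ioo (1 - σ) 1 ∧ cross x - p ∈ coneBall d η σ} with hS
  have hSmem : ∀ t ∈ Ioo (1 - σ) 1, ∀ z ∈ coneBall d η σ, lift t (p + z) ∈ S := fun t ht z hz =>
    ⟨by simpa using ht, by simpa using hz⟩
  have hmono : coneBall d η σ ⊆ coneBall d η σ₀ := fun z ⟨s, hs, hz⟩ =>
    ⟨s, ⟨hs.1, hs.2.trans_le hσle⟩, hz⟩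
  have hSdn : S ⊆ downstream Ω f := by
    rintro x ⟨hx, hxc⟩
    rw [h.downstream_eq]
    have h1 := hcone _ (hmono hxc)
    have h2 := hσ2 _ hxc
    rw [add_sub_cancel] at h1 h2
    exact ⟨h1, h2.trans hx.1, hx.2⟩
  have hSsm : S ⊆ smoothRegion Ω f := hSdn.trans subset_union_right
  have hSo : IsOpen S := (isOpen_Ioo.preimage (continuous_coord 0)).inter
    ((isOpen_coneBall d η σ).preimage (continuous_cross.sub continuous_const))
  have hSc : Convex ℝ S := by
    refine ((convex_Ioo (1 - σ) 1).linear_preimage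
      (EuclideanSpace.proj 0 : Space →L[ℝ] ℝ).toLinearMap).inter ?_
    have e : {x : Space | cross x - p ∈ coneBall d η σ} =
        crossL ⁻¹' ((fun z => p + z) '' coneBall d η σ) := by
      ext x
      constructor
      · intro hx; exact ⟨_, hx, add_sub_cancel p (cross x)⟩
      · rintro ⟨z, hz, hzx⟩
        change cross x - p ∈ coneBall d η σ
        rw [show cross x = p + z from hzx.symm, add_sub_cancel_left]; exact hz
    change Convex ℝ {x : Space | cross x - p ∈ coneBall d η σ}
    rw [e]
    exact ((convex_coneBall d η σ).translate p).linear_preimage crossL.toLinearMap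
  obtain ⟨P, hP⟩ := h.exists_tendsto_gradient hSc hSsm x₀
  -- points of the cone
  have hmem : ∀ α : ℝ, 0 < α → ∀ e : Plane, ‖e - d‖ < η → ∀ᶠ s in 𝓝[>] (0 : ℝ),
      x₀ + s • (-(α • axis) + embed e) ∈ S := by
    intro α hα e he
    filter_upwards [Ioo_mem_nhdsGT hσ, Ioo_mem_nhdsGT (div_pos hσ hα)] with s hs1 hs2
    have h3 := (lt_div_iff₀ hα).1 hs2.2
    have h4 := mul_pos hs2.1 hα
    refine ⟨⟨?_, ?_⟩, ?_⟩
    · simp [hx₀]; linarith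
    · simp [hx₀]; linarith
    · have := smul_mem_coneBall hs1 he
      simpa [hx₀, cross_add, cross_smul, cross_neg] using this
  have hx₀S : x₀ ∈ closure S := by
    have ht : Tendsto (fun s : ℝ => x₀ + s • (-((1 : ℝ) • axis) + embed d)) (𝓝[>] 0) (𝓝 x₀) := by
      have : Continuous fun s : ℝ => x₀ + s • (-((1 : ℝ) • axis) + embed d) := by fun_prop
      simpa using (this.tendsto 0).mono_left nhdsWithin_le_nhds
    exact mem_closure_of_tendsto ht (hmem 1 one_pos d (by simpa using hη))
  have hneS : (𝓝[S] x₀).NeBot := mem_closure_iff_nhdsWithin_neBot.1 hx₀S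
  -- first order condition at the minimum
  set W : Space → ℝ := fun x => Φ x - v * x 0 with hW
  have hWc : Continuous W := hΦc.sub (continuous_const.mul (continuous_coord 0))
  have hWd : ∀ x ∈ S, HasFDerivAt W (innerSL ℝ (gradient φ x - v • axis)) x := fun x hx =>
    (h.hasFDerivAt_excess (hSsm hx)).congr_of_eventuallyEq (by
      filter_upwards [h.eventuallyEq_extension hΦ (hSdn hx).1] with z hz
      rw [hW, hz])
  have hWx₀ : HasFDerivWithinAt W (innerSL ℝ (P - v • axis)) (closure S) x₀ := by
    refine hasFDerivWithinAt_closure_of_tendsto_fderiv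
      (fun x hx => (hWd x hx).differentiableAt.differentiableWithinAt) hSc hSo
      (fun _ _ => hWc.continuousAt.continuousWithinAt) ?_
    refine (((innerSL ℝ (E := Space)).continuous.tendsto _).comp
      (hP.sub_const (v • axis))).congr' ?_
    filter_upwards [self_mem_nhdsWithin] with z hz
    exact (hWd z hz).fderiv.symm
  have hWmin : IsLocalMinOn W (closure S) x₀ := by
    refine eventually_nhdsWithin_of_forall fun x hx => ?_
    have hWx₀k : W x₀ = k := by simp [hW, hx₀, ← hkp]
    change W x₀ ≤ W x
    rw [hWx₀k]
    refine closure_minimal (s := S) (t := {x | k ≤ W x}) ?_ (isClosed_le continuous_const hWc) hx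
    intro z hz
    have := hk z (hSdn hz)
    rwa [hΦ (hSdn hz).1] at this
  have hle : ∀ α > 0, ∀ e : Plane, ‖e - d‖ < η → 0 ≤ α * (v - P 0) + inner ℝ (cross P) e := by
    intro α hα e he
    obtain ⟨s, hs, hs0⟩ := ((hmem α hα e he).and self_mem_nhdsWithin).exists
    have hcone' : s • (-(α • axis) + embed e) ∈ posTangentConeAt (closure S) x₀ :=
      mem_posTangentConeAt_of_segment_subset
        (hSc.closure.segment_subset hx₀S (subset_closure hs))
    have h1 := hWmin.hasFDerivWithinAt_nonneg hWx₀ hcone'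
    rw [map_smul, smul_eq_mul, innerSL_apply_apply, inner_add_right, inner_neg_right,
      inner_smul_right, inner_axis, inner_embed, cross_sub, cross_smul, cross_axis, smul_zero,
      sub_zero, PiLp.sub_apply, PiLp.smul_apply, axis_zero, smul_eq_mul, mul_one] at h1
    have h2 := nonneg_of_mul_nonneg_right h1 hs0
    linarith
  -- The axis `d` is zero or the inward normal; in the latter case the slip condition applies at the
  -- edge of the exit.
  have hPd : inner ℝ (cross P) d = 0 := by
    rcases hd with rfl | ⟨hfr, hn⟩
    · simp
    have hslip : Tendsto (fun z => inner ℝ (gradient φ z) (embed (-d))) (𝓝[S] x₀) (𝓝 0) :=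
      (h.sol.slip x₀ ⟨by simp [hx₀], by simpa [hx₀] using hfr⟩ (-d)
        (by simpa [hx₀] using hn)).mono_left (nhdsWithin_mono _ hSsm)
    have h1 := tendsto_nhds_unique (hP.inner (tendsto_const_nhds (x := embed (-d)))) hslip
    rw [inner_embed, inner_neg_right] at h1
    linarith
  obtain ⟨hPv, hPax⟩ := eq_axis_of_cone hη hPd hle
  -- the limit has speed `c₁` and no backflow
  have hclosed : ∀ ε > 0, |‖P‖ - c₁| ≤ ε ∧ -ε ≤ P 0 := by
    intro ε hε
    have hA : IsClosed {w : Space | |‖w‖ - c₁| ≤ ε ∧ -ε ≤ w 0} :=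
      (isClosed_le (continuous_norm.sub continuous_const).abs continuous_const).inter
        (isClosed_le continuous_const (continuous_coord 0))
    have hcl : x₀ ∈ closure {x | (|‖gradient φ x‖ - c₁| ≤ ε ∧ -ε ≤ gradient φ x 0) ∧ x ∈ S} := by
      -- The exit conditions are given over `Ω` only, while `p` may lie on its boundary. They are
      -- transferred through exit points along the axis of the cone, each approached from inside
      -- `S`; hence the closure of a closure.
      have ht : Tendsto (fun s : ℝ => lift 1 (p + s • d)) (𝓝[>] 0) (𝓝 x₀) := by
        have : Continuous fun s : ℝ => lift 1 (p + s • d) :=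
          continuous_lift.comp (by fun_prop : Continuous fun s : ℝ => ((1 : ℝ), p + s • d))
        simpa [hx₀] using (this.tendsto 0).mono_left nhdsWithin_le_nhds
      rw [← closure_closure]
      refine mem_closure_of_tendsto ht ?_
      filter_upwards [Ioo_mem_nhdsGT hσ] with s hs
      have hz := smul_mem_coneBall hs (show ‖d - d‖ < η by simpa using hη)
      have hy : p + s • d ∈ Ω := hcone _ (hmono hz)
      obtain ⟨a, ha0, ha⟩ := hH (lift 1 (p + s • d)) (Or.inr ⟨by simp, by simpa using hy⟩)
      obtain ⟨Q, hQ, hQn⟩ := h.exists_tendsto_gradient_exit hy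
      have hcol := h.tendsto_lift_exit hy
      have e1 := (hQ.comp hcol).norm
      rw [hQn] at e1
      have e2 : Tendsto (fun t => gradient φ (lift t (p + s • d)) 0) (𝓝[<] 1) (𝓝 a) :=
        ha.comp hcol
      have e3 := ((e1.sub_const c₁).abs).eventually_lt_const (u := ε) (by simpa using hε)
      have e4 := e2.eventually_const_lt (u := -ε) (by linarith)
      refine mem_closure_of_tendsto (hcol.mono_right nhdsWithin_le_nhds) ?_
      filter_upwards [e3, e4, Ioo_mem_nhdsLT (show 1 - σ < 1 by linarith)] with t h3 h4 ht
      exact ⟨⟨le_of_lt h3, h4.le⟩, hSmem t ht _ hz⟩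
    have hfreq : ∃ᶠ x in 𝓝[S] x₀, gradient φ x ∈ {w : Space | |‖w‖ - c₁| ≤ ε ∧ -ε ≤ w 0} := by
      rw [frequently_nhdsWithin_iff]
      exact mem_closure_iff_frequently.1 hcl
    exact hA.mem_of_frequently_of_tendsto hfreq hP
  have hPn : ‖P‖ = c₁ := by
    have := le_of_forall_pos_le_add (a := |‖P‖ - c₁|) (b := 0) fun ε hε => by
      simpa using (hclosed ε hε).1
    exact sub_eq_zero.1 (abs_nonpos_iff.1 this)
  have hP0 : 0 ≤ P 0 := by
    have := le_of_forall_pos_le_add (a := 0) (b := P 0) fun ε hε => by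
      linarith [(hclosed ε hε).2]
    exact this
  rw [← hPn, hPax, norm_smul_axis hP0]
  exact hPv

/-- The exit speed is at most the speed behind a normal shock. -/
theorem exit_speed_le {v : ℝ} (hv : IsDownstreamSpeed γ b u v) (hH : NoBackflow Ω f φ) :
    c₁ ≤ v := by
  obtain ⟨Φ, ⟨K, hK⟩, hΦ⟩ := h.exists_extension
  have hΦc := hK.continuous
  -- The minimum is taken over the closed cross-section and may lie on its boundary, which is why
  -- cones and the slip condition are needed.
  obtain ⟨p, hp, hmin⟩ := h.crossSection.isBounded.isCompact_closure.exists_isMinOn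
    (h.crossSection.isConnected.nonempty.mono subset_closure)
    (hΦc.comp (continuous_lift.comp (Continuous.prodMk_right (1 : ℝ)))).continuousOn
  have hk : ∀ x ∈ downstream Ω f, Φ (lift 1 p) - v ≤ φ x - v * x 0 := fun x hx =>
    h.le_excess_of_le_exit hv hΦc hΦ
      (fun y hy => sub_le_sub_right (isMinOn_iff.1 hmin y (subset_closure hy)) v) hx
  exact h.exit_speed_le_of_le_excess hH hΦc hΦ hp rfl hk
    (h.front_lt_one_of_le_excess (hv.2.1.trans h.critical_lt) hΦc hΦ hp rfl hk)

end IsFlow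

/-! ### Flatness of the front and form of the solution -/

namespace IsFlow

variable {γ b u c₁ : ℝ} {Ω : Set Plane} {f : Plane → ℝ} {φ : Space → ℝ}
  (h : IsFlow γ b u c₁ Ω f φ)
include h

theorem exit_speed_eq {v : ℝ} (hv : IsDownstreamSpeed γ b u v) (hH : NoBackflow Ω f φ) :
    c₁ = v := by
  obtain ⟨y, hy⟩ := h.crossSection.isConnected.nonempty
  obtain ⟨P, hP, hPn⟩ := h.exists_tendsto_gradient_exit hy
  have : P = v • axis := by
    refine tendsto_nhds_unique (hP.comp (h.tendsto_lift_exit hy)) (tendsto_const_nhds.congr' ?_)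
    filter_upwards [Ioo_mem_nhdsLT (h.front_lt_one hy)] with t ht
    exact (h.gradient_downstream_of_le hv (h.exit_speed_le hv hH)
      (h.lift_mem_downstream hy ht)).symm
  rw [← hPn, this, norm_smul_axis hv.1.le]

/-- If the flow is uniform behind the front, the excess potential is the height of the front. -/
lemma potential_downstream {v : ℝ} (hg : ∀ x ∈ downstream Ω f, gradient φ x = v • axis)
    {x : Space} (hx : x ∈ downstream Ω f) : φ x = v * x 0 + (u - v) * f (cross x) := by
  obtain ⟨Φ, ⟨K, hK⟩, hΦ⟩ := h.exists_extension
  have hx' := hx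
  rw [h.downstream_eq] at hx'
  obtain ⟨hy, hx1, hx2⟩ := hx'
  have hd : ∀ t ∈ Ioo (f (cross x)) 1, HasDerivAt (fun t => φ (lift t (cross x))) v t := by
    intro t ht
    have hm := h.lift_mem_downstream hy ht
    have := h.hasDerivAt_vertical (Or.inr hm)
    rw [hg _ hm] at this
    simpa using this
  have hlim : Tendsto (fun t => φ (lift t (cross x))) (𝓝[>] (f (cross x)))
      (𝓝 (u * f (cross x))) := by
    rw [← h.tendsto_extension_front hK.continuous hΦ hy]
    refine ((hK.continuous.tendsto _).comp
      ((h.tendsto_lift_front_right hy).mono_right nhdsWithin_le_nhds)).congr' ?_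
    filter_upwards [Ioo_mem_nhdsGT (h.front_lt_one hy)] with t ht
    exact (hΦ (h.lift_mem_downstream hy ht).1).symm
  have := eq_of_hasDerivAt_of_tendsto hd (Ioo_mem_nhdsGT (h.front_lt_one hy))
    nhdsWithin_le_nhds hlim ⟨hx1, hx2⟩
  rw [lift_cross] at this
  rw [this]; ring

/-- If the flow is uniform behind the front, the front is flat. -/
lemma exists_front_eq {v : ℝ} (hvu : v < u)
    (hg : ∀ x ∈ downstream Ω f, gradient φ x = v • axis) :
    ∃ t, ∀ y ∈ closure Ω, f y = t := by
  have hd : ∀ y ∈ Ω, HasFDerivAt f (0 : Plane →L[ℝ] ℝ) y := by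
    intro y hy
    obtain ⟨t, ht⟩ := exists_between (h.front_lt_one hy)
    have hm := h.lift_mem_downstream hy ht
    have h1 : HasFDerivAt (fun y => lift t y) embed y := by
      simp only [lift_eq]
      exact embed.hasFDerivAt.const_add _
    -- At a fixed height behind the front, `f` locally equals the excess potential divided by `u -
    -- v`, whose gradient is zero.
    have h2 := ((h.hasFDerivAt_excess (v := v) (Or.inr hm)).comp y h1).const_mul (u - v)⁻¹
    rw [hg _ hm, sub_self, map_zero, ContinuousLinearMap.zero_comp, smul_zero] at h2
    refine h2.congr_of_eventuallyEq ?_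
    filter_upwards [h1.continuousAt.eventually (h.isOpen_downstream.mem_nhds hm)] with z hz
    have := h.potential_downstream hg hz
    have hne : u - v ≠ 0 := by linarith
    simp only [Function.comp_apply, this, cross_lift]
    field_simp
    ring
  obtain ⟨t, ht⟩ := h.crossSection.isOpen.exists_is_const_of_fderiv_eq_zero
    h.crossSection.isConnected.isPreconnected
    (fun y hy => (hd y hy).differentiableAt.differentiableWithinAt) fun y hy => (hd y hy).fderiv
  exact ⟨t, EqOn.of_subset_closure ht h.sol.front_contDiff.continuousOn continuousOn_const
    subset_closure subset_rfl⟩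

theorem eq_flatShock {v : ℝ} (hv : IsDownstreamSpeed γ b u v) (hH : NoBackflow Ω f φ) :
    ∃ t ∈ Ioo (-1 : ℝ) 1, (∀ y ∈ closure Ω, f y = t) ∧
      ∀ x ∈ duct Ω, φ x = flatShock u v t x := by
  have hg : ∀ x ∈ downstream Ω f, gradient φ x = v • axis := fun x hx =>
    h.gradient_downstream_of_le hv (h.exit_speed_le hv hH) hx
  obtain ⟨t, ht⟩ := h.exists_front_eq (hv.2.1.trans h.critical_lt) hg
  obtain ⟨y, hy⟩ := h.crossSection.isConnected.nonempty
  have hty := ht y (subset_closure hy)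
  refine ⟨t, ⟨hty ▸ h.neg_one_lt_front hy, hty ▸ h.front_lt_one hy⟩, ht, fun x hx => ?_⟩
  have hfx := ht (cross x) (subset_closure hx.2)
  unfold flatShock
  rcases lt_trichotomy (x 0) t with hlt | heq | hgt
  · rw [if_pos hlt, h.potential_upstream ⟨hx, by rwa [hfx]⟩]
  -- On the front the value is determined by continuity from the upstream side.
  · obtain ⟨Φ, ⟨K, hK⟩, hΦ⟩ := h.exists_extension
    have h1 := h.tendsto_extension_front hK.continuous hΦ hx.2
    rw [hfx, ← heq, lift_cross, ← hΦ hx] at h1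
    rw [if_neg heq.not_lt, h1, heq]; ring
  · rw [if_neg hgt.not_gt, h.potential_downstream hg ⟨hx, by rwa [hfx]⟩, hfx]; ring

end IsFlow

/-! ### Flat fronts -/

section FlatShock

variable {u v t : ℝ}

lemma flatShock_eventuallyEq_of_lt {x : Space} (hx : x 0 < t) :
    flatShock u v t =ᶠ[𝓝 x] fun z => u * z 0 := by
  filter_upwards [(continuous_coord 0).continuousAt.eventually_lt_const hx] with z hz
  exact if_pos hz

lemma flatShock_eventuallyEq_of_gt {x : Space} (hx : t < x 0) :
    flatShock u v t =ᶠ[𝓝 x] fun z => v * (z 0 - t) + u * t := by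
  filter_upwards [(continuous_coord 0).continuousAt.eventually_const_lt hx] with z hz
  exact if_neg (not_lt.2 hz.le)

lemma gradient_eq_smul_axis {φ : Space → ℝ} {s : ℝ} {x : Space}
    (h : HasFDerivAt φ (s • (EuclideanSpace.proj 0 : Space →L[ℝ] ℝ)) x) :
    gradient φ x = s • axis := by
  refine ext_inner_right ℝ fun k => ?_
  rw [inner_gradient_left, h.fderiv, inner_smul_left, axis_inner]
  rfl

lemma gradient_flatShock_of_lt {x : Space} (hx : x 0 < t) :
    gradient (flatShock u v t) x = u • axis :=
  gradient_eq_smul_axis (((EuclideanSpace.proj 0 : Space →L[ℝ] ℝ).hasFDerivAt.const_mul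
    u).congr_of_eventuallyEq (flatShock_eventuallyEq_of_lt hx))

lemma gradient_flatShock_of_gt {x : Space} (hx : t < x 0) :
    gradient (flatShock u v t) x = v • axis :=
  gradient_eq_smul_axis (((((EuclideanSpace.proj 0 : Space →L[ℝ] ℝ).hasFDerivAt.sub_const
    t).const_mul v).add_const (u * t)).congr_of_eventuallyEq (flatShock_eventuallyEq_of_gt hx))

lemma gradient_flatShock_eventuallyEq {x : Space} (hx : x 0 ≠ t) :
    ∃ s, (s = u ∧ x 0 < t ∨ s = v ∧ t < x 0) ∧
      gradient (flatShock u v t) =ᶠ[𝓝 x] fun _ => s • axis := by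
  rcases hx.lt_or_gt with hx | hx
  · refine ⟨u, Or.inl ⟨rfl, hx⟩, ?_⟩
    filter_upwards [(continuous_coord 0).continuousAt.eventually_lt_const hx] with z hz
    exact gradient_flatShock_of_lt hz
  · refine ⟨v, Or.inr ⟨rfl, hx⟩, ?_⟩
    filter_upwards [(continuous_coord 0).continuousAt.eventually_const_lt hx] with z hz
    exact gradient_flatShock_of_gt hz

/-- As the slope drops from `u` to `v`, the potential is concave in the axial variable; as a minimum
of two affine functions it is globally Lipschitz. -/
lemma flatShock_eq_min (hvu : v < u) (x : Space) :
    flatShock u v t x = min (u * x 0) (v * (x 0 - t) + u * t) := by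
  unfold flatShock
  split_ifs with hx
  · rw [min_eq_left]; nlinarith
  · rw [min_eq_right]; nlinarith [not_lt.1 hx]

lemma exists_lipschitzWith_flatShock (hvu : v < u) : ∃ K, LipschitzWith K (flatShock u v t) := by
  have h1 := (u • (EuclideanSpace.proj 0 : Space →L[ℝ] ℝ)).lipschitz
  have h2 := ((v • (EuclideanSpace.proj 0 : Space →L[ℝ] ℝ)).lipschitz).add
    (LipschitzWith.const (u * t - v * t))
  suffices e : flatShock u v t = fun x => min ((u • (EuclideanSpace.proj 0 : Space →L[ℝ] ℝ)) x)
      ((v • (EuclideanSpace.proj 0 : Space →L[ℝ] ℝ)) x + (u * t - v * t)) by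
    rw [e]; exact ⟨_, h1.min h2⟩
  ext x
  rw [flatShock_eq_min hvu]
  simp only [smul_apply, PiLp.proj_apply, smul_eq_mul]
  congr 1; ring

lemma smoothRegion_const_ne {Ω : Set Plane} {x : Space} (hx : x ∈ smoothRegion Ω fun _ => t) :
    x 0 ≠ t := by
  rcases hx with hx | hx
  · exact hx.2.ne
  · exact hx.2.ne'

/-- The gradient is locally constant off the front, so every condition becomes one on the two
speeds: Rankine-Hugoniot is the defining equation of `v`, and the entropy condition follows since
density decreases with speed. -/
theorem isTransonicShockSolution_flatShock {γ b : ℝ} (hγ : 1 ≤ γ) (hc : 0 < criticalSpeed γ b)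
    (hu : criticalSpeed γ b < u) (hb : 0 < bernoulliBase γ b (u ^ 2))
    (hv : IsDownstreamSpeed γ b u v) (ht : t ∈ Ioo (-1 : ℝ) 1) (Ω : Set Plane) :
    IsTransonicShockSolution γ b u v Ω (fun _ => t) (flatShock u v t) := by
  obtain ⟨hv0, hvc, hflux⟩ := hv
  have hvu : v < u := hvc.trans hu
  have hu0 : 0 < u := hc.trans hu
  have hbv : 0 < bernoulliBase γ b (v ^ 2) := bernoulliBase_pos_of_le hγ hc hv0.le hvc.le
  have hun := norm_smul_axis hu0.le
  have hvn := norm_smul_axis hv0.le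
  refine ⟨contDiffOn_const, ?_, ?_, ⟨0, ?_⟩, ?_, ?_, ?_, ?_, ?_, ?_, ?_, ?_, ?_⟩
  · obtain ⟨K, hK⟩ := exists_lipschitzWith_flatShock (t := t) hvu
    exact ⟨K, hK.lipschitzOnWith⟩
  · intro x hx
    have hp : ContDiff ℝ 2 fun z : Space => z 0 :=
      (EuclideanSpace.proj 0 : Space →L[ℝ] ℝ).contDiff
    refine ContDiffAt.contDiffWithinAt ?_
    rcases (smoothRegion_const_ne hx).lt_or_gt with h | h
    · exact (contDiff_const.mul hp).contDiffAt.congr_of_eventuallyEq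
        (flatShock_eventuallyEq_of_lt h)
    · exact ((contDiff_const.mul (hp.sub contDiff_const)).add
        contDiff_const).contDiffAt.congr_of_eventuallyEq (flatShock_eventuallyEq_of_gt h)
  · intro x hx
    obtain ⟨s, -, hs⟩ := gradient_flatShock_eventuallyEq (u := u) (v := v)
      (smoothRegion_const_ne hx)
    rw [hs.fderiv_eq]; simp
  · intro x hx
    rcases (smoothRegion_const_ne hx).lt_or_gt with h | h
    · rwa [gradient_flatShock_of_lt h, hun]
    · rwa [gradient_flatShock_of_gt h, hvn]
  · intro x hx
    rw [gradient_flatShock_of_lt hx.2, hun]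
    exact soundSpeed_lt_of_criticalSpeed_lt hγ hc hb hu
  · intro x hx
    rw [gradient_flatShock_of_gt hx.2, hvn]
    exact lt_soundSpeed_of_lt_criticalSpeed hγ hc hv0.le hvc
  · intro x hx
    obtain ⟨s, -, hs⟩ := gradient_flatShock_eventuallyEq (u := u) (v := v)
      (smoothRegion_const_ne hx)
    have : (fun z => massFlux γ b (gradient (flatShock u v t) z)) =ᶠ[𝓝 x]
        fun _ => massFlux γ b (s • axis) := hs.fun_comp (massFlux γ b)
    rw [divergence]
    simp [this.fderiv_eq]
  · intro x hx
    have h0 : x 0 < t := hx.1.trans_lt ht.1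
    have h1 : Tendsto (fun z : Space => u * z 0) (𝓝 x) (𝓝 (u * x 0)) :=
      (continuous_const.mul (continuous_coord 0)).tendsto x
    rw [hx.1, mul_neg_one] at h1
    exact (h1.congr' (flatShock_eventuallyEq_of_lt h0).symm).mono_left nhdsWithin_le_nhds
  · intro x hx
    refine (tendsto_const_nhds.congr' ?_).mono_left nhdsWithin_le_nhds
    filter_upwards [(continuous_coord 0).continuousAt.eventually_lt_const
      (hx.1.trans_lt ht.1)] with z hz
    rw [gradient_flatShock_of_lt hz]; simp
  · intro x hx
    refine (tendsto_const_nhds.congr' ?_).mono_left nhdsWithin_le_nhds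
    filter_upwards [(continuous_coord 0).continuousAt.eventually_const_lt
      (ht.2.trans_eq hx.1.symm)] with z hz
    rw [gradient_flatShock_of_gt hz, hvn]
  · intro x _ n _
    refine tendsto_const_nhds.congr' ?_
    filter_upwards [self_mem_nhdsWithin] with z hz
    have key : ∀ s : ℝ, 0 = inner ℝ (s • axis) (embed n) := fun s => by
      rw [inner_smul_left, axis_inner, embed_zero_coord, mul_zero]
    rcases (smoothRegion_const_ne hz).lt_or_gt with h | h
    · rw [gradient_flatShock_of_lt h]; exact key u
    · rw [gradient_flatShock_of_gt h]; exact key v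
  · intro x _
    refine ⟨u • axis, v • axis, tendsto_const_nhds.congr' ?_, tendsto_const_nhds.congr' ?_, ?_,
      ?_, ?_⟩
    · filter_upwards [self_mem_nhdsWithin] with z hz using (gradient_flatShock_of_lt hz.2).symm
    · filter_upwards [self_mem_nhdsWithin] with z hz using (gradient_flatShock_of_gt hz.2).symm
    · rw [massFlux_smul_axis hu0.le, massFlux_smul_axis hv0.le, hflux]
    · rw [hun, hvn]
      exact density_lt_density hγ (by nlinarith) hb
    · rwa [hun, hvn]

theorem noBackflow_flatShock (hu : 0 ≤ u) (hv : 0 ≤ v) (ht : t ∈ Ioo (-1 : ℝ) 1)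
    (Ω : Set Plane) : NoBackflow Ω (fun _ => t) (flatShock u v t) := by
  rintro x (hx | hx)
  · refine ⟨u, hu, (tendsto_const_nhds.congr' ?_).mono_left nhdsWithin_le_nhds⟩
    filter_upwards [(continuous_coord 0).continuousAt.eventually_lt_const
      (hx.1.trans_lt ht.1)] with z hz
    rw [gradient_flatShock_of_lt hz]; simp
  · refine ⟨v, hv, (tendsto_const_nhds.congr' ?_).mono_left nhdsWithin_le_nhds⟩
    filter_upwards [(continuous_coord 0).continuousAt.eventually_const_lt
      (ht.2.trans_eq hx.1.symm)] with z hz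
    rw [gradient_flatShock_of_gt hz]; simp

end FlatShock

end TransonicDuct

end

/-! ### The theorem -/

theorem theorem1p1 (γ b₀ u : ℝ) (hγ : 1 ≤ γ)
    (hu : TransonicDuct.criticalSpeed γ b₀ < u)
    (hu' : 1 < γ → u < Real.sqrt (2 * (b₀ + 1 / (γ - 1)))) :
    (∃! v : ℝ, TransonicDuct.IsDownstreamSpeed γ b₀ u v) ∧
    ∀ v : ℝ, TransonicDuct.IsDownstreamSpeed γ b₀ u v →
      ∀ Ω : Set TransonicDuct.Plane, TransonicDuct.IsCrossSection Ω →
        ∀ c₁ : ℝ, 0 < c₁ → c₁ < TransonicDuct.criticalSpeed γ b₀ →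
          ((∃ f φ, TransonicDuct.IsTransonicShockSolution γ b₀ u c₁ Ω f φ ∧
              TransonicDuct.NoBackflow Ω f φ) ↔ c₁ = v) ∧
          (∀ f φ, TransonicDuct.IsTransonicShockSolution γ b₀ u c₁ Ω f φ →
            TransonicDuct.NoBackflow Ω f φ →
              ∃ t ∈ Set.Ioo (-1 : ℝ) 1, (∀ y ∈ closure Ω, f y = t) ∧
                ∀ x ∈ TransonicDuct.duct Ω, φ x = TransonicDuct.flatShock u v t x) ∧
          (c₁ = v → ∀ t ∈ Set.Ioo (-1 : ℝ) 1,
            TransonicDuct.IsTransonicShockSolution γ b₀ u c₁ Ω (fun _ => t)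
                (TransonicDuct.flatShock u v t) ∧
              TransonicDuct.NoBackflow Ω (fun _ => t) (TransonicDuct.flatShock u v t)) := by
  obtain ⟨hc, hb⟩ := TransonicDuct.criticalSpeed_pos_and_base_pos hγ hu hu'
  refine ⟨TransonicDuct.existsUnique_isDownstreamSpeed hγ hc hu hb, ?_⟩
  intro v hv Ω hΩ c₁ _ hc₁
  have flat : c₁ = v → ∀ t ∈ Set.Ioo (-1 : ℝ) 1,
      TransonicDuct.IsTransonicShockSolution γ b₀ u c₁ Ω (fun _ => t)
          (TransonicDuct.flatShock u v t) ∧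
        TransonicDuct.NoBackflow Ω (fun _ => t) (TransonicDuct.flatShock u v t) := by
    rintro rfl t ht
    exact ⟨TransonicDuct.isTransonicShockSolution_flatShock hγ hc hu hb hv ht Ω,
      TransonicDuct.noBackflow_flatShock (hc.trans hu).le hv.1.le ht Ω⟩
  -- For existence any front position in the duct would do; `0` is chosen.
  refine ⟨⟨?_, fun h => ⟨_, _, flat h 0 (by norm_num)⟩⟩, ?_, flat⟩
  · rintro ⟨f, φ, hsol, hH⟩
    exact TransonicDuct.IsFlow.exit_speed_eq ⟨hγ, hc, hu, hb, hΩ, hc₁, hsol⟩ hv hH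
  · intro f φ hsol hH
    exact TransonicDuct.IsFlow.eq_flatShock ⟨hγ, hc, hu, hb, hΩ, hc₁, hsol⟩ hv hH
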